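/- By a local field we mean a non-archimedean local field $K$ (of any characteristic); $q_K$ is the size of its residue field, $K^{\mathrm{sep}}$ a separable closure, $\mathcal{O}_K$ its ring of integers with maximal ideal $\wp_K$. For a finite group $\Gamma$ let $S_{K,\Gamma}$ be the set of continuous homomorphisms $\mathrm{Gal}(K^{\mathrm{sep}}/K)\to\Gamma$, with $\Gamma$ discrete. A counting function $c$ for $\Gamma$ assigns to each $\rho\in S_{K,\Gamma}$, for every local field $K$, an integer $c(\rho)\ge 0$ with $c(\gamma\rho\gamma^{-1})=c(\rho)$ for all $\gamma\in\Gamma$. Its total mass at $K$ is $$M(K,\Gamma,c)=\sum_{\rho\in S_{K,\Gamma}} q_K^{-c(\rho)}\in[0,\infty],$$ and $(\Gamma,c)$ has a mass formula for all local fields if there is a polynomial $f\in\mathbb{Z}[x]$ such that $M(K,\Gamma,c)=f(1/q_K)$ for every local field $K$. Let $D_4\subset S_4$ be the dihedral group generated by $(1\,2\,3\,4)$ and $(1\,3)$. A homomorphism $\rho\in S_{K,D_4}$ defines an action of $\mathrm{Gal}(K^{\mathrm{sep}}/K)$ on four letters, and hence an étale $K$-algebra $L_\rho$ of degree $4$ (the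 direct sum, over the orbits, of the fixed fields of the stabilizers of one letter in each orbit). Let $d(\rho)$ be its discriminant exponent: $\wp_K^{d(\rho)}=\mathrm{Disc}(L_\rho|K)$. Then: 1. For every local field $K$ with $q_K$ odd, $$M(K,D_4,d)=8+\frac{8}{q_K}+\frac{16}{q_K^2}+\frac{8}{q_K^3}.$$ 2. The value of $8+\frac{8}{q}+\frac{16}{q^2}+\frac{8}{q^3}$ at $q=2$ is $17$, whereas $q_{\mathbb{Q}_2}=2$ and $M(\mathbb{Q}_2,D_4,d)=\frac{121}{8}$. 3. $(D_4,d)$ does not have a mass formula for all local fields. -/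

import Mathlib

open scoped ENNReal Topology

namespace LocalMass

open ValuativeRel

universe u

theorem padic_valuation_lt_iff {p : ℕ} [Fact p.Prime] (x y : ℚ_[p]) :
    valuation ℚ_[p] x < valuation ℚ_[p] y ↔ ‖x‖ < ‖y‖ := by
  rw [(ValuativeRel.isEquiv (valuation ℚ_[p]) Padic.mulValuation).lt_iff_lt]
  have hp : 1 < (p : ℝ) := by exact_mod_cast (Fact.out : p.Prime).one_lt
  by_cases hx : x = 0
  · subst hx
    simp [zero_lt_iff]
  by_cases hy : y = 0
  · subst hy
    simp
  rw [Padic.norm_eq_zpow_log_mulValuation hx, Padic.norm_eq_zpow_log_mulValuation hy,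
    zpow_lt_zpow_iff_right₀ hp, WithZero.log_lt_log (by simpa) (by simpa)]

instance padicIsNonarchimedeanLocalField (p : ℕ) [Fact p.Prime] :
    IsNonarchimedeanLocalField ℚ_[p] where
  toIsValuativeTopology := by
    refine IsValuativeTopology.of_zero fun s => ?_
    rw [Metric.mem_nhds_iff]
    constructor
    · rintro ⟨ε, hε, hs⟩
      obtain ⟨x, hx0, hx⟩ := NormedField.exists_norm_lt ℚ_[p] hε
      refine ⟨Units.mk0 (valuation ℚ_[p] x) ?_, fun z hz => hs ?_⟩
      · simpa using hx0
      · rw [mem_ball_zero_iff]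
        exact ((padic_valuation_lt_iff z x).1 hz).trans hx
    · rintro ⟨γ, hs⟩
      obtain ⟨x, hx⟩ := ValuativeRel.valuation_surjective (γ : ValueGroupWithZero ℚ_[p])
      have hx0 : x ≠ 0 := fun h => γ.ne_zero (by rw [← hx, h, map_zero])
      refine ⟨‖x‖, norm_pos_iff.2 hx0, fun z hz => hs ?_⟩
      rw [mem_ball_zero_iff, ← padic_valuation_lt_iff, hx] at hz
      exact hz

/-- The absolute Galois group `Gal(K^sep / K)`, which carries the Krull topology. -/
abbrev AbsGal (K : Type u) [Field K] : Type u :=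
  SeparableClosure K ≃ₐ[K] SeparableClosure K

/-- The size `q_K` of the residue field. -/
noncomputable def residueCard (K : Type u) [Field K] [ValuativeRel K] : ℕ :=
  Nat.card 𝓀[K]

/-- `S_{K,Γ}`: the homomorphisms `Gal(K^sep / K) → Γ` that are continuous for the discrete
topology on `Γ`. -/
def GalRep (K : Type u) [Field K] (Γ : Type) [Group Γ] : Type u :=
  {ρ : AbsGal K →* Γ // Continuous[inferInstance, ⊥] ρ}

/-- The conjugate representation `γ ρ γ⁻¹`. -/
noncomputable def GalRep.conj {K : Type u} [Field K] {Γ : Type} [Group Γ] (γ : Γ) (ρ : GalRep K Γ) :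
    GalRep K Γ :=
  ⟨(MulAut.conj γ).toMonoidHom.comp ρ.1, by
    let _ : TopologicalSpace Γ := ⊥
    exact (continuous_bot (f := MulAut.conj γ)).comp ρ.2⟩

/-- A counting function for `Γ`: a function with values in the non-negative integers on the
representations to `Γ` of the absolute Galois groups of all local fields, invariant under
conjugation by elements of `Γ`. -/
structure CountingFunction (Γ : Type) [Group Γ] where
  /-- The value `c(ρ)`. -/
  toFun : ∀ (K : Type u) [Field K] [ValuativeRel K] [TopologicalSpace K]
    [IsNonarchimedeanLocalField K], GalRep K Γ → ℕ
  conj_inv : ∀ (K : Type u) [Field K] [ValuativeRel K] [TopologicalSpace K]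
    [IsNonarchimedeanLocalField K] (γ : Γ) (ρ : GalRep K Γ),
    toFun K (ρ.conj γ) = toFun K ρ

/-- The total mass `M(K, Γ, c)`, the sum of `q_K ^ (-c(ρ))` over all `ρ`, equal to `∞` if the sum
diverges. -/
noncomputable def mass (K : Type u) [Field K] [ValuativeRel K] [TopologicalSpace K]
    [IsNonarchimedeanLocalField K] {Γ : Type} [Group Γ] (c : CountingFunction.{u} Γ) : ℝ≥0∞ :=
  ∑' ρ : GalRep K Γ, 1 / (residueCard K : ℝ≥0∞) ^ c.toFun K ρ

/-- `(Γ, c)` has a mass formula for all local fields. -/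
def HasMassFormula {Γ : Type} [Group Γ] (c : CountingFunction.{u} Γ) : Prop :=
  ∃ f : Polynomial ℤ, ∀ (K : Type u) [Field K] [ValuativeRel K] [TopologicalSpace K]
    [IsNonarchimedeanLocalField K],
    mass K c ≠ ∞ ∧ (mass K c).toReal = Polynomial.aeval (1 / (residueCard K : ℝ)) f

section Discriminant

variable {K : Type u} [Field K] {n : ℕ} {Γ : Subgroup (Equiv.Perm (Fin n))}

/-- The étale `K`-algebra of degree `n` that corresponds to a representation `ρ` to a permutation
group on `n` letters: the Galois-equivariant functions from the letters to `K^sep`. Evaluation at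
one letter of each orbit identifies it with the direct sum of the fixed fields of the stabilizers
of these letters. -/
def GalRep.etaleAlgebra (ρ : GalRep K Γ) : Subalgebra K (Fin n → SeparableClosure K) where
  carrier := {x | ∀ (σ : AbsGal K) (i : Fin n), σ (x i) = x ((ρ.1 σ : Equiv.Perm (Fin n)) i)}
  mul_mem' hx hy σ i := by simp [hx σ i, hy σ i]
  add_mem' hx hy σ i := by simp [hx σ i, hy σ i]
  algebraMap_mem' r σ i := by simp

/-- The discriminant ideal of the étale algebra `L` corresponding to `ρ`: the ideal of the ring of
integers of `K` generated by the discriminants of all `n`-tuples of integral elements of `L`. -/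
noncomputable def GalRep.discIdeal [ValuativeRel K] (ρ : GalRep K Γ) : Ideal 𝒪[K] :=
  Ideal.span {a | ∃ b : Fin n → ρ.etaleAlgebra,
    (∀ i, IsIntegral 𝒪[K] (b i)) ∧ (a : K) = Algebra.discr K b}

/-- The discriminant exponent: the exponent of the maximal ideal of the ring of integers of `K`
in the discriminant ideal. -/
noncomputable def GalRep.discExponent [ValuativeRel K] (ρ : GalRep K Γ) : ℕ :=
  multiplicity (IsLocalRing.maximalIdeal 𝒪[K]) ρ.discIdeal

/-- Relabelling the letters by `γ` identifies the étale algebras of `ρ` and `γ ρ γ⁻¹`. -/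
noncomputable def GalRep.etaleAlgebraConj (γ : Γ) (ρ : GalRep K Γ) :
    (ρ.conj γ).etaleAlgebra ≃ₐ[K] ρ.etaleAlgebra where
  toFun x := ⟨fun i => x.1 ((γ : Equiv.Perm (Fin n)) i), fun σ i => by
    have := x.2 σ ((γ : Equiv.Perm (Fin n)) i)
    simpa [GalRep.conj] using this⟩
  invFun x := ⟨fun i => x.1 ((γ : Equiv.Perm (Fin n))⁻¹ i), fun σ i => by
    have := x.2 σ ((γ : Equiv.Perm (Fin n))⁻¹ i)
    simpa [GalRep.conj] using this⟩
  left_inv x := by ext i; simp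
  right_inv x := by ext i; simp
  map_mul' x y := rfl
  map_add' x y := rfl
  commutes' r := rfl

theorem GalRep.discIdeal_conj [ValuativeRel K] (γ : Γ) (ρ : GalRep K Γ) :
    (ρ.conj γ).discIdeal = ρ.discIdeal := by
  unfold GalRep.discIdeal
  congr 1
  ext a
  constructor
  · rintro ⟨b, hb, h⟩
    refine ⟨fun i => ρ.etaleAlgebraConj γ (b i), fun i =>
      (hb i).map ((ρ.etaleAlgebraConj γ).toAlgHom.restrictScalars 𝒪[K]), ?_⟩
    rw [h]
    exact Algebra.discr_eq_discr_of_algEquiv b (ρ.etaleAlgebraConj γ)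
  · rintro ⟨b, hb, h⟩
    refine ⟨fun i => (ρ.etaleAlgebraConj γ).symm (b i), fun i =>
      (hb i).map ((ρ.etaleAlgebraConj γ).symm.toAlgHom.restrictScalars 𝒪[K]), ?_⟩
    rw [h]
    exact Algebra.discr_eq_discr_of_algEquiv b (ρ.etaleAlgebraConj γ).symm

end Discriminant

/-- The counting function `d` of a permutation group given by the discriminant exponent of the
corresponding étale algebra. -/
noncomputable def discCounting {n : ℕ} (Γ : Subgroup (Equiv.Perm (Fin n))) :
    CountingFunction.{u} Γ where
  toFun _ _ _ _ _ ρ := ρ.discExponent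
  conj_inv _ _ _ _ _ γ ρ := by
    unfold GalRep.discExponent
    rw [GalRep.discIdeal_conj]

/-- The dihedral group `D₄` in `S₄`, generated by a 4-cycle `(1 2 3 4)` and `(1 3)`
(the letters are `0, 1, 2, 3` here). -/
def D4 : Subgroup (Equiv.Perm (Fin 4)) :=
  Subgroup.closure {c[0, 1, 2, 3], c[0, 2]}

end LocalMass

/-! The group `D4` preserves the partition of the letters into the blocks {0, 2} and {1, 3}. A
representation ρ therefore amounts to a tower: a quadratic étale algebra F over K, given by the
action on the blocks, and a quadratic étale algebra L over F. The ideal Disc(L|K) is the square of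
Disc(F|K) times the norm of Disc(L|F), and the mass is summed over these towers.

In characteristic other than 2, quadratic étale algebras over the fraction field of a discrete
valuation ring R are square classes. Each square class contains exactly one class, modulo squares of
units, of fundamental discriminants, and these generate the discriminant ideal; hence `DiscClass R`
stands for the set of quadratic algebras. The number of residues modulo 16π² in the class of γ is
inversely proportional to `idx γ` (`ncard_sqOrbit`), so a sum of inverse absolute discriminants
becomes a count of residues (`sum_inv_idx_mul_card`). Over all classes the sum is 2 + 2/q, whatever
the residue characteristic (`sum_inv_idx`).

If F = K × K, then ρ is a pair of quadratic characters, and these ρ contribute (2 + 2/q)²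
(`tsum_split`). If F is a field, its ring of integers is R[ω] with ω² = wω − n and w² − 4n
fundamental. This is again a discrete valuation ring of the same kind, so the quadratic algebras
over F have mass 2 + 2/q_F. Each of them arises from two ρ, and F contributes 2·|d_F|⁻²·(2 + 2/q_F),
where |d_F| is the index of the discriminant ideal (`tsum_inert`). Here q_F = q² for the unramified
field and q_F = q otherwise. The total is (2 + 2/q)² + 2(2 + 2/q²) + 2T(2 + 2/q), where T is the sum
of |d_F|⁻² over the ramified F (`tsum_eq_of_sum_unit`).

Only T is sensitive to the residue characteristic. For odd q it is 2/q². Over the 2-adic numbers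
there are two fields with |d_F| = 4 and four with |d_F| = 8, so T = 3/16 instead of 1/2. The odd
primes determine the only possible polynomial, and it fails at 1/2. -/

namespace LocalMass

/-! ### Fundamental discriminants in a valuation ring. -/

section Discriminants

variable {R : Type*} [CommRing R]

/-- The discriminants of the monic quadratic polynomials over `R`. -/
def IsDisc (γ : R) : Prop := ∃ w n : R, γ = w ^ 2 - 4 * n

/-- The discriminants that are not the product of a discriminant with the square of a non-unit. -/
def IsFundDisc (γ : R) : Prop :=
  IsDisc γ ∧ ∀ r δ : R, IsDisc δ → γ = r ^ 2 * δ → IsUnit r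

theorem IsDisc.sq_mul {γ : R} (h : IsDisc γ) (r : R) : IsDisc (r ^ 2 * γ) := by
  obtain ⟨w, n, rfl⟩ := h
  exact ⟨r * w, r ^ 2 * n, by ring⟩

theorem isDisc_four_mul (z : R) : IsDisc (4 * z) := ⟨0, -z, by ring⟩

theorem isDisc_sq (w : R) : IsDisc (w ^ 2) := ⟨w, 0, by ring⟩

theorem IsFundDisc.unit_sq_mul {γ : R} (h : IsFundDisc γ) (u : Rˣ) :
    IsFundDisc ((u : R) ^ 2 * γ) := by
  refine ⟨h.1.sq_mul _, fun r δ hδ e => ?_⟩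
  have := h.2 (↑u⁻¹ * r) δ hδ (by
    have h1 : (↑u⁻¹ : R) * u = 1 := u.inv_mul
    linear_combination (↑u⁻¹ : R) ^ 2 * e - (↑u⁻¹ * u + 1) * γ * h1)
  exact isUnit_of_mul_isUnit_right this

/-- Fundamental discriminants up to squares of units. -/
def discSetoid (R : Type*) [CommRing R] : Setoid {γ : R // IsFundDisc γ} where
  r γ γ' := ∃ u : Rˣ, (γ' : R) = (u : R) ^ 2 * γ
  iseqv :=
    { refl := fun γ => ⟨1, by simp⟩
      symm := by
        rintro γ γ' ⟨u, h⟩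
        refine ⟨u⁻¹, ?_⟩
        have h1 : (↑u⁻¹ : R) * u = 1 := u.inv_mul
        rw [h]
        linear_combination -(↑u⁻¹ * u + 1) * γ * h1
      trans := by
        rintro γ γ' γ'' ⟨u, h⟩ ⟨v, h'⟩
        exact ⟨v * u, by rw [h', h]; push_cast; ring⟩ }

/-- The classes of fundamental discriminants modulo squares of units. -/
def DiscClass (R : Type*) [CommRing R] : Type _ := Quotient (discSetoid R)

/-- The class of a fundamental discriminant. -/
def DiscClass.mk {γ : R} (h : IsFundDisc γ) : DiscClass R := Quotient.mk (discSetoid R) ⟨γ, h⟩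

/-- A representative of a class of fundamental discriminants. -/
noncomputable def DiscClass.rep (c : DiscClass R) : R := (Quotient.out c).1

theorem DiscClass.rep_fund (c : DiscClass R) : IsFundDisc c.rep := (Quotient.out c).2

@[simp] theorem DiscClass.mk_rep (c : DiscClass R) : DiscClass.mk c.rep_fund = c :=
  Quotient.out_eq c

theorem DiscClass.mk_eq_mk_iff {γ γ' : R} (h : IsFundDisc γ) (h' : IsFundDisc γ') :
    DiscClass.mk h = DiscClass.mk h' ↔ ∃ u : Rˣ, γ' = (u : R) ^ 2 * γ :=
  Quotient.eq (r := discSetoid R)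

theorem DiscClass.mk_eq_iff {γ : R} (h : IsFundDisc γ) (c : DiscClass R) :
    DiscClass.mk h = c ↔ ∃ u : Rˣ, γ = (u : R) ^ 2 * c.rep := by
  conv_lhs => rw [← c.mk_rep]
  rw [eq_comm, DiscClass.mk_eq_mk_iff]

variable [IsDomain R]

theorem IsFundDisc.ne_zero (hR : ¬ IsField R) {γ : R} (hγ : IsFundDisc γ) : γ ≠ 0 := by
  rintro rfl
  exact hR ⟨⟨0, 1, zero_ne_one⟩, mul_comm, fun {a} ha =>
    absurd (hγ.2 0 0 ⟨0, 0, by ring⟩ (by ring)) not_isUnit_zero⟩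

/-- Squares of non-units are split off as long as the cofactor is a discriminant. Each step passes
to a strict divisor, so the process ends in a Noetherian domain. -/
theorem exists_fundDisc [IsNoetherianRing R] {δ : R} (h0 : δ ≠ 0) (hδ : IsDisc δ) :
    ∃ r γ : R, r ≠ 0 ∧ IsFundDisc γ ∧ δ = r ^ 2 * γ := by
  induction δ using (wellFounded_dvdNotUnit (α := R)).induction with
  | _ δ ih =>
    by_cases hf : IsFundDisc δ
    · exact ⟨1, δ, one_ne_zero, hf, by ring⟩
    · simp only [IsFundDisc, hδ, true_and, not_forall] at hf
      obtain ⟨r, δ', hδ', e, hr⟩ := hf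
      have hr0 : r ≠ 0 := by rintro rfl; simp [e] at h0
      have hδ0 : δ' ≠ 0 := by rintro rfl; simp [e] at h0
      obtain ⟨s, γ, hs, hγ, e'⟩ := ih δ' ⟨hδ0, r ^ 2, by simpa using hr, by rw [e]; ring⟩ hδ0 hδ'
      exact ⟨r * s, γ, mul_ne_zero hr0 hs, hγ, by rw [e, e']; ring⟩

variable [ValuationRing R]

/-- Otherwise 2 = (w − w')c with c a non-unit. Then w² − w'² = (w − w')²(1 + cw') while 4 = (w −
w')²c², so c would divide the unit 1 + cw'. Thus a discriminant w² − 4n determines w modulo 2. -/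
theorem two_dvd_sub_of_four_dvd_sq_sub {w w' : R} (h : (4 : R) ∣ w ^ 2 - w' ^ 2) :
    (2 : R) ∣ w - w' := by
  rcases ValuationRing.dvd_total (2 : R) (w - w') with h2 | ⟨c, hc⟩
  · exact h2
  by_cases hcu : IsUnit c
  · obtain ⟨c, rfl⟩ := hcu
    exact ⟨↑c⁻¹, by rw [hc, mul_assoc, c.mul_inv, mul_one]⟩
  have hu : IsUnit (1 + c * w') := by
    by_contra hn
    have h1 : (1 : R) ∈ IsLocalRing.maximalIdeal R := by
      have := sub_mem ((IsLocalRing.mem_maximalIdeal _).2 hn)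
        (Ideal.mul_mem_right w' _ ((IsLocalRing.mem_maximalIdeal _).2 hcu))
      simp only [add_sub_cancel_right] at this
      exact this
    exact (Ideal.ne_top_iff_one _).1 (IsLocalRing.maximalIdeal.isMaximal R).ne_top h1
  obtain ⟨z, hz⟩ := h
  obtain ⟨v, hv⟩ := hu
  by_cases ha : w - w' = 0
  · simp [ha]
  exfalso
  apply hcu
  have h4 : (w - w') ^ 2 * (1 + c * w') = (w - w') ^ 2 * (c ^ 2 * z) := by
    linear_combination hz + (-w' * (w - w') + z * (2 + (w - w') * c)) * hc
  have h5 := mul_left_cancel₀ (pow_ne_zero 2 ha) h4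
  refine isUnit_of_dvd_unit (Dvd.intro (c * z) ?_) v.isUnit
  rw [hv, h5]; ring

/-- Of a and b one divides the other. If b = ac, then γ = c²δ, and fundamentality makes c a unit. So
a fundamental discriminant divides every discriminant of its square class with a square quotient. -/
theorem IsFundDisc.dvd_of_sq_mul_eq {γ δ a b : R} (hγ : IsFundDisc γ) (hδ : IsDisc δ)
    (h : b ^ 2 * δ = a ^ 2 * γ) : b ∣ a := by
  rcases ValuationRing.dvd_total b a with h1 | ⟨c, rfl⟩
  · exact h1
  by_cases ha : a = 0
  · simp [ha]
  have h2 : γ = c ^ 2 * δ := by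
    apply mul_left_cancel₀ (pow_ne_zero 2 ha)
    rw [← h]; ring
  obtain ⟨c, rfl⟩ := hγ.2 c δ hδ h2
  exact ⟨↑c⁻¹, by rw [mul_assoc, c.mul_inv, mul_one]⟩

/-- Divisibility in both directions shows that two fundamental discriminants in one square class
differ by the square of a unit. This is the uniqueness that lets classes stand for quadratic
algebras. -/
theorem IsFundDisc.exists_unit {γ δ a b : R} (hγ : IsFundDisc γ) (hδ : IsFundDisc δ)
    (ha : a ≠ 0) (h : b ^ 2 * δ = a ^ 2 * γ) : ∃ u : Rˣ, a = b * u ∧ δ = (u : R) ^ 2 * γ := by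
  obtain ⟨c, rfl⟩ := hγ.dvd_of_sq_mul_eq hδ.1 h
  have hb : b ≠ 0 := left_ne_zero_of_mul ha
  obtain ⟨d, hd⟩ := hδ.dvd_of_sq_mul_eq hγ.1 h.symm
  have hcd : c * d = 1 := by
    apply mul_left_cancel₀ hb
    rw [mul_one, ← mul_assoc]; exact hd.symm
  refine ⟨⟨c, d, hcd, by rw [mul_comm]; exact hcd⟩, rfl, ?_⟩
  apply mul_left_cancel₀ (pow_ne_zero 2 hb)
  simp only
  rw [h]; ring

end Discriminants

/-! ### Indices of principal ideals. -/

section Index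

/-- The index of the principal ideal generated by `x`. -/
noncomputable def idx {R : Type*} [CommRing R] (x : R) : ℕ := Nat.card (R ⧸ Ideal.span {x})

variable {R : Type*} [CommRing R]

theorem idx_eq_index (x : R) : idx x = (Ideal.span {x}).toAddSubgroup.index := rfl

theorem idx_of_isUnit {u : R} (h : IsUnit u) : idx u = 1 := by
  rw [idx_eq_index, Ideal.span_singleton_eq_top.2 h]
  exact AddSubgroup.index_top

variable [IsDomain R]

/-- Indices multiply along (ab) ⊆ (a) ⊆ R, and multiplication by a identifies R/(b) with (a)/(ab).
-/
theorem idx_mul {a : R} (ha : a ≠ 0) (b : R) : idx (a * b) = idx a * idx b := by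
  have h1 : (Ideal.span {b}).toAddSubgroup =
      (Ideal.span {a * b}).toAddSubgroup.comap (AddMonoidHom.mulLeft a) := by
    ext x
    change x ∈ Ideal.span {b} ↔ a * x ∈ Ideal.span {a * b}
    rw [Ideal.mem_span_singleton, Ideal.mem_span_singleton, mul_dvd_mul_iff_left ha]
  have h2 : (AddMonoidHom.mulLeft a).range = (Ideal.span {a}).toAddSubgroup := by
    ext x
    change (∃ y, a * y = x) ↔ x ∈ Ideal.span {a}
    rw [Ideal.mem_span_singleton]
    exact ⟨fun ⟨y, h⟩ => ⟨y, h.symm⟩, fun ⟨y, h⟩ => ⟨y, h.symm⟩⟩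
  rw [idx_eq_index, idx_eq_index b, h1, AddSubgroup.index_comap, h2,
    mul_comm (idx a), idx_eq_index, AddSubgroup.relIndex_mul_index]
  exact Ideal.span_singleton_le_span_singleton.2 (dvd_mul_right a b)

theorem idx_unit_mul (u : Rˣ) (x : R) : idx (u * x) = idx x := by
  rw [idx_mul u.ne_zero, idx_of_isUnit u.isUnit, one_mul]

theorem idx_pow {a : R} (ha : a ≠ 0) (n : ℕ) : idx (a ^ n) = idx a ^ n := by
  induction n with
  | zero => simpa using idx_of_isUnit isUnit_one
  | succ n ih => rw [pow_succ, idx_mul (pow_ne_zero n ha), ih, pow_succ]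

/-- The multiples of `x` modulo `x * y` are as many as the residues modulo `y`. -/
theorem card_range_mul {x : R} (hx : x ≠ 0) (y : R) :
    (Set.range fun r : R => Ideal.Quotient.mk (Ideal.span {x * y}) (x * r)).ncard = idx y := by
  let f : R →ₗ[R] R ⧸ Ideal.span {x * y} :=
    (Ideal.span {x * y}).mkQ.comp (LinearMap.mulLeft R x)
  have hk : f.ker = Ideal.span {y} := by
    ext r
    rw [LinearMap.mem_ker, Ideal.mem_span_singleton, ← mul_dvd_mul_iff_left hx,
      ← Ideal.mem_span_singleton]
    exact Ideal.Quotient.eq_zero_iff_mem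
  rw [idx, ← hk, Nat.card_congr f.quotKerEquivRange.toEquiv]
  rfl

variable [IsDiscreteValuationRing R]

theorem idx_irreducible {π : R} (h : Irreducible π) :
    idx π = Nat.card (IsLocalRing.ResidueField R) := by
  rw [idx, ← h.maximalIdeal_eq]; rfl

/-- `Nat.card` takes the value 0 on infinite types, so this is the finiteness of the quotient. -/
theorem idx_ne_zero [Finite (IsLocalRing.ResidueField R)] {x : R} (hx : x ≠ 0) : idx x ≠ 0 := by
  obtain ⟨π, hπ⟩ := IsDiscreteValuationRing.exists_irreducible R
  obtain ⟨n, u, rfl⟩ := IsDiscreteValuationRing.eq_unit_mul_pow_irreducible hx hπ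
  rw [idx_unit_mul, idx_pow hπ.ne_zero, idx_irreducible hπ]
  exact pow_ne_zero _ Nat.card_pos.ne'

end Index

end LocalMass

/-! ### Sizes of the classes of fundamental discriminants modulo 16π². -/

namespace LocalMass

open IsLocalRing

/-- The discrete valuation rings for which the mass of the quadratic characters is computed: the
residue field is finite, the characteristic is not `2`, and elements close to `1` are squares. -/
class QuadHenselian (R : Type*) [CommRing R] [IsDomain R] [IsDiscreteValuationRing R] : Prop where
  finite_residueField : Finite (ResidueField R)
  two_ne_zero : (2 : R) ≠ 0
  exists_sq_eq : ∀ z ∈ maximalIdeal R, ∃ u : R, u ^ 2 = 1 + 4 * z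

attribute [instance] QuadHenselian.finite_residueField

/-- The orbit-stabilizer theorem for an action through a homomorphism; below this is the squaring
map on the units of a quotient ring. -/
theorem ncard_orbit_mul_ncard_stabilizer {G H X : Type*} [Group G] [Group H] [MulAction H X]
    (φ : G →* H) (x : X) :
    (Set.range fun g : G => φ g • x).ncard * {g : G | φ g • x = x}.ncard = Nat.card G := by
  let _ : MulAction G X := MulAction.compHom X φ
  rw [← Subgroup.index_mul_card (MulAction.stabilizer G x), MulAction.index_stabilizer]
  rfl

section Counting

variable {R : Type*} [CommRing R] [IsDomain R] [IsDiscreteValuationRing R]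

theorem isUnit_one_add {x : R} (hx : x ∈ maximalIdeal R) : IsUnit (1 + x) := by
  by_contra hn
  have := sub_mem ((mem_maximalIdeal _).2 hn) hx
  simp only [add_sub_cancel_right] at this
  exact (Ideal.ne_top_iff_one _).1 (maximalIdeal.isMaximal R).ne_top this

theorem isUnit_mk_iff {D : R} (hD : D ∈ maximalIdeal R) (a : R) :
    IsUnit (Ideal.Quotient.mk (Ideal.span {D}) a) ↔ IsUnit a := by
  refine ⟨fun h => ?_, fun h => h.map _⟩
  obtain ⟨b, hb⟩ := h.exists_right_inv
  obtain ⟨b, rfl⟩ := Ideal.Quotient.mk_surjective b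
  rw [← map_mul, ← map_one (Ideal.Quotient.mk _), Ideal.Quotient.eq,
    Ideal.mem_span_singleton] at hb
  obtain ⟨c, hc⟩ := hb
  have h1 : IsUnit (a * b) := by
    rw [show a * b = 1 + D * c by linear_combination hc]
    exact isUnit_one_add (Ideal.mul_mem_right _ _ hD)
  exact isUnit_of_mul_isUnit_left h1

/-- A multiple of 4π² is π² times the discriminant 4y, hence not fundamental. So the valuation of γ
is at most that of 4π. -/
theorem IsFundDisc.dvd_four_mul {γ π : R} (hγ : IsFundDisc γ) (hπ : Irreducible π) :
    γ ∣ 4 * π := by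
  rcases ValuationRing.dvd_total γ (4 * π) with h | ⟨z, rfl⟩
  · exact h
  by_cases hz : IsUnit z
  · obtain ⟨z, rfl⟩ := hz
    exact ⟨↑z⁻¹, by rw [mul_assoc, z.mul_inv, mul_one]⟩
  · have hz' : z ∈ maximalIdeal R := (mem_maximalIdeal _).2 hz
    rw [hπ.maximalIdeal_eq, Ideal.mem_span_singleton] at hz'
    obtain ⟨y, rfl⟩ := hz'
    exact absurd (hγ.2 π (4 * y) (isDisc_four_mul y) (by ring)) hπ.not_isUnit

variable [QuadHenselian R]

theorem two_ne_zero_of_quadHenselian : (2 : R) ≠ 0 := QuadHenselian.two_ne_zero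

theorem four_ne_zero_of_quadHenselian : (4 : R) ≠ 0 := by
  have : (4 : R) = 2 * 2 := by norm_num
  rw [this]
  exact mul_ne_zero two_ne_zero_of_quadHenselian two_ne_zero_of_quadHenselian

/-- Write 4π = γh. Then γ + 16π²z = γ(1 + 4πhz), and the second factor is a square. Hence the class
of a fundamental discriminant depends only on its residue modulo 16π². -/
theorem IsFundDisc.exists_unit_of_congr {γ π : R} (hγ : IsFundDisc γ) (hπ : Irreducible π)
    (z : R) : ∃ u : Rˣ, γ + 16 * π ^ 2 * z = (u : R) ^ 2 * γ := by
  obtain ⟨h, hh⟩ := hγ.dvd_four_mul hπ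
  have hm : π * (h * z) ∈ maximalIdeal R := by
    rw [hπ.maximalIdeal_eq]
    exact Ideal.mul_mem_right _ _ (Ideal.mem_span_singleton_self π)
  obtain ⟨u, hu⟩ := QuadHenselian.exists_sq_eq _ hm
  have hu' : IsUnit (u ^ 2) := by
    rw [hu]; exact isUnit_one_add (Ideal.mul_mem_left _ _ hm)
  refine ⟨((isUnit_pow_iff two_ne_zero).1 hu').unit, ?_⟩
  simp only [IsUnit.unit_spec]
  rw [hu]
  linear_combination (4 * π * z) * hh

/-- The unit square multiples of `γ` modulo `16 π ^ 2`. -/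
def sqOrbit (γ π : R) : Set (R ⧸ Ideal.span {16 * π ^ 2}) :=
  Ideal.Quotient.mk _ '' {δ | ∃ u : Rˣ, δ = (u : R) ^ 2 * γ}

/-- The non-units are the multiples of π, a fraction 1/q of the quotient; their number is the index
of 16π. -/
theorem card_units_quotient {π : R} (hπ : Irreducible π) :
    Nat.card (R ⧸ Ideal.span {16 * π ^ 2})ˣ =
      (Nat.card (ResidueField R) - 1) * (idx (4 : R) ^ 2 * Nat.card (ResidueField R)) := by
  have h4 := four_ne_zero_of_quadHenselian (R := R)
  have h16 : (16 : R) * π ≠ 0 := by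
    rw [show (16 : R) = 4 * 4 by norm_num]
    exact mul_ne_zero (mul_ne_zero h4 h4) hπ.ne_zero
  have hD : (16 : R) * π ^ 2 ∈ maximalIdeal R := by
    rw [hπ.maximalIdeal_eq, Ideal.mem_span_singleton]
    exact ⟨16 * π, by ring⟩
  have hidx : idx (16 * π : R) = idx (4 : R) ^ 2 * Nat.card (ResidueField R) := by
    rw [show (16 : R) * π = 4 * (4 * π) by ring, idx_mul h4, idx_mul h4, idx_irreducible hπ]
    ring
  have hN : idx (16 * π ^ 2 : R) = Nat.card (ResidueField R) * idx (16 * π) := by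
    rw [show (16 : R) * π ^ 2 = π * (16 * π) by ring, idx_mul hπ.ne_zero, idx_irreducible hπ]
  have hfin : Finite (R ⧸ Ideal.span {16 * π ^ 2}) := by
    apply Nat.finite_of_card_ne_zero
    change idx (16 * π ^ 2 : R) ≠ 0
    exact idx_ne_zero (by rw [show (16 : R) * π ^ 2 = 16 * π * π by ring]
                          exact mul_ne_zero h16 hπ.ne_zero)
  have h1 : Nat.card (R ⧸ Ideal.span {16 * π ^ 2})ˣ =
      {x : R ⧸ Ideal.span {16 * π ^ 2} | IsUnit x}.ncard :=
    Nat.card_congr ⟨fun u => ⟨u, u.isUnit⟩, fun x => IsUnit.unit x.2, fun u => by ext; rfl,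
      fun x => rfl⟩
  have h2 : {x : R ⧸ Ideal.span {16 * π ^ 2} | IsUnit x}ᶜ =
      Set.range fun r : R => Ideal.Quotient.mk (Ideal.span {16 * π ^ 2}) (π * r) := by
    ext x
    obtain ⟨a, rfl⟩ := Ideal.Quotient.mk_surjective x
    rw [Set.mem_compl_iff, Set.mem_ofPred_eq, isUnit_mk_iff hD, ← mem_nonunits_iff,
      ← mem_maximalIdeal, hπ.maximalIdeal_eq, Ideal.mem_span_singleton]
    constructor
    · rintro ⟨r, rfl⟩
      exact ⟨r, rfl⟩
    · rintro ⟨r, hr⟩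
      rw [Ideal.Quotient.eq, Ideal.mem_span_singleton] at hr
      obtain ⟨c, hc⟩ := hr
      exact ⟨r - 16 * π * c, by linear_combination -hc⟩
  have h3 : ({x : R ⧸ Ideal.span {16 * π ^ 2} | IsUnit x}ᶜ).ncard = idx (16 * π) := by
    rw [h2]
    have := card_range_mul hπ.ne_zero (16 * π)
    rw [show π * (16 * π) = 16 * π ^ 2 by ring] at this
    exact this
  have h5 := Set.ncard_add_ncard_compl {x : R ⧸ Ideal.span {16 * π ^ 2} | IsUnit x}
  have h6 : Nat.card (R ⧸ Ideal.span {16 * π ^ 2}) = idx (16 * π ^ 2) := rfl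
  rw [h3, h6, hN, hidx] at h5
  rw [h1, Nat.sub_mul, one_mul]
  omega

/-- The units of the quotient act on the residue of γ through their squares. The stabilizer consists
of the residues congruent to 1 or to −1 modulo 2g, where 16π² = 2g·2γ. These are two disjoint cosets
with `idx (2 * γ)` elements each, so the orbit is smaller in proportion to `idx γ`. -/
theorem ncard_sqOrbit {γ π : R} (hγ : IsFundDisc γ) (hπ : Irreducible π) :
    (sqOrbit γ π).ncard * (2 * (idx (2 : R) * idx γ)) =
      Nat.card (R ⧸ Ideal.span {16 * π ^ 2})ˣ := by
  classical
  obtain ⟨h, hh⟩ := hγ.dvd_four_mul hπ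
  have h2 := two_ne_zero_of_quadHenselian (R := R)
  have hγ0 : γ ≠ 0 := hγ.ne_zero (IsDiscreteValuationRing.not_isField R)
  have hh0 : h ≠ 0 := by
    rintro rfl
    rw [mul_zero] at hh
    exact mul_ne_zero four_ne_zero_of_quadHenselian hπ.ne_zero hh
  have hπm : π ∈ maximalIdeal R := by
    rw [hπ.maximalIdeal_eq]; exact Ideal.mem_span_singleton_self π
  have hD : (16 : R) * π ^ 2 ∈ maximalIdeal R := by
    rw [hπ.maximalIdeal_eq, Ideal.mem_span_singleton]
    exact ⟨16 * π, by ring⟩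
  -- The extra factor π keeps g in the maximal ideal even if h is a unit. This makes the two cosets
  -- disjoint and exactly one of t and t + 1 below a unit.
  obtain ⟨g, hg⟩ : ∃ g, g = h * π := ⟨_, rfl⟩
  have hgm : g ∈ maximalIdeal R := hg ▸ Ideal.mul_mem_left _ _ hπm
  have hg0 : g ≠ 0 := hg ▸ mul_ne_zero hh0 hπ.ne_zero
  have hDg : (16 : R) * π ^ 2 = 2 * g * (2 * γ) := by
    rw [hg]; linear_combination (4 * π) * hh
  set P := R ⧸ Ideal.span {16 * π ^ 2} with hP
  set mk : R →+* P := Ideal.Quotient.mk (Ideal.span {16 * π ^ 2}) with hmk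
  have hmk_eq : ∀ a b : R, mk a = mk b ↔ (2 * g * (2 * γ)) ∣ a - b := fun a b => by
    rw [hmk, Ideal.Quotient.eq, Ideal.mem_span_singleton, hDg]
  have hfin : Finite P := by
    apply Nat.finite_of_card_ne_zero
    change idx (16 * π ^ 2 : R) ≠ 0
    rw [hDg]
    exact idx_ne_zero (mul_ne_zero (mul_ne_zero h2 hg0) (mul_ne_zero h2 hγ0))
  have horb : (Set.range fun u : Pˣ => powMonoidHom 2 u • mk γ) = sqOrbit γ π := by
    ext x
    constructor
    · rintro ⟨u, rfl⟩
      obtain ⟨a, ha⟩ := Ideal.Quotient.mk_surjective (u : P)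
      have hau : IsUnit a := (isUnit_mk_iff hD a).1 (ha ▸ u.isUnit)
      refine ⟨a ^ 2 * γ, ⟨hau.unit, rfl⟩, ?_⟩
      simp only [powMonoidHom_apply, Units.smul_def, Units.val_pow_eq_pow_val, ← ha, smul_eq_mul,
        map_mul, map_pow]
      rfl
    · rintro ⟨_, ⟨u, rfl⟩, rfl⟩
      refine ⟨u.map mk.toMonoidHom, ?_⟩
      simp only [powMonoidHom_apply, Units.smul_def, Units.val_pow_eq_pow_val, smul_eq_mul,
        map_mul, map_pow]
      rfl
  let A : Set P := (fun x => 1 + x) '' (Set.range fun r : R => mk (2 * g * r))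
  let B : Set P := (fun x => -1 + x) '' (Set.range fun r : R => mk (2 * g * r))
  have hcard : (Set.range fun r : R => mk (2 * g * r)).ncard = idx (2 : R) * idx γ := by
    rw [← idx_mul h2 γ]
    have := card_range_mul (mul_ne_zero h2 hg0) (2 * γ)
    rw [← hDg] at this
    exact this
  have hA : A.ncard = idx (2 : R) * idx γ := by
    rw [Set.ncard_image_of_injective _ (add_right_injective _), hcard]
  have hB : B.ncard = idx (2 : R) * idx γ := by
    rw [Set.ncard_image_of_injective _ (add_right_injective _), hcard]
  have hdisj : Disjoint A B := by
    rw [Set.disjoint_left]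
    rintro _ ⟨_, ⟨r, rfl⟩, rfl⟩ ⟨_, ⟨s, rfl⟩, e⟩
    have e' : mk (-1 + 2 * g * s) = mk (1 + 2 * g * r) := by simpa using e
    rw [hmk_eq] at e'
    obtain ⟨c, hc⟩ := e'
    have : (1 : R) = g * (s - r - 2 * γ * c) := by
      apply mul_left_cancel₀ h2
      linear_combination -hc
    exact (mem_maximalIdeal _).1 hgm (IsUnit.of_mul_eq_one _ this.symm)
  have hstab : (Units.val '' {u : Pˣ | powMonoidHom 2 u • mk γ = mk γ}) = A ∪ B := by
    ext x
    obtain ⟨a, rfl⟩ := Ideal.Quotient.mk_surjective x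
    change mk a ∈ _ ↔ mk a ∈ _
    constructor
    · rintro ⟨u, hu, hua⟩
      have hu' : (u : P) ^ 2 * mk γ = mk γ := hu
      rw [hua, ← map_pow, ← map_mul, hmk_eq] at hu'
      obtain ⟨c, hc⟩ := hu'
      have e1 : a ^ 2 - 1 = 4 * g * c := by
        apply mul_right_cancel₀ hγ0
        linear_combination hc
      obtain ⟨t, ht⟩ := two_dvd_sub_of_four_dvd_sq_sub (w := a) (w' := 1)
        ⟨g * c, by linear_combination e1⟩
      have e2 : t * (t + 1) = g * c := by
        apply mul_left_cancel₀ (four_ne_zero_of_quadHenselian (R := R))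
        linear_combination e1 - (a + 1 + 2 * t) * ht
      -- Here a = 1 + 2t and g divides t(t + 1). One of the two factors is a unit, so g divides the
      -- other one, which places a in the coset of −1 or of 1.
      by_cases htu : IsUnit t
      · obtain ⟨t, rfl⟩ := htu
        right
        refine ⟨mk (2 * g * (↑t⁻¹ * c)), ⟨_, rfl⟩, ?_⟩
        have h1 : (↑t⁻¹ : R) * t = 1 := t.inv_mul
        have : a = -1 + 2 * g * (↑t⁻¹ * c) := by
          linear_combination ht + 2 * ↑t⁻¹ * e2 - 2 * (↑t + 1) * h1
        rw [this]; simp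
      · have ht1 : IsUnit (t + 1) := by
          rw [add_comm]; exact isUnit_one_add ((mem_maximalIdeal _).2 htu)
        obtain ⟨s, hs⟩ := ht1
        left
        refine ⟨mk (2 * g * (↑s⁻¹ * c)), ⟨_, rfl⟩, ?_⟩
        have h1 : (↑s⁻¹ : R) * s = 1 := s.inv_mul
        have : a = 1 + 2 * g * (↑s⁻¹ * c) := by
          rw [← hs] at e2
          linear_combination ht + 2 * ↑s⁻¹ * e2 - 2 * t * h1
        rw [this]; simp
    · have key : ∀ ε r : R, IsUnit ε → ε ^ 2 = 1 → mk a = mk (ε + 2 * g * r) →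
          mk a ∈ (Units.val '' {u : Pˣ | powMonoidHom 2 u • mk γ = mk γ}) := by
        intro ε r hε hε2 e
        have hu : IsUnit (mk a) := by
          rw [e, hmk, isUnit_mk_iff hD, show ε + 2 * g * r = ε * (1 + g * (2 * r * ε)) by
            linear_combination -(2 * g * r) * hε2]
          exact hε.mul (isUnit_one_add (Ideal.mul_mem_right _ _ hgm))
        refine ⟨hu.unit, ?_, rfl⟩
        change mk a ^ 2 * mk γ = mk γ
        rw [e, ← map_pow, ← map_mul, hmk_eq]
        refine ⟨r * (ε + g * r), ?_⟩
        linear_combination γ * hε2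
      rintro (⟨_, ⟨r, rfl⟩, e⟩ | ⟨_, ⟨r, rfl⟩, e⟩)
      · exact key 1 r isUnit_one (by ring) (by simpa using e.symm)
      · exact key (-1) r isUnit_one.neg (by ring) (by simpa using e.symm)
  have hsc : {u : Pˣ | powMonoidHom 2 u • mk γ = mk γ}.ncard = 2 * (idx (2 : R) * idx γ) := by
    rw [two_mul]
    nth_rewrite 1 [← hA]
    rw [← hB, ← Set.ncard_union_eq hdisj, ← hstab,
      Set.ncard_image_of_injective _ Units.val_injective]
  rw [← horb, ← hsc, ncard_orbit_mul_ncard_stabilizer]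

end Counting

end LocalMass

/-! ### Sums of inverse absolute discriminants over the classes. -/

namespace LocalMass

open IsLocalRing

section ClassSums

/-- It suffices to test division by π²: a non-unit is πs, and s² can be absorbed into the
discriminant. -/
theorem isFundDisc_iff {R : Type*} [CommRing R] [IsDomain R] [IsDiscreteValuationRing R] {γ π : R} (hπ : Irreducible π) :
    IsFundDisc γ ↔ IsDisc γ ∧ ¬ ∃ δ, IsDisc δ ∧ γ = π ^ 2 * δ := by
  refine ⟨fun h => ⟨h.1, fun ⟨δ, hδ, e⟩ => hπ.not_isUnit (h.2 π δ hδ e)⟩, fun ⟨h1, h2⟩ =>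
    ⟨h1, fun r δ hδ e => ?_⟩⟩
  by_contra hr
  rw [← mem_nonunits_iff, ← mem_maximalIdeal, hπ.maximalIdeal_eq, Ideal.mem_span_singleton] at hr
  obtain ⟨s, rfl⟩ := hr
  exact h2 ⟨s ^ 2 * δ, hδ.sq_mul s, by rw [e]; ring⟩

theorem two_dvd_sub_one {R : Type*} [CommRing R] [IsDomain R] [IsDiscreteValuationRing R]
    (h2 : Irreducible (2 : R)) (hq : Nat.card (ResidueField R) = 2) {x : R}
    (hx : IsUnit x) : (2 : R) ∣ x - 1 := by
  rw [← Ideal.mem_span_singleton, ← h2.maximalIdeal_eq, ← residue_eq_zero_iff, map_sub, map_one,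
    sub_eq_zero]
  obtain ⟨y, -, hy⟩ := (Nat.card_eq_two_iff' (0 : ResidueField R)).1 hq
  rw [hy (residue R x) ((residue_ne_zero_iff_isUnit x).2 hx), hy 1 one_ne_zero]

variable {R : Type*} [CommRing R] [IsDomain R] [IsDiscreteValuationRing R] [QuadHenselian R]

theorem sixteen_mul_sq_ne_zero {π : R} (hπ : Irreducible π) : (16 : R) * π ^ 2 ≠ 0 := by
  have h4 := four_ne_zero_of_quadHenselian (R := R)
  rw [show (16 : R) = 4 * 4 by norm_num]
  exact mul_ne_zero (mul_ne_zero h4 h4) (pow_ne_zero 2 hπ.ne_zero)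

theorem finite_quotient_sixteen {π : R} (hπ : Irreducible π) :
    Finite (R ⧸ Ideal.span {16 * π ^ 2}) := by
  apply Nat.finite_of_card_ne_zero
  change idx (16 * π ^ 2 : R) ≠ 0
  exact idx_ne_zero (sixteen_mul_sq_ne_zero hπ)

theorem IsFundDisc.mk_eq_of_quotient_eq {γ δ π : R} (hγ : IsFundDisc γ) (hπ : Irreducible π)
    (h : Ideal.Quotient.mk (Ideal.span {16 * π ^ 2}) δ = Ideal.Quotient.mk _ γ) :
    ∃ u : Rˣ, δ = (u : R) ^ 2 * γ := by
  rw [Ideal.Quotient.eq, Ideal.mem_span_singleton] at h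
  obtain ⟨z, hz⟩ := h
  obtain ⟨u, hu⟩ := hγ.exists_unit_of_congr hπ z
  exact ⟨u, by rw [← hu]; linear_combination hz⟩

instance : Finite (DiscClass R) := by
  obtain ⟨π, hπ⟩ := IsDiscreteValuationRing.exists_irreducible R
  have := finite_quotient_sixteen hπ
  refine Finite.of_injective
    (fun c : DiscClass R => Ideal.Quotient.mk (Ideal.span {16 * π ^ 2}) c.rep) fun c c' h => ?_
  rw [← c.mk_rep, DiscClass.mk_eq_iff]
  exact c'.rep_fund.mk_eq_of_quotient_eq hπ h

noncomputable instance : Fintype (DiscClass R) := Fintype.ofFinite _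

/-- The residues modulo `16 π ^ 2` of the fundamental discriminants with the property `T`. -/
def fundImage (T : R → Prop) (π : R) : Set (R ⧸ Ideal.span {16 * π ^ 2}) :=
  Ideal.Quotient.mk _ '' {γ | IsFundDisc γ ∧ T γ}

open Classical in
/-- The sum of the inverse absolute discriminants over the classes of fundamental discriminants
with the property `T`, in terms of a number of residues. -/
theorem sum_inv_idx_mul_card {T : R → Prop} (hT : ∀ (γ : R) (u : Rˣ), T γ → T ((u : R) ^ 2 * γ))
    {π : R} (hπ : Irreducible π) :
    (∑ c : DiscClass R with T c.rep, (idx c.rep : ℝ)⁻¹) *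
      Nat.card (R ⧸ Ideal.span {16 * π ^ 2})ˣ = 2 * idx (2 : R) * (fundImage T π).ncard := by
  have hfin := finite_quotient_sixteen hπ
  have _ := Fintype.ofFinite (R ⧸ Ideal.span {16 * π ^ 2})
  -- The residues in question are the disjoint union of the orbits of the classes. By
  -- `ncard_sqOrbit` each orbit has as many elements as its class contributes to the sum, up to a
  -- common factor.
  have h1 : (fundImage T π).toFinset =
      (Finset.univ.filter fun c : DiscClass R => T c.rep).biUnion
        fun c => (sqOrbit c.rep π).toFinset := by
    ext x
    simp only [Set.mem_toFinset, Finset.mem_biUnion, Finset.mem_filter, Finset.mem_univ, true_and]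
    constructor
    · rintro ⟨γ, ⟨hγ, hTγ⟩, rfl⟩
      obtain ⟨u, hu⟩ := (DiscClass.mk_eq_iff hγ (DiscClass.mk hγ)).1 rfl
      refine ⟨DiscClass.mk hγ, ?_, γ, ⟨u, hu⟩, rfl⟩
      have : (DiscClass.mk hγ).rep = ((u⁻¹ : Rˣ) : R) ^ 2 * γ := by
        have h1 : (↑u⁻¹ : R) * u = 1 := u.inv_mul
        linear_combination -(↑u⁻¹ : R) ^ 2 * hu - (DiscClass.mk hγ).rep * (↑u⁻¹ * u + 1) * h1
      rw [this]
      exact hT γ _ hTγ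
    · rintro ⟨c, hc, γ, ⟨u, rfl⟩, rfl⟩
      exact ⟨_, ⟨c.rep_fund.unit_sq_mul u, hT _ _ hc⟩, rfl⟩
  have h2 : ((Finset.univ.filter fun c : DiscClass R => T c.rep) : Set (DiscClass R)).PairwiseDisjoint
      fun c => (sqOrbit c.rep π).toFinset := by
    intro c _ c' _ hne
    rw [Function.onFun, Set.disjoint_toFinset, Set.disjoint_left]
    rintro _ ⟨_, ⟨u, rfl⟩, rfl⟩ ⟨_, ⟨v, rfl⟩, e⟩
    apply hne
    obtain ⟨w, hw⟩ := (c.rep_fund.unit_sq_mul u).mk_eq_of_quotient_eq hπ e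
    have h3 : DiscClass.mk (c.rep_fund.unit_sq_mul u) = DiscClass.mk (c'.rep_fund.unit_sq_mul v) :=
      (DiscClass.mk_eq_mk_iff _ _).2 ⟨w, hw⟩
    rwa [(DiscClass.mk_eq_iff (c.rep_fund.unit_sq_mul u) c).2 ⟨u, rfl⟩,
      (DiscClass.mk_eq_iff (c'.rep_fund.unit_sq_mul v) c').2 ⟨v, rfl⟩] at h3
  have h4 : (fundImage T π).ncard =
      ∑ c : DiscClass R with T c.rep, (sqOrbit c.rep π).ncard := by
    rw [Set.ncard_eq_toFinset_card', h1, Finset.card_biUnion h2]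
    simp only [Set.ncard_eq_toFinset_card']
  have hidx2 : (idx (2 : R) : ℝ) ≠ 0 := by
    exact_mod_cast idx_ne_zero two_ne_zero_of_quadHenselian
  rw [h4, Finset.sum_mul]
  push_cast
  rw [Finset.mul_sum]
  refine Finset.sum_congr rfl fun c _ => ?_
  have hc : (idx c.rep : ℝ) ≠ 0 := by
    exact_mod_cast idx_ne_zero (c.rep_fund.ne_zero (IsDiscreteValuationRing.not_isField R))
  rw [← ncard_sqOrbit c.rep_fund hπ]
  push_cast
  field_simp

/-- The number of residues of the multiples of `t ^ 2` by discriminants. -/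
theorem ncard_sq_mul_disc {t E D : R} (hD : D = 4 * t ^ 2 * E) (hD0 : D ≠ 0) :
    (Ideal.Quotient.mk (Ideal.span {D}) '' {γ | ∃ δ, IsDisc δ ∧ γ = t ^ 2 * δ}).ncard =
      idx (2 : R) * idx E := by
  have ht : t ≠ 0 := by rintro rfl; simp [hD] at hD0
  have h4 := four_ne_zero_of_quadHenselian (R := R)
  have hmk_eq : ∀ a b : R, Ideal.Quotient.mk (Ideal.span {D}) a = Ideal.Quotient.mk _ b ↔
      (4 * t ^ 2 * E) ∣ a - b := fun a b => by
    rw [Ideal.Quotient.eq, Ideal.mem_span_singleton, hD]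
  let S := Set.range fun r : R => Ideal.Quotient.mk (Ideal.span {D}) (4 * t ^ 2 * r)
  have hS : S.ncard = idx E := by
    have := card_range_mul (mul_ne_zero h4 (pow_ne_zero 2 ht)) E
    rw [← hD] at this
    exact this
  -- Replacing w by w + 2k changes w² − 4n by a multiple of 4. A residue of t²(w² − 4n) is thus
  -- given by w modulo 2, which it determines, and by a multiple of 4t² modulo D.
  let f : (R ⧸ Ideal.span {(2 : R)}) × S → R ⧸ Ideal.span {D} := fun p =>
    Ideal.Quotient.mk (Ideal.span {D}) (t ^ 2 * (Quotient.out p.1) ^ 2) + p.2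
  have hout : ∀ x : R ⧸ Ideal.span {(2 : R)}, Ideal.Quotient.mk _ (Quotient.out x) = x :=
    fun x => Quotient.out_eq x
  have hinj : Function.Injective f := by
    rintro ⟨x, _, r, rfl⟩ ⟨y, _, s, rfl⟩ e
    have e' := e
    simp only [f, ← map_add, hmk_eq] at e'
    obtain ⟨c, hc⟩ := e'
    have h1 : (4 : R) ∣ (Quotient.out x) ^ 2 - (Quotient.out y) ^ 2 := by
      refine ⟨E * c + s - r, mul_left_cancel₀ (pow_ne_zero 2 ht) ?_⟩
      linear_combination hc
    have h2 : x = y := by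
      rw [← hout x, ← hout y, Ideal.Quotient.eq, Ideal.mem_span_singleton]
      exact two_dvd_sub_of_four_dvd_sq_sub h1
    subst h2
    simp only [f, add_right_inj] at e
    exact Prod.ext rfl (Subtype.ext e)
  have hrange : Set.range f =
      Ideal.Quotient.mk (Ideal.span {D}) '' {γ | ∃ δ, IsDisc δ ∧ γ = t ^ 2 * δ} := by
    ext z
    constructor
    · rintro ⟨⟨x, _, r, rfl⟩, rfl⟩
      refine ⟨t ^ 2 * (Quotient.out x ^ 2 - 4 * (-r)), ⟨_, ⟨_, _, rfl⟩, rfl⟩, ?_⟩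
      simp only [f, ← map_add]
      congr 1
      ring
    · rintro ⟨_, ⟨_, ⟨w, n, rfl⟩, rfl⟩, rfl⟩
      have h1 := hout (Ideal.Quotient.mk _ w)
      rw [Ideal.Quotient.eq, Ideal.mem_span_singleton] at h1
      obtain ⟨k, hk⟩ := h1
      refine ⟨⟨Ideal.Quotient.mk _ w, _, -n - k * w - k ^ 2, rfl⟩, ?_⟩
      simp only [f, ← map_add]
      congr 1
      linear_combination t ^ 2 * (Quotient.out ((Ideal.Quotient.mk (Ideal.span {(2 : R)})) w) + w + 2 * k) * hk
  rw [← hrange, ← Nat.card_coe_set_eq, Nat.card_range_of_injective hinj, Nat.card_prod,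
    Nat.card_coe_set_eq, hS]
  rfl

/-- **The mass formula for quadratic characters.** -/
theorem sum_inv_idx : ∑ c : DiscClass R, (idx c.rep : ℝ)⁻¹ =
    2 + 2 / (Nat.card (ResidueField R) : ℝ) := by
  classical
  obtain ⟨π, hπ⟩ := IsDiscreteValuationRing.exists_irreducible R
  have hfin := finite_quotient_sixteen hπ
  have hD0 := sixteen_mul_sq_ne_zero hπ
  have h4 := four_ne_zero_of_quadHenselian (R := R)
  have h := sum_inv_idx_mul_card (R := R) (T := fun _ => True) (fun _ _ _ => trivial) hπ
  rw [Finset.filter_true] at h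
  set mk := Ideal.Quotient.mk (Ideal.span {16 * π ^ 2}) with hmk
  -- The fundamental discriminants are the discriminants that are not π² times a discriminant. Since
  -- their classes depend on residues only, this difference of sets survives reduction modulo 16π².
  have h1 : fundImage (fun _ => True) π =
      (mk '' {γ | ∃ δ, IsDisc δ ∧ γ = 1 ^ 2 * δ}) \
        (mk '' {γ | ∃ δ, IsDisc δ ∧ γ = π ^ 2 * δ}) := by
    ext x
    constructor
    · rintro ⟨γ, ⟨hγ, -⟩, rfl⟩
      refine ⟨⟨γ, ⟨γ, hγ.1, by ring⟩, rfl⟩, ?_⟩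
      rintro ⟨_, ⟨δ, hδ, rfl⟩, e⟩
      obtain ⟨u, hu⟩ := hγ.mk_eq_of_quotient_eq hπ e
      exact ((isFundDisc_iff hπ).1 (hγ.unit_sq_mul u)).2 ⟨δ, hδ, hu.symm⟩
    · rintro ⟨⟨_, ⟨γ, hγ, rfl⟩, rfl⟩, hx⟩
      refine ⟨γ, ⟨(isFundDisc_iff hπ).2 ⟨hγ, ?_⟩, trivial⟩, by rw [one_pow, one_mul]⟩
      rintro ⟨δ, hδ, rfl⟩
      exact hx ⟨_, ⟨δ, hδ, rfl⟩, by rw [one_pow, one_mul]⟩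
  have h2 : (mk '' {γ | ∃ δ, IsDisc δ ∧ γ = π ^ 2 * δ}) ⊆
      (mk '' {γ | ∃ δ, IsDisc δ ∧ γ = 1 ^ 2 * δ}) := by
    rintro _ ⟨_, ⟨δ, hδ, rfl⟩, rfl⟩
    exact ⟨_, ⟨π ^ 2 * δ, hδ.sq_mul π, by ring⟩, rfl⟩
  have h3 := Set.ncard_sdiff_add_ncard_of_subset h2
  rw [← h1, ncard_sq_mul_disc (E := 4) (by ring) hD0,
    ncard_sq_mul_disc (E := 4 * π ^ 2) (by ring) hD0, idx_mul h4, idx_pow hπ.ne_zero,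
    idx_irreducible hπ] at h3
  rw [card_units_quotient hπ] at h
  have hq : 1 < Nat.card (ResidueField R) := Finite.one_lt_card
  have h4' : idx (4 : R) = idx (2 : R) ^ 2 := by
    rw [← idx_pow two_ne_zero_of_quadHenselian]; norm_num
  have h2' : (idx (2 : R) : ℝ) ≠ 0 := by
    exact_mod_cast idx_ne_zero two_ne_zero_of_quadHenselian
  -- All discriminants have idx(2)·idx(4)·q² residues, those divisible by π² in the above sense have
  -- idx(2)·idx(4), and idx(4) = idx(2)².
  have h3' : ((fundImage (fun _ : R => True) π).ncard : ℝ) =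
      idx (2 : R) ^ 3 * ((Nat.card (ResidueField R) : ℝ) ^ 2 - 1) := by
    have := congrArg (Nat.cast : ℕ → ℝ) h3
    rw [h4'] at this
    push_cast at this
    linear_combination this
  rw [h3', h4'] at h
  push_cast [Nat.cast_sub hq.le] at h
  have hq0 : (0 : ℝ) < Nat.card (ResidueField R) := by positivity
  have hq1 : (Nat.card (ResidueField R) : ℝ) - 1 ≠ 0 := by
    have : (1 : ℝ) < Nat.card (ResidueField R) := by exact_mod_cast hq
    linarith
  have h5 : (∑ c : DiscClass R, (idx c.rep : ℝ)⁻¹) * Nat.card (ResidueField R) =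
      2 * (Nat.card (ResidueField R) + 1) := by
    apply mul_right_cancel₀ (mul_ne_zero hq1 (pow_ne_zero 4 h2'))
    linear_combination h
  rw [← mul_left_inj' hq0.ne', h5]
  field_simp

open Classical in
/-- The number of classes of units among the fundamental discriminants, in odd residue
characteristic. -/
theorem sum_unit_of_isUnit_two (h2 : IsUnit (2 : R)) :
    ∑ c : DiscClass R with IsUnit c.rep, (idx c.rep : ℝ)⁻¹ = 2 := by
  classical
  obtain ⟨π, hπ⟩ := IsDiscreteValuationRing.exists_irreducible R
  have hfin := finite_quotient_sixteen hπ
  have h := sum_inv_idx_mul_card (R := R) (T := IsUnit)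
    (fun γ u h => (u.isUnit.pow 2).mul h) hπ
  have hD : (16 : R) * π ^ 2 ∈ maximalIdeal R := by
    rw [hπ.maximalIdeal_eq, Ideal.mem_span_singleton]
    exact ⟨16 * π, by ring⟩
  have h4 : IsUnit (4 : R) := by
    rw [show (4 : R) = 2 * 2 by norm_num]; exact h2.mul h2
  -- With 2 invertible every element is 4 times something, hence a discriminant, and so every unit
  -- is a fundamental discriminant.
  have h1 : fundImage IsUnit π = {x : R ⧸ Ideal.span {16 * π ^ 2} | IsUnit x} := by
    ext x
    obtain ⟨a, rfl⟩ := Ideal.Quotient.mk_surjective x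
    rw [Set.mem_ofPred_eq, isUnit_mk_iff hD]
    constructor
    · rintro ⟨γ, ⟨-, hγ⟩, e⟩
      rw [← isUnit_mk_iff hD] at hγ ⊢
      rwa [← e]
    · intro ha
      refine ⟨a, ⟨⟨?_, fun r δ _ e => ?_⟩, ha⟩, rfl⟩
      · obtain ⟨v, hv⟩ := h4.exists_right_inv
        rw [show a = 4 * (v * a) by rw [← mul_assoc, hv, one_mul]]
        exact isDisc_four_mul _
      · rw [e] at ha
        exact (isUnit_pow_iff two_ne_zero).1 (isUnit_of_mul_isUnit_left ha)
  have h3 : Nat.card (R ⧸ Ideal.span {16 * π ^ 2})ˣ =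
      {x : R ⧸ Ideal.span {16 * π ^ 2} | IsUnit x}.ncard :=
    Nat.card_congr ⟨fun u => ⟨u, u.isUnit⟩, fun x => IsUnit.unit x.2, fun u => by ext; rfl,
      fun x => rfl⟩
  rw [h1, ← h3, idx_of_isUnit h2] at h
  have h5 : (Nat.card (R ⧸ Ideal.span {16 * π ^ 2})ˣ : ℝ) ≠ 0 := by
    exact_mod_cast Nat.card_pos.ne'
  exact mul_right_cancel₀ h5 (h.trans (by push_cast; ring))

open Classical in
-- A fundamental discriminant divides 4π, hence π, so every ramified class has index exactly q. The
-- squares therefore sum to 1/q times what `sum_inv_idx` leaves for the ramified classes, namely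
-- 2/q.
theorem sum_not_unit_sq_of_isUnit_two (h2 : IsUnit (2 : R)) :
    ∑ c : DiscClass R with ¬ IsUnit c.rep, ((idx c.rep : ℝ)⁻¹) ^ 2 =
      2 / (Nat.card (ResidueField R) : ℝ) ^ 2 := by
  obtain ⟨π, hπ⟩ := IsDiscreteValuationRing.exists_irreducible R
  have h4 : IsUnit (4 : R) := by
    rw [show (4 : R) = 2 * 2 by norm_num]; exact h2.mul h2
  have h0 := sum_inv_idx (R := R)
  rw [← Finset.sum_filter_add_sum_filter_not _ (fun c : DiscClass R => IsUnit c.rep),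
    sum_unit_of_isUnit_two h2] at h0
  have h1 : ∀ c : DiscClass R, ¬ IsUnit c.rep → idx c.rep = Nat.card (ResidueField R) := by
    intro c hc
    rw [← mem_nonunits_iff, ← mem_maximalIdeal, hπ.maximalIdeal_eq, Ideal.mem_span_singleton] at hc
    have h3 : c.rep ∣ π := by
      obtain ⟨v, hv⟩ := h4.exists_right_inv
      have := (c.rep_fund.dvd_four_mul hπ).mul_left v
      rwa [← mul_assoc, mul_comm v, hv, one_mul] at this
    obtain ⟨u, hu⟩ := associated_of_dvd_dvd hc h3
    rw [← hu, mul_comm, idx_unit_mul, idx_irreducible hπ]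
  have h3 : ∑ c : DiscClass R with ¬ IsUnit c.rep, ((idx c.rep : ℝ)⁻¹) ^ 2 =
      (Nat.card (ResidueField R) : ℝ)⁻¹ * ∑ c : DiscClass R with ¬ IsUnit c.rep,
        (idx c.rep : ℝ)⁻¹ := by
    rw [Finset.mul_sum]
    refine Finset.sum_congr rfl fun c hc => ?_
    rw [h1 c (Finset.mem_filter.1 hc).2]; ring
  rw [h3, add_left_cancel h0]
  ring

/-! ### The dyadic sums, when 2 is a uniformizer and q = 2. -/

section Dyadic

open Classical in
-- A unit discriminant has w = 1 + 2t, so it is 1 + 4(t² + t − n), and every 1 + 4r occurs. This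
-- gives 16 residues modulo 64, against 32 units.
theorem sum_unit_of_dyadic (h2 : Irreducible (2 : R)) (hq : Nat.card (ResidueField R) = 2) :
    ∑ c : DiscClass R with IsUnit c.rep, (idx c.rep : ℝ)⁻¹ = 2 := by
  classical
  have h := sum_inv_idx_mul_card (R := R) (T := IsUnit)
    (fun γ u h => (u.isUnit.pow 2).mul h) h2
  have h4 := four_ne_zero_of_quadHenselian (R := R)
  have hi2 : idx (2 : R) = 2 := by rw [idx_irreducible h2, hq]
  have hi4 : idx (4 : R) = 4 := by
    rw [show (4 : R) = 2 ^ 2 by norm_num, idx_pow h2.ne_zero, hi2]; rfl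
  have h2m : (2 : R) ∈ maximalIdeal R := by
    rw [h2.maximalIdeal_eq]; exact Ideal.mem_span_singleton_self _
  have h1 : fundImage IsUnit (2 : R) = (fun x => 1 + x) ''
      Set.range fun r : R => Ideal.Quotient.mk (Ideal.span {16 * 2 ^ 2}) (4 * r) := by
    ext x
    constructor
    · rintro ⟨_, ⟨⟨⟨w, n, rfl⟩, -⟩, hu⟩, rfl⟩
      have hw : IsUnit w := by
        by_contra hw
        refine (mem_maximalIdeal _).1 (sub_mem (Ideal.pow_mem_of_mem _
          ((mem_maximalIdeal _).2 hw) 2 two_pos) (?_ : 4 * n ∈ maximalIdeal R)) hu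
        rw [show 4 * n = 2 * (2 * n) by ring]
        exact Ideal.mul_mem_right _ _ h2m
      obtain ⟨t, ht⟩ := two_dvd_sub_one h2 hq hw
      refine ⟨_, ⟨t ^ 2 + t - n, rfl⟩, ?_⟩
      simp only [← map_one (Ideal.Quotient.mk (Ideal.span {(16 : R) * 2 ^ 2})), ← map_add]
      congr 1
      linear_combination -(w + 1 + 2 * t) * ht
    · rintro ⟨_, ⟨r, rfl⟩, rfl⟩
      have hu : IsUnit (1 + 4 * r) := isUnit_one_add (by
        rw [show 4 * r = 2 * (2 * r) by ring]
        exact Ideal.mul_mem_right _ _ h2m)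
      refine ⟨1 + 4 * r, ⟨⟨⟨1, -r, by ring⟩, fun s δ _ e => ?_⟩, hu⟩, by simp⟩
      rw [e] at hu
      exact (isUnit_pow_iff two_ne_zero).1 (isUnit_of_mul_isUnit_left hu)
  have h3 : (fundImage IsUnit (2 : R)).ncard = 16 := by
    rw [h1, Set.ncard_image_of_injective _ (add_right_injective _)]
    have := card_range_mul h4 (4 * 4)
    rw [show (4 : R) * (4 * 4) = 16 * 2 ^ 2 by norm_num] at this
    rw [this, idx_mul h4, hi4]
  rw [h3, card_units_quotient h2, hq, hi2, hi4,
    show (2 - 1) * (4 ^ 2 * 2) = 32 from rfl] at h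
  exact mul_right_cancel₀ (b := ((32 : ℕ) : ℝ)) (by norm_num) (h.trans (by norm_num))

/-- For a non-unit discriminant w is even, say w = 2t, so γ = 4(t² − n). If t² − n is not a unit,
then γ | 8 leaves only 8 times a unit. -/
theorem IsFundDisc.dyadic_cases (h2 : Irreducible (2 : R)) {γ : R} (hγ : IsFundDisc γ)
    (hu : ¬ IsUnit γ) : (∃ u : Rˣ, γ = 4 * u) ∨ ∃ u : Rˣ, γ = 8 * u := by
  have h4 := four_ne_zero_of_quadHenselian (R := R)
  obtain ⟨⟨w, n, e⟩, -⟩ := id hγ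
  have hm : ∀ x : R, ¬ IsUnit x ↔ (2 : R) ∣ x := fun x => by
    rw [← mem_nonunits_iff, ← mem_maximalIdeal, h2.maximalIdeal_eq, Ideal.mem_span_singleton]
  have hw : (2 : R) ∣ w := by
    rw [hm] at hu
    have : (2 : R) ∣ w ^ 2 := by
      rw [show w ^ 2 = γ + 2 * (2 * n) by linear_combination -e]
      exact dvd_add hu (dvd_mul_right _ _)
    exact h2.prime.dvd_of_dvd_pow this
  obtain ⟨t, rfl⟩ := hw
  by_cases hv : IsUnit (t ^ 2 - n)
  · exact Or.inl ⟨hv.unit, by rw [IsUnit.unit_spec, e]; ring⟩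
  · obtain ⟨y, hy⟩ := (hm _).1 hv
    right
    obtain ⟨z, hz⟩ := hγ.dvd_four_mul h2
    have hyz : y * z = 1 := by
      apply mul_left_cancel₀ (mul_ne_zero h4 h2.ne_zero)
      linear_combination -hz - z * e - 4 * z * hy
    refine ⟨⟨y, z, hyz, by rw [mul_comm, hyz]⟩, ?_⟩
    simp only
    linear_combination e + 4 * hy

open Classical in
-- The discriminants 4u with u a unit are fundamental exactly for u ≡ 3 modulo 4. They fill 4
-- residues modulo 64 and have inverse indices 1/4 with sum 1/2. Of the total 1 of the ramified
-- classes this leaves 1/2 for those of index 8, and 1/4 · 1/2 + 1/8 · 1/2 = 3/16.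
theorem sum_not_unit_sq_of_dyadic (h2 : Irreducible (2 : R)) (hq : Nat.card (ResidueField R) = 2) :
    ∑ c : DiscClass R with ¬ IsUnit c.rep, ((idx c.rep : ℝ)⁻¹) ^ 2 = 3 / 16 := by
  classical
  have h4 := four_ne_zero_of_quadHenselian (R := R)
  have hi2 : idx (2 : R) = 2 := by rw [idx_irreducible h2, hq]
  have hi4 : idx (4 : R) = 4 := by
    rw [show (4 : R) = 2 ^ 2 by norm_num, idx_pow h2.ne_zero, hi2]; rfl
  have hi8 : idx (8 : R) = 8 := by
    rw [show (8 : R) = 2 ^ 3 by norm_num, idx_pow h2.ne_zero, hi2]; rfl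
  let T : R → Prop := fun γ => ∃ u : Rˣ, γ = 4 * u
  have hTi : ∀ γ, T γ → idx γ = 4 := by
    rintro _ ⟨u, rfl⟩
    rw [mul_comm, idx_unit_mul, hi4]
  have h8i : ∀ γ : R, (∃ u : Rˣ, γ = 8 * u) → idx γ = 8 := by
    rintro _ ⟨u, rfl⟩
    rw [mul_comm, idx_unit_mul, hi8]
  have hTu : ∀ γ : R, T γ → ¬ IsUnit γ := by
    rintro _ ⟨u, rfl⟩ h
    rw [show (4 : R) * u = 2 * (2 * u) by ring] at h
    exact h2.not_isUnit (isUnit_of_mul_isUnit_left h)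
  have h := sum_inv_idx_mul_card (R := R) (T := T)
    (fun γ u ⟨v, hv⟩ => ⟨u ^ 2 * v, by rw [hv]; push_cast; ring⟩) h2
  have hodd : ∀ z : R, IsUnit (3 + 4 * z) := fun z => by
    rw [show 3 + 4 * z = 1 + 2 * (1 + 2 * z) by ring]
    refine isUnit_one_add (Ideal.mul_mem_right _ _ ?_)
    rw [h2.maximalIdeal_eq]; exact Ideal.mem_span_singleton_self _
  have h1 : fundImage T (2 : R) = (fun x => 12 + x) ''
      Set.range fun r : R => Ideal.Quotient.mk (Ideal.span {16 * 2 ^ 2}) (16 * r) := by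
    have h12 : (12 : R ⧸ Ideal.span {(16 : R) * 2 ^ 2}) = Ideal.Quotient.mk _ 12 := (map_ofNat _ 12).symm
    ext x
    constructor
    · rintro ⟨_, ⟨hγ, u, rfl⟩, rfl⟩
      obtain ⟨s, hs⟩ := two_dvd_sub_one h2 hq u.isUnit
      -- For even s the unit u would be 1 modulo 4, hence a discriminant, and 4u = 2²u would not be
      -- fundamental.
      have hs' : IsUnit s := by
        by_contra hs'
        rw [← mem_nonunits_iff, ← mem_maximalIdeal, h2.maximalIdeal_eq,
          Ideal.mem_span_singleton] at hs'
        obtain ⟨y, rfl⟩ := hs'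
        exact h2.not_isUnit (hγ.2 2 u ⟨1, -y, by linear_combination hs⟩ (by ring))
      obtain ⟨z, hz⟩ := two_dvd_sub_one h2 hq hs'
      refine ⟨_, ⟨z, rfl⟩, ?_⟩
      simp only [h12, ← map_add]
      congr 1
      linear_combination -4 * hs - 8 * hz
    · rintro ⟨_, ⟨r, rfl⟩, rfl⟩
      refine ⟨12 + 16 * r, ⟨(isFundDisc_iff h2).2 ⟨⟨0, -3 - 4 * r, by ring⟩, ?_⟩,
        (hodd r).unit, by rw [IsUnit.unit_spec]; ring⟩, by rw [map_add, h12]⟩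
      rintro ⟨_, ⟨w, n, rfl⟩, e⟩
      have e' : 3 + 4 * r = w ^ 2 - 4 * n := mul_left_cancel₀ h4 (by linear_combination e)
      have hw : IsUnit w := by
        by_contra hw
        rw [← mem_nonunits_iff, ← mem_maximalIdeal, h2.maximalIdeal_eq,
          Ideal.mem_span_singleton] at hw
        obtain ⟨y, rfl⟩ := hw
        have h3 := hodd r
        rw [e', show (2 * y) ^ 2 - 4 * n = 2 * (2 * y ^ 2 - 2 * n) by ring] at h3
        exact h2.not_isUnit (isUnit_of_mul_isUnit_left h3)
      obtain ⟨t, ht⟩ := two_dvd_sub_one h2 hq hw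
      have h3 : (2 : R) * (2 * (t ^ 2 + t - n - r)) = 2 * 1 := by
        linear_combination -e' - (w + 1 + 2 * t) * ht
      exact h2.not_isUnit (IsUnit.of_mul_eq_one _ (mul_left_cancel₀ h2.ne_zero h3))
  have h3 : (fundImage T (2 : R)).ncard = 4 := by
    rw [h1, Set.ncard_image_of_injective _ (add_right_injective _)]
    have h16 : (16 : R) ≠ 0 := by
      rw [show (16 : R) = 4 * 4 by norm_num]; exact mul_ne_zero h4 h4
    have := card_range_mul h16 4
    rw [show (16 : R) * 4 = 16 * 2 ^ 2 by norm_num] at this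
    rw [this, hi4]
  rw [h3, card_units_quotient h2, hq, hi2, hi4,
    show (2 - 1) * (4 ^ 2 * 2) = 32 from rfl] at h
  push_cast at h
  have h0 := sum_inv_idx (R := R)
  rw [← Finset.sum_filter_add_sum_filter_not _ (fun c : DiscClass R => IsUnit c.rep),
    sum_unit_of_dyadic h2 hq, hq] at h0
  have hf : (Finset.univ.filter fun c : DiscClass R => ¬ IsUnit c.rep).filter
      (fun c => T c.rep) = Finset.univ.filter fun c : DiscClass R => T c.rep := by
    ext c
    simp only [Finset.mem_filter, Finset.mem_univ, true_and, and_iff_right_iff_imp]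
    exact hTu _
  have hc8 : ∀ c ∈ (Finset.univ.filter fun c : DiscClass R => ¬ IsUnit c.rep).filter
      (fun c => ¬ T c.rep), idx c.rep = 8 := by
    intro c hc
    simp only [Finset.mem_filter, Finset.mem_univ, true_and] at hc
    exact h8i _ ((c.rep_fund.dyadic_cases h2 hc.1).resolve_left hc.2)
  rw [← Finset.sum_filter_add_sum_filter_not _ (fun c : DiscClass R => T c.rep), hf] at h0 ⊢
  have e1 := Finset.sum_congr rfl fun (c : DiscClass R) hc =>
    show (idx c.rep : ℝ)⁻¹ = 1 / 8 by rw [hc8 c hc]; norm_num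
  have e2 := Finset.sum_congr rfl fun (c : DiscClass R) hc =>
    show ((idx c.rep : ℝ)⁻¹) ^ 2 = 1 / 8 * (1 / 8) by rw [hc8 c hc]; norm_num
  have e3 : ∑ c : DiscClass R with T c.rep, ((idx c.rep : ℝ)⁻¹) ^ 2 =
      1 / 4 * ∑ c : DiscClass R with T c.rep, (idx c.rep : ℝ)⁻¹ := by
    rw [Finset.mul_sum]
    refine Finset.sum_congr rfl fun c hc => ?_
    rw [hTi _ (Finset.mem_filter.1 hc).2]; norm_num
  rw [← Finset.mul_sum] at e2
  rw [e1] at h0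
  rw [e2, e3]
  linear_combination (1 / 8) * h0 + (1 / 8) / 32 * h

end Dyadic

end ClassSums

end LocalMass

/-! ### The ring of integers of a quadratic extension. -/

namespace LocalMass

open IsLocalRing
open QuadraticAlgebra hiding norm_zero norm_star norm_algebraMap

/-- If a² + a = z, then (1 + 2a)² = 1 + 4z. Hensel's lemma solves this equation starting from a = z:
the value there is z², and the derivative 1 + 2z has the inverse 1 − 2z modulo I. Only z² has to lie
in I, which matters when I is extended from the base ring of a ramified extension. -/
theorem exists_sq_eq_of_isAdicComplete {A : Type*} [CommRing A] (I : Ideal A) [IsAdicComplete I A]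
    {z : A} (hz : z ^ 2 ∈ I) : ∃ u : A, u ^ 2 = 1 + 4 * z := by
  open Polynomial in
  obtain ⟨a, ha, -⟩ := HenselianRing.is_henselian (I := I) (X ^ 2 + X - C z)
    (by monicity!) z (by simpa using hz) (by
      have h1 : Ideal.Quotient.mk I ((2 * z + 1) * (1 - 2 * z)) = 1 := by
        rw [← map_one (Ideal.Quotient.mk I), Ideal.Quotient.eq]
        rw [show (2 * z + 1) * (1 - 2 * z) - 1 = -4 * z ^ 2 by ring]
        exact Ideal.mul_mem_left _ _ hz
      rw [map_mul] at h1
      simpa [one_add_one_eq_two] using IsUnit.of_mul_eq_one _ h1)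
  refine ⟨1 + 2 * a, ?_⟩
  have h2 : a ^ 2 + a - z = 0 := by simpa using ha
  linear_combination 4 * h2

theorem QuadHenselian.of_isAdicComplete (R : Type*) [CommRing R] [IsDomain R]
    [IsDiscreteValuationRing R] [Finite (ResidueField R)] [IsAdicComplete (maximalIdeal R) R]
    (h2 : (2 : R) ≠ 0) : QuadHenselian R where
  finite_residueField := inferInstance
  two_ne_zero := h2
  exists_sq_eq _ hz := exists_sq_eq_of_isAdicComplete (maximalIdeal R)
    (Ideal.pow_mem_of_mem _ hz 2 two_pos)

section Order

variable {R : Type*} [CommRing R]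

/-- The discriminant of the characteristic polynomial of x is a square times that of the order. This
identity turns properties of norms into statements on discriminants. -/
theorem trace_sq_sub_four_norm {w n : R} (x : QuadraticAlgebra R (-n) w) :
    (2 * x.re + w * x.im) ^ 2 - 4 * norm x = x.im ^ 2 * (w ^ 2 - 4 * n) := by
  rw [norm_def]; ring

/-- The discriminant of `X ^ 2 - w X + n` is fundamental and not a square in the fraction field, so
that the ring `R[ω]` with `ω ^ 2 = w ω - n` is the ring of integers of a quadratic extension. -/
class IsQuadOrder (w n : R) : Prop where
  fund : IsFundDisc (w ^ 2 - 4 * n)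
  nonsq : ∀ a b : R, a ^ 2 = b ^ 2 * (w ^ 2 - 4 * n) → b = 0

theorem idx_algebraMap {w n : R} (r : R) :
    idx (algebraMap R (QuadraticAlgebra R (-n) w) r) = idx r ^ 2 := by
  let f : QuadraticAlgebra R (-n) w →+ (R ⧸ Ideal.span {r}) × (R ⧸ Ideal.span {r}) :=
    { toFun := fun x => (Ideal.Quotient.mk _ x.re, Ideal.Quotient.mk _ x.im)
      map_zero' := rfl
      map_add' := fun x y => by simp }
  have h1 : (Ideal.span {algebraMap R (QuadraticAlgebra R (-n) w) r}).toAddSubgroup = f.ker := by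
    ext x
    change x ∈ Ideal.span _ ↔ f x = 0
    rw [Ideal.mem_span_singleton, algebraMap_dvd_iff, ← Ideal.mem_span_singleton,
      ← Ideal.mem_span_singleton, ← Ideal.Quotient.eq_zero_iff_mem,
      ← Ideal.Quotient.eq_zero_iff_mem, ← Prod.mk_eq_zero]
    rfl
  have h2 : f.range = ⊤ := by
    rw [AddMonoidHom.range_eq_top]
    rintro ⟨x, y⟩
    obtain ⟨a, rfl⟩ := Ideal.Quotient.mk_surjective x
    obtain ⟨b, rfl⟩ := Ideal.Quotient.mk_surjective y
    exact ⟨⟨a, b⟩, rfl⟩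
  rw [idx_eq_index, h1, AddSubgroup.index_ker, h2, Nat.card_congr AddSubgroup.topEquiv.toEquiv,
    Nat.card_prod, pow_two]
  rfl

variable [IsDomain R] {w n : R} [hwn : IsQuadOrder w n]

theorem norm_eq_zero_iff_of_isQuadOrder {x : QuadraticAlgebra R (-n) w} : norm x = 0 ↔ x = 0 := by
  refine ⟨fun h => ?_, by rintro rfl; exact QuadraticAlgebra.norm_zero⟩
  have h1 := trace_sq_sub_four_norm x
  rw [h, mul_zero, sub_zero] at h1
  have h2 := hwn.nonsq _ _ h1
  rw [norm_def, h2] at h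
  ext
  · simpa using h
  · exact h2

instance : NoZeroDivisors (QuadraticAlgebra R (-n) w) where
  eq_zero_or_eq_zero_of_mul_eq_zero {x y} h := by
    rw [← norm_eq_zero_iff_of_isQuadOrder, ← norm_eq_zero_iff_of_isQuadOrder (x := y),
      ← mul_eq_zero, ← map_mul, h, QuadraticAlgebra.norm_zero]

instance : IsDomain (QuadraticAlgebra R (-n) w) := NoZeroDivisors.to_isDomain _

variable [IsDiscreteValuationRing R] [QuadHenselian R]

/-- Elements whose norm is divisible by `b ^ 2` are divisible by `b`. -/
theorem algebraMap_dvd_of_sq_dvd_norm {x : QuadraticAlgebra R (-n) w} {b : R} (hb : b ≠ 0)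
    (h : b ^ 2 ∣ norm x) : algebraMap R _ b ∣ x := by
  obtain ⟨N, hN⟩ := h
  have key := trace_sq_sub_four_norm x
  obtain ⟨T, hT⟩ : ∃ T, T = 2 * x.re + w * x.im := ⟨_, rfl⟩
  rw [← hT, hN] at key
  have hbT : b ∣ T := by
    rcases ValuationRing.dvd_total b T with h1 | ⟨c, rfl⟩
    · exact h1
    by_cases hc : IsUnit c
    · obtain ⟨c, rfl⟩ := hc
      exact ⟨↑c⁻¹, by rw [mul_assoc, c.mul_inv, mul_one]⟩
    -- Here b = Tc with c a non-unit, so T² − 4·norm x = T²(1 − 4c²N) is the square of Tu. As w² −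
    -- 4n is not a square, this is impossible.
    exfalso
    have hm : -(c ^ 2 * N) ∈ maximalIdeal R := neg_mem (Ideal.mul_mem_right _ _
      (Ideal.pow_mem_of_mem _ ((mem_maximalIdeal _).2 hc) 2 two_pos))
    obtain ⟨u, hu⟩ := QuadHenselian.exists_sq_eq _ hm
    have h2 := hwn.nonsq (T * u) x.im (by linear_combination key + T ^ 2 * hu)
    rw [h2] at key
    have h3 : T ^ 2 * (1 + -(4 * c ^ 2 * N)) = 0 := by linear_combination key
    have hm' : -(4 * c ^ 2 * N) ∈ maximalIdeal R := by
      rw [show -(4 * c ^ 2 * N) = 4 * -(c ^ 2 * N) by ring]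
      exact Ideal.mul_mem_left _ _ hm
    have hT0 : T ≠ 0 := left_ne_zero_of_mul hb
    exact mul_ne_zero (pow_ne_zero 2 hT0) (isUnit_one_add hm').ne_zero h3
  obtain ⟨T', rfl⟩ := hbT
  -- After division by b² the left side is still a discriminant, so fundamentality gives b | x.im.
  -- The congruence modulo 2 then yields b | x.re.
  have hbr : b ∣ x.im := hwn.fund.dvd_of_sq_mul_eq (δ := T' ^ 2 - 4 * N) ⟨_, _, rfl⟩
    (by linear_combination key)
  obtain ⟨r, hr⟩ := hbr
  rw [hr] at key hT
  have key' : T' ^ 2 - 4 * N = r ^ 2 * (w ^ 2 - 4 * n) :=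
    mul_left_cancel₀ (pow_ne_zero 2 hb) (by linear_combination key)
  obtain ⟨k, hk⟩ := two_dvd_sub_of_four_dvd_sq_sub (w := T') (w' := r * w)
    ⟨N - r ^ 2 * n, by linear_combination key'⟩
  refine algebraMap_dvd_iff.2 ⟨⟨k, ?_⟩, ⟨r, hr⟩⟩
  apply mul_left_cancel₀ (two_ne_zero_of_quadHenselian (R := R))
  linear_combination -hT + b * hk

/-- If norm y divides norm x, then the norm of x · star y is divisible by the square of norm y, so x
· star y is divisible by norm y = y · star y. Divisibility is thus read off from norms in R and is
total, which makes the order a valuation ring. -/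
theorem dvd_iff_norm_dvd {x y : QuadraticAlgebra R (-n) w} : y ∣ x ↔ norm y ∣ norm x := by
  refine ⟨fun h => map_dvd _ h, fun h => ?_⟩
  by_cases hy : y = 0
  · subst hy
    rw [QuadraticAlgebra.norm_zero, zero_dvd_iff, norm_eq_zero_iff_of_isQuadOrder] at h
    simp [h]
  have hN : norm y ≠ 0 := fun h0 => hy (norm_eq_zero_iff_of_isQuadOrder.1 h0)
  have h1 : norm y ^ 2 ∣ norm (x * star y) := by
    rw [map_mul, QuadraticAlgebra.norm_star, pow_two]
    exact mul_dvd_mul_right h _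
  obtain ⟨s, hs⟩ := algebraMap_dvd_of_sq_dvd_norm hN h1
  have hsy : star y ≠ 0 := fun h0 => hy (by rw [← star_star y, h0, star_zero])
  refine ⟨s, mul_right_cancel₀ hsy ?_⟩
  rw [hs, algebraMap_norm_eq_mul_star]; ring

instance : ValuationRing (QuadraticAlgebra R (-n) w) := by
  refine (ValuationRing.iff_dvd_total).2 ⟨fun x y => ?_⟩
  rw [dvd_iff_norm_dvd, dvd_iff_norm_dvd]
  exact ValuationRing.dvd_total _ _

instance : IsNoetherianRing (QuadraticAlgebra R (-n) w) :=
  isNoetherian_of_tower R inferInstance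

instance : IsDiscreteValuationRing (QuadraticAlgebra R (-n) w) := by
  have hf : ¬ IsField (QuadraticAlgebra R (-n) w) := by
    intro hf
    obtain ⟨π, hπ⟩ := IsDiscreteValuationRing.exists_irreducible R
    have h0 : algebraMap R (QuadraticAlgebra R (-n) w) π ≠ 0 := fun h => hπ.ne_zero
      (algebraMap_injective (by rw [h, map_zero]))
    obtain ⟨y, hy⟩ := hf.mul_inv_cancel h0
    have h1 := isUnit_iff_norm_isUnit.1 (IsUnit.of_mul_eq_one _ hy)
    rw [QuadraticAlgebra.norm_algebraMap] at h1
    exact hπ.not_isUnit ((isUnit_pow_iff two_ne_zero).1 h1)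
  have h := (IsDiscreteValuationRing.TFAE (QuadraticAlgebra R (-n) w) hf).out 0 1
  exact h.2 inferInstance

instance : Finite (ResidueField (QuadraticAlgebra R (-n) w)) := by
  obtain ⟨π, hπ⟩ := IsDiscreteValuationRing.exists_irreducible R
  have h0 : idx (algebraMap R (QuadraticAlgebra R (-n) w) π) ≠ 0 := by
    rw [idx_algebraMap]
    exact pow_ne_zero 2 (idx_ne_zero hπ.ne_zero)
  have := Nat.finite_of_card_ne_zero h0
  have hle : Ideal.span {algebraMap R (QuadraticAlgebra R (-n) w) π} ≤ maximalIdeal _ := by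
    rw [Ideal.span_singleton_le_iff_mem, mem_maximalIdeal, mem_nonunits_iff, isUnit_iff_norm_isUnit,
      QuadraticAlgebra.norm_algebraMap, isUnit_pow_iff two_ne_zero]
    exact hπ.not_isUnit
  exact Finite.of_surjective _ (Ideal.Quotient.factor_surjective hle)

/-- Both sides are multiplicative, so only a uniformizer ϖ matters. They agree on π, where both are
`idx π ^ 2`, and π is a unit times a positive power of ϖ. -/
theorem idx_eq_idx_norm {x : QuadraticAlgebra R (-n) w} (hx : x ≠ 0) : idx x = idx (norm x) := by
  obtain ⟨π, hπ⟩ := IsDiscreteValuationRing.exists_irreducible R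
  obtain ⟨ϖ, hϖ⟩ := IsDiscreteValuationRing.exists_irreducible (QuadraticAlgebra R (-n) w)
  have hN : norm ϖ ≠ 0 := fun h => hϖ.ne_zero (norm_eq_zero_iff_of_isQuadOrder.1 h)
  have hi : ∀ (u : (QuadraticAlgebra R (-n) w)ˣ) (k : ℕ),
      idx (QuadraticAlgebra.norm ((u : QuadraticAlgebra R (-n) w) * ϖ ^ k)) = idx (norm ϖ) ^ k := by
    intro u k
    obtain ⟨v, hv⟩ := isUnit_iff_norm_isUnit.1 u.isUnit
    rw [map_mul, ← hv, idx_unit_mul, map_pow, idx_pow hN]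
  have h0 : algebraMap R (QuadraticAlgebra R (-n) w) π ≠ 0 := fun h => hπ.ne_zero
    (algebraMap_injective (by rw [h, map_zero]))
  obtain ⟨e, v, he⟩ := IsDiscreteValuationRing.eq_unit_mul_pow_irreducible h0 hϖ
  have he0 : e ≠ 0 := by
    rintro rfl
    have h1 : IsUnit (algebraMap R (QuadraticAlgebra R (-n) w) π) := by rw [he]; simp
    rw [isUnit_iff_norm_isUnit, QuadraticAlgebra.norm_algebraMap, isUnit_pow_iff two_ne_zero] at h1
    exact hπ.not_isUnit h1
  have heq : idx ϖ = idx (norm ϖ) := by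
    apply Nat.pow_left_injective he0
    simp only
    rw [← hi v e, ← he, QuadraticAlgebra.norm_algebraMap, idx_pow hπ.ne_zero, ← idx_algebraMap (w := w) (n := n),
      he, idx_unit_mul, idx_pow hϖ.ne_zero]
  obtain ⟨k, u, rfl⟩ := IsDiscreteValuationRing.eq_unit_mul_pow_irreducible hx hϖ
  rw [hi, idx_unit_mul, idx_pow hϖ.ne_zero, heq]

/-- If the discriminant is a unit, the residue field extension is quadratic. -/
theorem card_residueField_of_isUnit (hu : IsUnit (w ^ 2 - 4 * n)) :
    Nat.card (ResidueField (QuadraticAlgebra R (-n) w)) = Nat.card (ResidueField R) ^ 2 := by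
  obtain ⟨π, hπ⟩ := IsDiscreteValuationRing.exists_irreducible R
  have hmem : ∀ x : R, ¬ IsUnit x ↔ π ∣ x := fun x => by
    rw [← mem_nonunits_iff, ← mem_maximalIdeal, hπ.maximalIdeal_eq, Ideal.mem_span_singleton]
  have hmax : maximalIdeal (QuadraticAlgebra R (-n) w) = Ideal.span {algebraMap R _ π} := by
    ext x
    rw [mem_maximalIdeal, mem_nonunits_iff, isUnit_iff_norm_isUnit, Ideal.mem_span_singleton]
    constructor
    · intro hx
      rw [hmem] at hx
      -- If x.im were a unit while π divides the norm, the identity for trace and norm would present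
      -- w² − 4n as the square of the trace over x.im, times an element 1 + 4z with z in the maximal
      -- ideal, hence as a square.
      have him : π ∣ x.im := by
        rw [← hmem]
        intro him
        obtain ⟨v, hv⟩ := him.exists_right_inv
        obtain ⟨g, hg⟩ := hu
        have hgi : (↑g⁻¹ : R) * g = 1 := g.inv_mul
        obtain ⟨y, hy⟩ := hx
        have hm : ↑g⁻¹ * v ^ 2 * (π * y) ∈ maximalIdeal R := by
          rw [hπ.maximalIdeal_eq, Ideal.mem_span_singleton]
          exact ⟨↑g⁻¹ * v ^ 2 * y, by ring⟩
        obtain ⟨u, hu'⟩ := QuadHenselian.exists_sq_eq _ hm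
        have h1 := trace_sq_sub_four_norm x
        rw [← hg, hy] at h1
        have h2 := hwn.nonsq (v * (2 * x.re + w * x.im)) u (by
          rw [← hg, hu']
          linear_combination v ^ 2 * h1 + (v * x.im + 1) * g * hv - 4 * v ^ 2 * π * y * hgi)
        rw [h2, pow_two, zero_mul] at hu'
        have h3 : IsUnit (1 + 4 * (↑g⁻¹ * v ^ 2 * (π * y))) :=
          isUnit_one_add (Ideal.mul_mem_left _ _ hm)
        rw [← hu'] at h3
        exact not_isUnit_zero h3
      refine algebraMap_dvd_iff.2 ⟨?_, him⟩
      obtain ⟨r, hr⟩ := him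
      obtain ⟨y, hy⟩ := hx
      refine hπ.prime.dvd_of_dvd_pow (n := 2) ⟨y - w * x.re * r - n * x.im * r, ?_⟩
      rw [norm_def] at hy
      linear_combination hy - (w * x.re + n * x.im) * hr
    · intro h
      have := map_dvd QuadraticAlgebra.norm h
      rw [QuadraticAlgebra.norm_algebraMap] at this
      rw [hmem]
      exact (dvd_pow_self π two_ne_zero).trans this
  rw [← idx_irreducible hπ, ← idx_algebraMap (w := w) (n := n), idx, ← hmax]
  rfl

/-- The polynomial X² − wX + n has vanishing discriminant over the residue field, hence a double
root there: w/2 in odd characteristic, and a square root of n in characteristic 2, where the finite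
field is perfect. -/
theorem exists_double_root {R : Type*} [CommRing R] [IsLocalRing R] [Finite (ResidueField R)]
    {w n : R} (h : w ^ 2 - 4 * n ∈ maximalIdeal R) :
    ∃ s : R, w - 2 * s ∈ maximalIdeal R ∧ s ^ 2 - n ∈ maximalIdeal R := by
  simp only [← residue_eq_zero_iff, map_sub, map_mul, map_pow, map_ofNat] at h ⊢
  by_cases h2 : (2 : ResidueField R) = 0
  · have hchar : ringChar (ResidueField R) = 2 := by
      have := ringChar.dvd (R := ResidueField R) (x := 2) (by exact_mod_cast h2)
      exact ((Nat.dvd_prime Nat.prime_two).1 this).resolve_left CharP.ringChar_ne_one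
    obtain ⟨s, hs⟩ := FiniteField.isSquare_of_char_two hchar (residue R n)
    obtain ⟨s, rfl⟩ := residue_surjective s
    refine ⟨s, ?_, by rw [hs]; ring⟩
    have h4 : residue R w ^ 2 = 0 := by linear_combination h + 2 * residue R n * h2
    rw [h2, zero_mul, sub_zero]
    exact pow_eq_zero_iff two_ne_zero |>.1 h4
  · obtain ⟨s, hs⟩ := residue_surjective (residue R w / 2)
    refine ⟨s, by rw [hs]; field_simp; ring, ?_⟩
    rw [hs]
    field_simp
    linear_combination h

/-- If the discriminant is not a unit, the residue field extension is trivial. -/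
theorem card_residueField_of_not_isUnit (hu : ¬ IsUnit (w ^ 2 - 4 * n)) :
    Nat.card (ResidueField (QuadraticAlgebra R (-n) w)) = Nat.card (ResidueField R) := by
  obtain ⟨π, hπ⟩ := IsDiscreteValuationRing.exists_irreducible R
  obtain ⟨ϖ, hϖ⟩ := IsDiscreteValuationRing.exists_irreducible (QuadraticAlgebra R (-n) w)
  have h0 : algebraMap R (QuadraticAlgebra R (-n) w) π ≠ 0 := fun h => hπ.ne_zero
    (algebraMap_injective (by rw [h, map_zero]))
  obtain ⟨s, hs1, hs2⟩ := exists_double_root ((mem_maximalIdeal _).2 hu)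
  rw [hπ.maximalIdeal_eq, Ideal.mem_span_singleton] at hs1 hs2
  have hnp : ¬ Prime (algebraMap R (QuadraticAlgebra R (-n) w) π) := by
    intro hp
    -- With s a double root, π divides (ω − s)² but not ω − s.
    have h1 : algebraMap R (QuadraticAlgebra R (-n) w) π ∣ (⟨-s, 1⟩ : QuadraticAlgebra R (-n) w) ^ 2 := by
      rw [algebraMap_dvd_iff, pow_two]
      simp only [re_mul, im_mul]
      refine ⟨?_, ?_⟩
      · obtain ⟨y, hy⟩ := hs2
        exact ⟨y, by linear_combination hy⟩
      · obtain ⟨y, hy⟩ := hs1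
        exact ⟨y, by linear_combination hy⟩
    have h2 := (algebraMap_dvd_iff.1 (hp.dvd_of_dvd_pow h1)).2
    exact hπ.not_isUnit (isUnit_of_dvd_one h2)
  obtain ⟨e, v, he⟩ := IsDiscreteValuationRing.eq_unit_mul_pow_irreducible h0 hϖ
  have hN : QuadraticAlgebra.norm ϖ ≠ 0 :=
    fun h => hϖ.ne_zero (norm_eq_zero_iff_of_isQuadOrder.1 h)
  obtain ⟨f, v', hf⟩ := IsDiscreteValuationRing.eq_unit_mul_pow_irreducible hN hπ
  have hq : 1 < Nat.card (ResidueField R) := Finite.one_lt_card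
  have hqS : Nat.card (ResidueField (QuadraticAlgebra R (-n) w)) =
      Nat.card (ResidueField R) ^ f := by
    rw [← idx_irreducible hϖ, idx_eq_idx_norm hϖ.ne_zero, hf, idx_unit_mul, idx_pow hπ.ne_zero,
      idx_irreducible hπ]
  -- The index of π in the order is q² on the one hand and (q ^ f) ^ e on the other. As π is not
  -- prime there, e = 2 and f = 1.
  have hfe : f * e = 2 := by
    have h1 : idx (algebraMap R (QuadraticAlgebra R (-n) w) π) = idx π ^ 2 := idx_algebraMap π
    rw [he, idx_unit_mul, idx_pow hϖ.ne_zero, idx_irreducible hϖ, hqS, idx_irreducible hπ,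
      ← pow_mul] at h1
    exact Nat.pow_right_injective hq h1
  have he1 : e ≠ 1 := by
    rintro rfl
    apply hnp
    rw [he, pow_one]
    exact (associated_unit_mul_left ϖ v v.isUnit).symm.prime hϖ.prime
  have hf1 : f = 1 := by
    have hdvd : f ∣ 2 := ⟨e, hfe.symm⟩
    rcases (Nat.dvd_prime Nat.prime_two).1 hdvd with h | h
    · exact h
    · subst h; omega
  rw [hqS, hf1, pow_one]

/-- The order is free of rank 2, and limits are taken in each coordinate. -/
instance isAdicComplete_quadraticAlgebra [IsAdicComplete (maximalIdeal R) R] :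
    IsAdicComplete (maximalIdeal R) (QuadraticAlgebra R (-n) w) where
  prec' f hf := by
    have hcomp : ∀ g : QuadraticAlgebra R (-n) w →ₗ[R] R, ∃ L : R, ∀ k : ℕ,
        g (f k) ≡ L [SMOD (maximalIdeal R ^ k • ⊤ : Ideal R)] := by
      intro g
      refine IsPrecomplete.prec' (I := maximalIdeal R) (fun k => g (f k)) fun {i j} hij => ?_
      refine ((hf hij).map g).mono ?_
      rw [Submodule.map_smul'']
      exact Submodule.smul_mono le_rfl le_top
    obtain ⟨L₁, h₁⟩ := hcomp (reₗ _ _)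
    obtain ⟨L₂, h₂⟩ := hcomp (imₗ _ _)
    refine ⟨⟨L₁, L₂⟩, fun k => ?_⟩
    have h₁ := SModEq.sub_mem.1 (h₁ k)
    have h₂ := SModEq.sub_mem.1 (h₂ k)
    rw [smul_eq_mul, Ideal.mul_top] at h₁ h₂
    rw [SModEq.sub_mem]
    have : f k - ⟨L₁, L₂⟩ = ((f k).re - L₁) • (1 : QuadraticAlgebra R (-n) w) +
        ((f k).im - L₂) • (⟨0, 1⟩ : QuadraticAlgebra R (-n) w) := by
      ext <;> simp [re_one, im_one]
    rw [this]
    exact add_mem (Submodule.smul_mem_smul h₁ trivial) (Submodule.smul_mem_smul h₂ trivial)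

/-- For z in the maximal ideal of the order, trace and norm lie in the maximal ideal of R. Hence z²
= tr(z)z − N(z) lies in the ideal extended from R, for which completeness is known. -/
instance [IsAdicComplete (maximalIdeal R) R] : QuadHenselian (QuadraticAlgebra R (-n) w) where
  finite_residueField := inferInstance
  two_ne_zero h := two_ne_zero_of_quadHenselian (R := R) (by
    apply algebraMap_injective (a := -n) (b := w)
    rw [map_zero, map_ofNat, h])
  exists_sq_eq z hz := by
    have := (IsAdicComplete.map_algebraMap_iff (I := maximalIdeal R)
      (M := QuadraticAlgebra R (-n) w) (S := QuadraticAlgebra R (-n) w)).2 inferInstance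
    refine exists_sq_eq_of_isAdicComplete
      ((maximalIdeal R).map (algebraMap R (QuadraticAlgebra R (-n) w))) ?_
    have hm : ∀ r : R, algebraMap R (QuadraticAlgebra R (-n) w) r ∈
        maximalIdeal (QuadraticAlgebra R (-n) w) → r ∈ maximalIdeal R := by
      intro r hr
      rw [mem_maximalIdeal, mem_nonunits_iff] at hr ⊢
      exact fun h => hr (h.map _)
    have hN : QuadraticAlgebra.norm z ∈ maximalIdeal R := by
      apply hm
      rw [algebraMap_norm_eq_mul_star]
      exact Ideal.mul_mem_right _ _ hz
    have hT : trace z ∈ maximalIdeal R := by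
      apply hm
      rw [algebraMap_trace_eq_add_star]
      refine add_mem hz ?_
      rw [mem_maximalIdeal, mem_nonunits_iff, isUnit_iff_norm_isUnit,
        QuadraticAlgebra.norm_star, ← isUnit_iff_norm_isUnit]
      exact hz
    rw [sq_eq_trace_smul_sub_norm, Algebra.smul_def]
    exact sub_mem (Ideal.mul_mem_right _ _ (Ideal.mem_map_of_mem _ hT)) (Ideal.mem_map_of_mem _ hN)

end Order

end LocalMass

/-! ### Discriminant ideals of subalgebras of Ωⁿ with an integral basis. -/

namespace LocalMass

open IsLocalRing

section EtaleDiscriminant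

variable {K : Type*} [Field K] {Ω : Type*} [Field Ω] [Algebra K Ω] {n : ℕ}

theorem sum_smul_apply {A : Subalgebra K (Fin n → Ω)} (c : Fin n → K) (v : Fin n → A) (j : Fin n) :
    ((∑ i, c i • v i : A) : Fin n → Ω) j = ∑ i, algebraMap K Ω (c i) * (v i : Fin n → Ω) j := by
  rw [AddSubmonoidClass.coe_finsetSum, Finset.sum_apply]
  refine Finset.sum_congr rfl fun i _ => ?_
  rw [Subalgebra.coe_smul, Pi.smul_apply, Algebra.smul_def]

/-- The trace of a subalgebra of `Ωⁿ` that has a basis over the base field which is also a basis of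
`Ωⁿ`. -/
theorem algebraMap_trace_eq_sum {A : Subalgebra K (Fin n → Ω)} (B : Module.Basis (Fin n) K A)
    (hdet : (Matrix.of fun i j => (B i : Fin n → Ω) j).det ≠ 0) (x : A) :
    algebraMap K Ω (Algebra.trace K A x) = ∑ j, (x : Fin n → Ω) j := by
  set M : Matrix (Fin n) (Fin n) Ω := Matrix.of fun i j => (B i : Fin n → Ω) j with hM
  set L := (Algebra.leftMulMatrix B x).map (algebraMap K Ω) with hL
  -- Multiplication by x is diagonal in the coordinates of Ωⁿ, and M is the change of basis.
  have h1 : L.transpose * M = M * Matrix.diagonal (x : Fin n → Ω) := by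
    ext k j
    rw [Matrix.mul_diagonal, Matrix.mul_apply]
    have h2 := congrArg (fun z : A => (z : Fin n → Ω) j) (B.sum_repr (x * B k))
    simp only [sum_smul_apply, MulMemClass.coe_mul, Pi.mul_apply] at h2
    rw [show M k j * (x : Fin n → Ω) j = (x : Fin n → Ω) j * (B k : Fin n → Ω) j from mul_comm _ _,
      ← h2]
    refine Finset.sum_congr rfl fun l _ => ?_
    simp only [Matrix.transpose_apply, hL, Matrix.map_apply, Algebra.leftMulMatrix_eq_repr_mul,
      hM, Matrix.of_apply]
  have hu : IsUnit M.det := isUnit_iff_ne_zero.2 hdet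
  have h2 : L.transpose = M * Matrix.diagonal (x : Fin n → Ω) * M⁻¹ := by
    rw [← h1, Matrix.mul_assoc, Matrix.mul_nonsing_inv _ hu, Matrix.mul_one]
  have h3 : L.trace = ∑ j, (x : Fin n → Ω) j := by
    rw [← Matrix.trace_transpose, h2, Matrix.mul_assoc, Matrix.trace_mul_comm, Matrix.mul_assoc,
      Matrix.nonsing_inv_mul _ hu, Matrix.mul_one, Matrix.trace_diagonal]
  rw [← h3, Algebra.trace_eq_matrix_trace B, hL, ← RingHom.mapMatrix_apply]
  simp [Matrix.trace]

/-- By the trace formula the trace matrix is the product of the matrix of coordinates with its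
transpose. -/
theorem algebraMap_discr_eq_det_sq {A : Subalgebra K (Fin n → Ω)} (B : Module.Basis (Fin n) K A)
    (hdet : (Matrix.of fun i j => (B i : Fin n → Ω) j).det ≠ 0) :
    algebraMap K Ω (Algebra.discr K B) = (Matrix.of fun i j => (B i : Fin n → Ω) j).det ^ 2 := by
  rw [Algebra.discr_def, RingHom.map_det]
  nth_rewrite 1 [pow_two]
  nth_rewrite 3 [← Matrix.det_transpose]
  rw [← Matrix.det_mul]
  congr 1
  ext i j
  rw [RingHom.mapMatrix_apply, Matrix.map_apply, Algebra.traceMatrix_apply, Algebra.traceForm_apply,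
    algebraMap_trace_eq_sum B hdet, Matrix.mul_apply]
  rfl

variable {R : Type*} [CommRing R] [Algebra R K] [Algebra R Ω] [IsScalarTower R K Ω]

/-- The product of monic equations of all coordinates is a monic equation of x. -/
theorem isIntegral_subalgebra_pi_iff {A : Subalgebra K (Fin n → Ω)} (x : A) :
    IsIntegral R x ↔ ∀ j, IsIntegral R ((x : Fin n → Ω) j) := by
  have hev : ∀ (p : Polynomial R) (j : Fin n),
      ((Polynomial.aeval x p : A) : Fin n → Ω) j = Polynomial.aeval ((x : Fin n → Ω) j) p := by
    intro p j
    exact (Polynomial.aeval_algHom_apply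
      (((Pi.evalAlgHom K (fun _ : Fin n => Ω) j).comp A.val).restrictScalars R) x p).symm
  constructor
  · rintro h j
    exact h.map (((Pi.evalAlgHom K (fun _ : Fin n => Ω) j).comp A.val).restrictScalars R)
  · intro h
    choose p hp hpx using h
    refine ⟨∏ j, p j, Polynomial.monic_prod_of_monic _ _ fun j _ => hp j, ?_⟩
    rw [← Polynomial.aeval_def]
    ext j
    rw [hev, map_prod]
    exact Finset.prod_eq_zero (Finset.mem_univ j) (by rw [Polynomial.aeval_def, hpx j])

variable [IsDomain R] [IsFractionRing R K]

/-- The discriminant ideal in terms of an integral basis. -/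
theorem span_discr_eq_span_singleton [Algebra.IsAlgebraic K Ω] {A : Subalgebra K (Fin n → Ω)}
    (v : Fin n → A)
    (hv : ∀ i, IsIntegral R (v i))
    (hspan : ∀ x : A, IsIntegral R x →
      ∃ c : Fin n → R, ∀ j, (x : Fin n → Ω) j = ∑ i, algebraMap R Ω (c i) * (v i : Fin n → Ω) j)
    {δ : R} (hδ : δ ≠ 0)
    (hdet : (Matrix.of fun i j => (v i : Fin n → Ω) j).det ^ 2 = algebraMap R Ω δ) :
    Ideal.span {a : R | ∃ b : Fin n → A, (∀ i, IsIntegral R (b i)) ∧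
      algebraMap R K a = Algebra.discr K b} = Ideal.span {δ} := by
  have hinjK : Function.Injective (algebraMap R K) := IsFractionRing.injective R K
  have hcomp : ∀ r : R, algebraMap R Ω r = algebraMap K Ω (algebraMap R K r) :=
    IsScalarTower.algebraMap_apply R K Ω
  have hinj : Function.Injective (algebraMap R Ω) := by
    intro a b h
    rw [hcomp, hcomp] at h
    exact hinjK ((algebraMap K Ω).injective h)
  set M : Matrix (Fin n) (Fin n) Ω := Matrix.of fun i j => (v i : Fin n → Ω) j with hM
  have hdet0 : M.det ≠ 0 := by
    intro h
    rw [h] at hdet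
    rcases Nat.eq_zero_or_pos n with rfl | hn
    · simp at h
    · exact hδ (hinj (by rw [← hdet, map_zero]; ring))
  have hspan' : ∀ x : A, IsIntegral R x →
      ∃ c : Fin n → R, x = ∑ i, algebraMap R K (c i) • v i := by
    intro x hx
    obtain ⟨c, hc⟩ := hspan x hx
    refine ⟨c, ?_⟩
    ext j
    rw [hc, sum_smul_apply]
    simp only [hcomp]
  have hli : LinearIndependent K v := by
    rw [Fintype.linearIndependent_iff]
    intro c hc
    have h1 : Matrix.vecMul (fun i => algebraMap K Ω (c i)) M = 0 := by
      ext j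
      have h2 := congrArg (fun z : A => (z : Fin n → Ω) j) hc
      simp only [sum_smul_apply] at h2
      exact h2
    have h3 := Matrix.eq_zero_of_vecMul_eq_zero hdet0 h1
    intro i
    have h4 := congrFun h3 i
    exact (algebraMap K Ω).injective (by rw [map_zero]; exact h4)
  -- Some nonzero multiple of x by an element of R has integral coordinates, and integral elements
  -- are spanned by v.
  have htop : ⊤ ≤ Submodule.span K (Set.range v) := by
    intro x _
    have halg : ∀ j, ∃ r : R, r ≠ 0 ∧ IsIntegral R (r • (x : Fin n → Ω) j) := fun j => by
      have h1 : IsAlgebraic K ((x : Fin n → Ω) j) := Algebra.IsAlgebraic.isAlgebraic _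
      have h2 : IsAlgebraic R ((x : Fin n → Ω) j) :=
        (IsFractionRing.isAlgebraic_iff R K Ω).2 h1
      exact h2.exists_integral_multiple
    choose r hr hrx using halg
    have hprod : ∏ j, r j ≠ 0 := Finset.prod_ne_zero_iff.2 fun j _ => hr j
    have hint : IsIntegral R (algebraMap R K (∏ j, r j) • x) := by
      rw [isIntegral_subalgebra_pi_iff]
      intro j
      rw [SetLike.val_smul, Pi.smul_apply, Algebra.smul_def, ← hcomp,
        ← Finset.prod_erase_mul _ _ (Finset.mem_univ j), map_mul, mul_assoc]
      have := hrx j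
      rw [Algebra.smul_def] at this
      exact isIntegral_algebraMap.mul this
    obtain ⟨c, hc⟩ := hspan' _ hint
    have hne : algebraMap R K (∏ j, r j) ≠ 0 := fun h => hprod (hinjK (by rw [h, map_zero]))
    rw [← inv_smul_smul₀ hne x, hc]
    exact Submodule.smul_mem _ _ (Submodule.sum_mem _ fun i _ =>
      Submodule.smul_mem _ _ (Submodule.subset_span ⟨i, rfl⟩))
  let B := Module.Basis.mk hli htop
  have hB : ⇑B = v := Module.Basis.coe_mk hli htop
  have hdiscr : algebraMap R K δ = Algebra.discr K v := by
    apply (algebraMap K Ω).injective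
    rw [← hcomp, ← hdet, ← hB, algebraMap_discr_eq_det_sq B (by rw [hB]; exact hdet0), hB]
  -- An integral tuple is v transformed by a matrix over R, and its discriminant is multiplied by
  -- the square of the determinant.
  apply le_antisymm
  · rw [Ideal.span_le]
    rintro a ⟨b, hb, hab⟩
    choose P hP using fun i => hspan' (b i) (hb i)
    have h1 : b = (((Matrix.of P).map (algebraMap R K)).map (algebraMap K A)).mulVec v := by
      ext1 i
      rw [hP i]
      simp [Matrix.mulVec, dotProduct, Algebra.smul_def]
    rw [h1, Algebra.discr_of_matrix_mulVec, ← hdiscr, ← RingHom.mapMatrix_apply, ← RingHom.map_det,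
      ← map_pow, ← map_mul] at hab
    rw [SetLike.mem_coe, Ideal.mem_span_singleton, hinjK hab]
    exact dvd_mul_left _ _
  · rw [Ideal.span_singleton_le_iff_mem]
    exact Ideal.subset_span ⟨v, hv, hdiscr⟩

end EtaleDiscriminant

section Descent

variable {S : Type*} [CommRing S] [IsDomain S] [IsDiscreteValuationRing S]
  {Ω : Type*} [Field Ω] [Algebra S Ω]

/-- The element x lies in the image of the fraction field, and S is integrally closed. -/
theorem exists_algebraMap_eq_of_isIntegral (hinj : Function.Injective (algebraMap S Ω)) {x : Ω}
    (hx : IsIntegral S x) {a b : S} (hb : b ≠ 0) (h : algebraMap S Ω b * x = algebraMap S Ω a) :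
    ∃ s : S, algebraMap S Ω s = x := by
  let F := FractionRing S
  let ψ : F →ₐ[S] Ω := IsFractionRing.liftAlgHom (g := Algebra.ofId S Ω) hinj
  have hψ : Function.Injective ψ := ψ.toRingHom.injective
  have hb' : algebraMap S Ω b ≠ 0 := fun h0 => hb (hinj (by rw [h0, map_zero]))
  have h1 : ψ (algebraMap S F a / algebraMap S F b) = x := by
    rw [map_div₀, AlgHom.commutes, AlgHom.commutes, ← h, mul_div_cancel_left₀ _ hb']
  rw [← h1, isIntegral_algHom_iff ψ hψ] at hx
  obtain ⟨s, hs⟩ := IsIntegrallyClosed.isIntegral_iff.1 hx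
  exact ⟨s, by rw [← h1, ← hs, AlgHom.commutes]⟩

variable [QuadHenselian S]

/-- The integral elements of a quadratic algebra with fundamental discriminant. -/
theorem IsFundDisc.exists_coords (hinj : Function.Injective (algebraMap S Ω)) {w n : S}
    (hγ : IsFundDisc (w ^ 2 - 4 * n)) {y x x' : Ω} (hy : y ^ 2 = algebraMap S Ω (w ^ 2 - 4 * n))
    (hx : IsIntegral S x) (hx' : IsIntegral S x') {a b c d : S} (hb : b ≠ 0) (hd : d ≠ 0)
    (hadd : algebraMap S Ω b * (x + x') = algebraMap S Ω a)
    (hsub : algebraMap S Ω d * (x - x') = algebraMap S Ω c * y) :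
    ∃ m r : S, x = algebraMap S Ω m + algebraMap S Ω r * ((algebraMap S Ω w + y) / 2) ∧
      x' = algebraMap S Ω m + algebraMap S Ω r * ((algebraMap S Ω w - y) / 2) := by
  have hne : ∀ s : S, s ≠ 0 → algebraMap S Ω s ≠ 0 := fun s hs h0 =>
    hs (hinj (by rw [h0, map_zero]))
  have h2 : (2 : Ω) ≠ 0 := by
    have := hne 2 two_ne_zero_of_quadHenselian
    rwa [map_ofNat] at this
  obtain ⟨T, hT⟩ := exists_algebraMap_eq_of_isIntegral hinj (hx.add hx') hb hadd
  have h4 : (4 : Ω) ≠ 0 := by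
    rw [show (4 : Ω) = 2 * 2 by norm_num]; exact mul_ne_zero h2 h2
  have hN : algebraMap S Ω (4 * d ^ 2) * (x * x') =
      algebraMap S Ω (d ^ 2 * T ^ 2 - c ^ 2 * (w ^ 2 - 4 * n)) := by
    rw [map_sub, map_mul _ (c ^ 2), ← hy, map_mul, map_mul, map_pow, map_pow, map_pow, map_ofNat,
      hT]
    linear_combination -(algebraMap S Ω d * (x - x') + algebraMap S Ω c * y) * hsub
  obtain ⟨N, hN'⟩ := exists_algebraMap_eq_of_isIntegral hinj (hx.mul hx')
    (mul_ne_zero four_ne_zero_of_quadHenselian (pow_ne_zero 2 hd)) hN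
  have hδ : d ^ 2 * (T ^ 2 - 4 * N) = c ^ 2 * (w ^ 2 - 4 * n) := by
    apply hinj
    rw [← hN', ← map_mul] at hN
    have := hinj hN
    congr 1
    linear_combination -this
  -- With trace T and norm N in S, fundamentality shows that (x − x')/y lies in S; this is r. The
  -- congruence T ≡ rw modulo 2 then provides m.
  obtain ⟨r, rfl⟩ := hγ.dvd_of_sq_mul_eq ⟨_, _, rfl⟩ hδ
  have hδ' : T ^ 2 - 4 * N = r ^ 2 * (w ^ 2 - 4 * n) :=
    mul_left_cancel₀ (pow_ne_zero 2 hd) (by rw [hδ]; ring)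
  have hsub' : x - x' = algebraMap S Ω r * y :=
    mul_left_cancel₀ (hne d hd) (by rw [hsub, map_mul]; ring)
  obtain ⟨m, hm⟩ := two_dvd_sub_of_four_dvd_sq_sub (w := T) (w' := r * w)
    ⟨N - r ^ 2 * n, by linear_combination hδ'⟩
  have hT' : x + x' = 2 * algebraMap S Ω m + algebraMap S Ω r * algebraMap S Ω w := by
    rw [← hT, show T = 2 * m + r * w by linear_combination hm, map_add, map_mul, map_mul,
      map_ofNat]
  refine ⟨m, r, ?_, ?_⟩
  · field_simp
    linear_combination hT' + hsub'
  · field_simp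
    linear_combination hT' - hsub'

end Descent

end LocalMass

/-! ### Representations to `D4` in terms of square roots. -/

namespace LocalMass

section Dihedral

/-- The dihedral group is the centralizer of the half turn i ↦ i + 2; addition of letters is modulo
4. This replaces generators by a condition that can be checked letter by letter. -/
theorem mem_D4_iff (g : Equiv.Perm (Fin 4)) : g ∈ D4 ↔ ∀ i, g (i + 2) = g i + 2 := by
  constructor
  · intro hg
    induction hg using Subgroup.closure_induction with
    | mem x hx =>
      rcases hx with rfl | rfl <;> decide
    | one => simp
    | mul x y _ _ hx hy => intro i; simp [hx, hy]
    | inv x _ hx =>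
      intro i
      apply x.injective
      rw [hx]; simp
  · intro h
    have h0 : (c[0, 1, 2, 3] : Equiv.Perm (Fin 4)) ∈ D4 := Subgroup.subset_closure (by simp)
    have h1 : (c[0, 2] : Equiv.Perm (Fin 4)) ∈ D4 := Subgroup.subset_closure (by simp)
    have key : ∀ g : Equiv.Perm (Fin 4), (∀ i, g (i + 2) = g i + 2) →
        ∃ (a : Fin 4) (b : Fin 2),
          g = (c[0, 1, 2, 3] : Equiv.Perm (Fin 4)) ^ (a : ℕ) * c[0, 2] ^ (b : ℕ) := by
      decide
    obtain ⟨a, b, rfl⟩ := key g h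
    exact mul_mem (pow_mem h0 _) (pow_mem h1 _)

theorem D4_apply_add_two (g : D4) (i : Fin 4) :
    (g : Equiv.Perm (Fin 4)) (i + 2) = (g : Equiv.Perm (Fin 4)) i + 2 :=
  (mem_D4_iff _).1 g.2 i

/-- Elements of `D4` either preserve or exchange the blocks `{0, 2}` and `{1, 3}`. -/
theorem D4_block (g : D4) :
    (((g : Equiv.Perm (Fin 4)) 0 = 0 ∨ (g : Equiv.Perm (Fin 4)) 0 = 2) ∧
      ((g : Equiv.Perm (Fin 4)) 1 = 1 ∨ (g : Equiv.Perm (Fin 4)) 1 = 3)) ∨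
    (((g : Equiv.Perm (Fin 4)) 0 = 1 ∨ (g : Equiv.Perm (Fin 4)) 0 = 3) ∧
      ((g : Equiv.Perm (Fin 4)) 1 = 0 ∨ (g : Equiv.Perm (Fin 4)) 1 = 2)) := by
  have h1 : (g : Equiv.Perm (Fin 4)) 1 ≠ (g : Equiv.Perm (Fin 4)) 0 := by
    intro h; exact absurd (Equiv.injective _ h) (by decide)
  have h2 : (g : Equiv.Perm (Fin 4)) 1 ≠ (g : Equiv.Perm (Fin 4)) 0 + 2 := by
    rw [← D4_apply_add_two]
    intro h; exact absurd (Equiv.injective _ h) (by decide)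
  generalize (g : Equiv.Perm (Fin 4)) 0 = a at *
  generalize (g : Equiv.Perm (Fin 4)) 1 = b at *
  revert a b
  decide

theorem D4_apply_two (g : D4) :
    (g : Equiv.Perm (Fin 4)) 2 = (g : Equiv.Perm (Fin 4)) 0 + 2 := D4_apply_add_two g 0

theorem D4_apply_three (g : D4) :
    (g : Equiv.Perm (Fin 4)) 3 = (g : Equiv.Perm (Fin 4)) 1 + 2 := D4_apply_add_two g 1

end Dihedral

section Galois

variable {K : Type*} [Field K]

/-- The condition `hidx` says that N has index at most 2 in H. If the index is 2, some x fixed by N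
is moved by some t in H outside N, and x − t x is fixed by N and negated by the rest of H. If H = N,
the last requirement is empty and 1 serves. -/
theorem exists_kummer_generator {H N : Subgroup (AbsGal K)} (hNH : N ≤ H)
    (hN : IsOpen (N : Set (AbsGal K)))
    (hidx : ∀ a ∈ H, a ∉ N → ∀ b ∈ H, b ∉ N → a * b ∈ N) :
    ∃ y : SeparableClosure K, y ≠ 0 ∧ (∀ σ ∈ N, σ y = y) ∧ ∀ σ ∈ H, σ ∉ N → σ y = -y := by
  by_cases hHN : H ≤ N
  · exact ⟨1, one_ne_zero, fun σ _ => map_one σ, fun σ h h' => absurd (hHN h) h'⟩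
  obtain ⟨t, htH, htN⟩ := SetLike.not_le_iff_exists.1 hHN
  have hfix := InfiniteGalois.fixingSubgroup_fixedField
    (⟨N, Subgroup.isClosed_of_isOpen N hN⟩ : ClosedSubgroup (AbsGal K))
  obtain ⟨x, hxN, hxt⟩ : ∃ x : SeparableClosure K, (∀ σ ∈ N, σ x = x) ∧ t x ≠ x := by
    by_contra! hcon
    apply htN
    change t ∈ ((⟨N, Subgroup.isClosed_of_isOpen N hN⟩ : ClosedSubgroup (AbsGal K)) :
      Subgroup (AbsGal K))
    rw [← hfix, IntermediateField.mem_fixingSubgroup_iff]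
    intro x hx
    exact hcon x fun σ hσ => hx ⟨σ, hσ⟩
  refine ⟨x - t x, fun h => hxt (sub_eq_zero.1 h).symm, fun σ hσ => ?_, fun σ hσH hσN => ?_⟩
  · have h1 : t⁻¹ * (σ * t) ∈ N := by
      refine hidx _ (inv_mem htH) (fun h => htN (inv_mem_iff.1 h)) _ (mul_mem (hNH hσ) htH)
        fun h => htN ?_
      simpa using mul_mem (inv_mem hσ) h
    have h2 : σ (t x) = t x := by
      have := congrArg t (hxN _ h1)
      simpa [← AlgEquiv.mul_apply, ← mul_assoc] using this
    rw [map_sub, hxN σ hσ, h2]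
  · have h1 : σ (t x) = x := hxN _ (hidx σ hσH hσN t htH htN)
    have h3 : t⁻¹ * σ ∈ N := hidx _ (inv_mem htH) (fun h => htN (inv_mem_iff.1 h)) σ hσH hσN
    have h2 : σ x = t x := by
      have := congrArg t (hxN _ h3)
      simpa [← AlgEquiv.mul_apply, ← mul_assoc] using this
    rw [map_sub, h1, h2]; ring

/-- The function on the letters that is `α` on one block and `-α` on the other. -/
noncomputable def tag (α : SeparableClosure K) : Fin 4 → SeparableClosure K := ![α, -α, α, -α]

/-- The function on the letters with opposite values within each block. -/
noncomputable def pt (y z : SeparableClosure K) : Fin 4 → SeparableClosure K := ![y, z, -y, -z]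

theorem isOpen_preimage_rep (ρ : GalRep K D4) (s : Set D4) : IsOpen (ρ.1 ⁻¹' s) := by
  let _ : TopologicalSpace D4 := ⊥
  have : DiscreteTopology D4 := ⟨rfl⟩
  exact (isOpen_discrete s).preimage ρ.2

/-- The elements that preserve the blocks. -/
noncomputable def blockSubgroup (ρ : GalRep K D4) : Subgroup (AbsGal K) where
  carrier := {σ | (ρ.1 σ : Equiv.Perm (Fin 4)) 0 = 0 ∨ (ρ.1 σ : Equiv.Perm (Fin 4)) 0 = 2}
  one_mem' := by simp
  mul_mem' {a b} ha hb := by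
    have h2 := D4_apply_two (ρ.1 a)
    simp only [Set.mem_ofPred_eq, map_mul, Subgroup.coe_mul, Equiv.Perm.coe_mul,
      Function.comp_apply] at *
    rcases ha with ha | ha <;> rcases hb with hb | hb <;> rw [hb] <;> simp [h2, ha]
  inv_mem' {a} ha := by
    have h1 := D4_apply_three (ρ.1 a)
    have h0 := D4_block (ρ.1 a)
    simp only [Set.mem_ofPred_eq, map_inv, Subgroup.coe_inv] at *
    have h2 : (ρ.1 a : Equiv.Perm (Fin 4)) (((ρ.1 a : Equiv.Perm (Fin 4))⁻¹) 0) = 0 := by simp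
    generalize ((ρ.1 a : Equiv.Perm (Fin 4))⁻¹) 0 = j at *
    fin_cases j
    · simp
    · rcases h0 with h0 | h0
      · rcases h0.2 with h | h <;> simp [h] at h2
      · rcases h0.1 with h | h <;> simp [h] at ha
    · simp
    · rcases h0 with h0 | h0
      · rcases h0.2 with h | h <;> simp [h1, h] at h2
      · rcases h0.1 with h | h <;> simp [h] at ha

theorem mem_blockSubgroup {ρ : GalRep K D4} {σ : AbsGal K} : σ ∈ blockSubgroup ρ ↔
    (ρ.1 σ : Equiv.Perm (Fin 4)) 0 = 0 ∨ (ρ.1 σ : Equiv.Perm (Fin 4)) 0 = 2 := Iff.rfl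

theorem even_of_mem {ρ : GalRep K D4} {σ : AbsGal K} (h : σ ∈ blockSubgroup ρ) :
    ((ρ.1 σ : Equiv.Perm (Fin 4)) 0 = 0 ∨ (ρ.1 σ : Equiv.Perm (Fin 4)) 0 = 2) ∧
      ((ρ.1 σ : Equiv.Perm (Fin 4)) 1 = 1 ∨ (ρ.1 σ : Equiv.Perm (Fin 4)) 1 = 3) := by
  rcases D4_block (ρ.1 σ) with h' | h'
  · exact h'
  · rcases mem_blockSubgroup.1 h with h | h <;> rcases h'.1 with h' | h' <;> simp [h] at h'

theorem odd_of_notMem {ρ : GalRep K D4} {σ : AbsGal K} (h : σ ∉ blockSubgroup ρ) :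
    ((ρ.1 σ : Equiv.Perm (Fin 4)) 0 = 1 ∨ (ρ.1 σ : Equiv.Perm (Fin 4)) 0 = 3) ∧
      ((ρ.1 σ : Equiv.Perm (Fin 4)) 1 = 0 ∨ (ρ.1 σ : Equiv.Perm (Fin 4)) 1 = 2) :=
  (D4_block (ρ.1 σ)).resolve_left fun h' => h (mem_blockSubgroup.2 h'.1)

theorem mul_mem_blockSubgroup_of_notMem {ρ : GalRep K D4} {σ τ : AbsGal K}
    (h : σ ∉ blockSubgroup ρ) (h' : τ ∉ blockSubgroup ρ) : σ * τ ∈ blockSubgroup ρ := by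
  rw [mem_blockSubgroup, map_mul, Subgroup.coe_mul, Equiv.Perm.coe_mul, Function.comp_apply]
  have h3 := D4_apply_three (ρ.1 σ)
  rcases (odd_of_notMem h').1 with h1 | h1 <;> rcases (odd_of_notMem h).2 with h2 | h2 <;>
    rw [h1] <;> simp [h2, h3]

theorem tag_mem_iff {ρ : GalRep K D4} {α : SeparableClosure K} :
    tag α ∈ ρ.etaleAlgebra ↔
      ∀ σ : AbsGal K, (σ ∈ blockSubgroup ρ → σ α = α) ∧ (σ ∉ blockSubgroup ρ → σ α = -α) := by
  constructor
  · intro h σ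
    have h0 : σ α = tag α _ := h σ 0
    refine ⟨fun hσ => ?_, fun hσ => ?_⟩
    · rcases (even_of_mem hσ).1 with h1 | h1 <;> rw [h0, h1] <;> rfl
    · rcases (odd_of_notMem hσ).1 with h1 | h1 <;> rw [h0, h1] <;> rfl
  · intro h σ i
    have h2 := D4_apply_two (ρ.1 σ)
    have h3 := D4_apply_three (ρ.1 σ)
    by_cases hσ : σ ∈ blockSubgroup ρ
    · have hα := (h σ).1 hσ
      obtain ⟨h0, h1⟩ := even_of_mem hσ
      rcases h0 with h0 | h0 <;> rcases h1 with h1 | h1 <;> fin_cases i <;>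
        simp [tag, h0, h1, h2, h3, hα]
    · have hα := (h σ).2 hσ
      obtain ⟨h0, h1⟩ := odd_of_notMem hσ
      rcases h0 with h0 | h0 <;> rcases h1 with h1 | h1 <;> fin_cases i <;>
        simp [tag, h0, h1, h2, h3, hα]

theorem exists_tag_mem (ρ : GalRep K D4) :
    ∃ α : SeparableClosure K, α ≠ 0 ∧ tag α ∈ ρ.etaleAlgebra := by
  obtain ⟨α, h0, h1, h2⟩ := exists_kummer_generator (H := ⊤) (N := blockSubgroup ρ) le_top
    (isOpen_preimage_rep ρ {g | (g : Equiv.Perm (Fin 4)) 0 = 0 ∨ (g : Equiv.Perm (Fin 4)) 0 = 2})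
    (fun a _ ha b _ hb => mul_mem_blockSubgroup_of_notMem ha hb)
  exact ⟨α, h0, tag_mem_iff.2 fun σ => ⟨h1 σ, h2 σ trivial⟩⟩

/-- The elements that fix the letter `j`. -/
noncomputable def letterSubgroup (ρ : GalRep K D4) (j : Fin 4) : Subgroup (AbsGal K) :=
  (MulAction.stabilizer (Equiv.Perm (Fin 4)) j).comap (D4.subtype.comp ρ.1)

theorem mem_letterSubgroup {ρ : GalRep K D4} {j : Fin 4} {σ : AbsGal K} :
    σ ∈ letterSubgroup ρ j ↔ (ρ.1 σ : Equiv.Perm (Fin 4)) j = j := Iff.rfl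

theorem isOpen_letterSubgroup (ρ : GalRep K D4) (j : Fin 4) :
    IsOpen (letterSubgroup ρ j : Set (AbsGal K)) :=
  isOpen_preimage_rep ρ {g | (g : Equiv.Perm (Fin 4)) j = j}

theorem exists_letter_generator (ρ : GalRep K D4) (j : Fin 4) (hj : j = 0 ∨ j = 1) :
    ∃ y : SeparableClosure K, y ≠ 0 ∧ ∀ σ ∈ blockSubgroup ρ,
      ((ρ.1 σ : Equiv.Perm (Fin 4)) j = j → σ y = y) ∧
      ((ρ.1 σ : Equiv.Perm (Fin 4)) j ≠ j → σ y = -y) := by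
  have hblk : ∀ σ ∈ blockSubgroup ρ, (ρ.1 σ : Equiv.Perm (Fin 4)) j ≠ j →
      (ρ.1 σ : Equiv.Perm (Fin 4)) j = j + 2 := by
    intro σ hσ hne
    obtain ⟨h0, h1⟩ := even_of_mem hσ
    rcases hj with rfl | rfl
    · simpa using h0.resolve_left hne
    · simpa using h1.resolve_left hne
  obtain ⟨y, h0, h1, h2⟩ := exists_kummer_generator (H := blockSubgroup ρ)
    (N := blockSubgroup ρ ⊓ letterSubgroup ρ j) inf_le_left
    ((isOpen_preimage_rep ρ {g | (g : Equiv.Perm (Fin 4)) 0 = 0 ∨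
      (g : Equiv.Perm (Fin 4)) 0 = 2}).inter (isOpen_letterSubgroup ρ j))
    (fun a ha ha' b hb hb' => by
      refine ⟨mul_mem ha hb, ?_⟩
      have ha'' := hblk a ha fun h => ha' ⟨ha, h⟩
      have hb'' := hblk b hb fun h => hb' ⟨hb, h⟩
      change a * b ∈ letterSubgroup ρ j
      rw [mem_letterSubgroup, map_mul, Subgroup.coe_mul, Equiv.Perm.coe_mul, Function.comp_apply,
        hb'', D4_apply_add_two, ha'', add_assoc]
      rcases hj with rfl | rfl <;> decide)
  exact ⟨y, h0, fun σ hσ => ⟨fun h => h1 σ ⟨hσ, h⟩, fun h => h2 σ hσ fun h' => h h'.2⟩⟩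

theorem pt_add_two (y z : SeparableClosure K) (i : Fin 4) : pt y z (i + 2) = -pt y z i := by
  fin_cases i <;> simp [pt]

/-- It is enough to check membership for one letter of each block. -/
theorem pt_mem_of_forall {ρ : GalRep K D4} {y z : SeparableClosure K}
    (h0 : ∀ σ : AbsGal K, σ y = pt y z ((ρ.1 σ : Equiv.Perm (Fin 4)) 0))
    (h1 : ∀ σ : AbsGal K, σ z = pt y z ((ρ.1 σ : Equiv.Perm (Fin 4)) 1)) :
    pt y z ∈ ρ.etaleAlgebra := by
  intro σ i
  have key : ∀ j : Fin 4, (j = 0 ∨ j = 1) →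
      σ (pt y z j) = pt y z ((ρ.1 σ : Equiv.Perm (Fin 4)) j) := by
    rintro j (rfl | rfl)
    · exact h0 σ
    · exact h1 σ
  have hi : (i = 0 ∨ i = 1) ∨ ∃ j : Fin 4, (j = 0 ∨ j = 1) ∧ i = j + 2 := by
    revert i; decide
  rcases hi with hi | ⟨j, hj, rfl⟩
  · exact key i hi
  · rw [pt_add_two, map_neg, key j hj, D4_apply_add_two, pt_add_two]

/-- On the stabilizer of the blocks, y is a square root that records the sign on {0, 2}. If some τ
exchanges the blocks, z has to be ±τ y, the sign being given by the image of the letter 0. Otherwise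
the two blocks are independent. -/
theorem exists_pt_mem (ρ : GalRep K D4) :
    ∃ y z : SeparableClosure K, y ≠ 0 ∧ z ≠ 0 ∧ pt y z ∈ ρ.etaleAlgebra := by
  obtain ⟨y, hy0, hy⟩ := exists_letter_generator ρ 0 (Or.inl rfl)
  by_cases hτ : ∃ τ, τ ∉ blockSubgroup ρ
  · obtain ⟨τ, hτ⟩ := hτ
    obtain ⟨z, hz, hz0⟩ : ∃ z, τ y = pt y z ((ρ.1 τ : Equiv.Perm (Fin 4)) 0) ∧ z ≠ 0 := by
      have hτy : τ y ≠ 0 := by simpa using hy0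
      rcases (odd_of_notMem hτ).1 with h | h <;> rw [h]
      · exact ⟨τ y, rfl, hτy⟩
      · exact ⟨-τ y, by simp [pt], by simpa using hτy⟩
    have hev : ∀ σ ∈ blockSubgroup ρ, σ y = pt y z ((ρ.1 σ : Equiv.Perm (Fin 4)) 0) := by
      intro σ hσ
      rcases (even_of_mem hσ).1 with h | h
      · rw [(hy σ hσ).1 h, h]; rfl
      · rw [(hy σ hσ).2 (by rw [h]; decide), h]; rfl
    have hτ' : ∀ σ ∈ blockSubgroup ρ,
        τ (σ y) = pt y z ((ρ.1 (τ * σ) : Equiv.Perm (Fin 4)) 0) := by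
      intro σ hσ
      rw [hev σ hσ, map_mul, Subgroup.coe_mul, Equiv.Perm.coe_mul, Function.comp_apply]
      rcases (even_of_mem hσ).1 with h | h <;> rw [h]
      · exact hz
      · rw [D4_apply_two, pt_add_two, ← hz]; simp [pt]
    have h0 : ∀ σ : AbsGal K, σ y = pt y z ((ρ.1 σ : Equiv.Perm (Fin 4)) 0) := by
      intro σ
      by_cases hσ : σ ∈ blockSubgroup ρ
      · exact hev σ hσ
      · have h := hτ' (τ⁻¹ * σ) (mul_mem_blockSubgroup_of_notMem
          (fun h => hτ (inv_mem_iff.1 h)) hσ)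
        simpa [← AlgEquiv.mul_apply, ← mul_assoc] using h
    refine ⟨y, z, hy0, hz0, pt_mem_of_forall h0 fun σ => ?_⟩
    have h1 := h0 (σ * τ)
    rw [AlgEquiv.mul_apply, hz, map_mul, Subgroup.coe_mul, Equiv.Perm.coe_mul,
      Function.comp_apply] at h1
    rcases (odd_of_notMem hτ).1 with h | h <;> rw [h] at h1
    · exact h1
    · rw [D4_apply_three, pt_add_two] at h1
      simpa [pt] using h1
  · push Not at hτ
    obtain ⟨z, hz0, hz⟩ := exists_letter_generator ρ 1 (Or.inr rfl)
    refine ⟨y, z, hy0, hz0, pt_mem_of_forall (fun σ => ?_) fun σ => ?_⟩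
    · rcases (even_of_mem (hτ σ)).1 with h | h
      · rw [(hy σ (hτ σ)).1 h, h]; rfl
      · rw [(hy σ (hτ σ)).2 (by rw [h]; decide), h]; rfl
    · rcases (even_of_mem (hτ σ)).2 with h | h
      · rw [(hz σ (hτ σ)).1 h, h]; rfl
      · rw [(hz σ (hτ σ)).2 (by rw [h]; decide), h]; rfl

/-- The first function separates the blocks and the second one the letters within a block. A
representation is therefore determined by α, y and z. -/
theorem tag_pt_injective (h2 : (2 : K) ≠ 0) {α y z : SeparableClosure K} (hα : α ≠ 0) (hy : y ≠ 0)
    (hz : z ≠ 0) {i j : Fin 4} (h : tag α i = tag α j) (h' : pt y z i = pt y z j) : i = j := by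
  have hne : ∀ x : SeparableClosure K, x ≠ 0 → x ≠ -x := by
    intro x hx e
    have h3 : (2 : SeparableClosure K) * x = 0 := by linear_combination e
    have h4 : (2 : SeparableClosure K) ≠ 0 := by
      rw [← map_ofNat (algebraMap K (SeparableClosure K)) 2]
      exact (map_ne_zero _).2 h2
    exact mul_ne_zero h4 hx h3
  fin_cases i <;> fin_cases j <;>
    simp_all [tag, pt, hne α hα, hne y hy, hne z hz, (hne α hα).symm, (hne y hy).symm,
      (hne z hz).symm]

theorem rep_ext (h2 : (2 : K) ≠ 0) {ρ ρ' : GalRep K D4} {α y z : SeparableClosure K} (hα : α ≠ 0)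
    (hy : y ≠ 0) (hz : z ≠ 0) (h1 : tag α ∈ ρ.etaleAlgebra) (h1' : tag α ∈ ρ'.etaleAlgebra)
    (h3 : pt y z ∈ ρ.etaleAlgebra) (h3' : pt y z ∈ ρ'.etaleAlgebra) : ρ = ρ' := by
  apply Subtype.ext
  ext σ i : 3
  exact tag_pt_injective h2 hα hy hz (by rw [← h1 σ i, ← h1' σ i]) (by rw [← h3 σ i, ← h3' σ i])

/-- The Galois group permutes the four pairs (`tag α i`, `pt y z i`), which correspond to the
letters. The permutation commutes with i ↦ i + 2, so it lies in `D4`. Continuity holds because α, y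
and z have open stabilizers. -/
theorem exists_rep (h2 : (2 : K) ≠ 0) {α y z : SeparableClosure K} (hα : α ≠ 0) (hy : y ≠ 0)
    (hz : z ≠ 0)
    (h : ∀ σ : AbsGal K, (σ α = α ∧ (σ y = y ∨ σ y = -y) ∧ (σ z = z ∨ σ z = -z)) ∨
      (σ α = -α ∧ (σ y = z ∨ σ y = -z) ∧ (σ z = y ∨ σ z = -y))) :
    ∃ ρ : GalRep K D4, tag α ∈ ρ.etaleAlgebra ∧ pt y z ∈ ρ.etaleAlgebra := by
  have hex : ∀ (σ : AbsGal K) (i : Fin 4), ∃ j, σ (tag α i) = tag α j ∧ σ (pt y z i) = pt y z j := by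
    intro σ i
    have hex' : ∃ f : Fin 4 → Fin 4, ∀ i, σ (tag α i) = tag α (f i) ∧ σ (pt y z i) = pt y z (f i) := by
      -- The eight sign patterns are the eight elements of the dihedral group.
      rcases h σ with ⟨ha, hb | hb, hc | hc⟩ | ⟨ha, hb | hb, hc | hc⟩
      · exact ⟨![0, 1, 2, 3], fun i => by fin_cases i <;> simp [tag, pt, ha, hb, hc]⟩
      · exact ⟨![0, 3, 2, 1], fun i => by fin_cases i <;> simp [tag, pt, ha, hb, hc]⟩
      · exact ⟨![2, 1, 0, 3], fun i => by fin_cases i <;> simp [tag, pt, ha, hb, hc]⟩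
      · exact ⟨![2, 3, 0, 1], fun i => by fin_cases i <;> simp [tag, pt, ha, hb, hc]⟩
      · exact ⟨![1, 0, 3, 2], fun i => by fin_cases i <;> simp [tag, pt, ha, hb, hc]⟩
      · exact ⟨![1, 2, 3, 0], fun i => by fin_cases i <;> simp [tag, pt, ha, hb, hc]⟩
      · exact ⟨![3, 0, 1, 2], fun i => by fin_cases i <;> simp [tag, pt, ha, hb, hc]⟩
      · exact ⟨![3, 2, 1, 0], fun i => by fin_cases i <;> simp [tag, pt, ha, hb, hc]⟩
    obtain ⟨f, hf⟩ := hex'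
    exact ⟨f i, hf i⟩
  choose f hf1 hf2 using hex
  have hinj : ∀ {i j}, tag α i = tag α j → pt y z i = pt y z j → i = j :=
    fun h h' => tag_pt_injective h2 hα hy hz h h'
  let φ : AbsGal K →* Function.End (Fin 4) :=
    { toFun := f
      map_one' := by
        funext i
        exact hinj (by rw [← hf1]; rfl) (by rw [← hf2]; rfl)
      map_mul' := fun σ τ => by
        funext i
        refine hinj ?_ ?_
        · change _ = tag α (f σ (f τ i))
          rw [← hf1, ← hf1, ← hf1]; rfl
        · change _ = pt y z (f σ (f τ i))
          rw [← hf2, ← hf2, ← hf2]; rfl }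
  have hφ : ∀ σ i, φ.toHomPerm σ i = f σ i := fun σ i => rfl
  have htag : ∀ i, tag α (i + 2) = tag α i := fun i => by fin_cases i <;> simp [tag]
  let ψ : AbsGal K →* D4 := φ.toHomPerm.codRestrict D4 fun σ => by
    rw [mem_D4_iff]
    intro i
    rw [hφ, hφ]
    refine hinj ?_ ?_
    · rw [← hf1, htag, htag, ← hf1]
    · rw [← hf2, pt_add_two, pt_add_two, ← hf2, map_neg]
  have hcont : Continuous[inferInstance, ⊥] ψ := by
    let _ : TopologicalSpace D4 := ⊥
    have : DiscreteTopology D4 := ⟨rfl⟩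
    refine continuous_of_continuousAt_one ψ ?_
    rw [ContinuousAt, nhds_discrete D4, Filter.tendsto_pure]
    have hopen : ∀ x : SeparableClosure K, ∀ᶠ σ in 𝓝 (1 : AbsGal K), σ x = x := fun x =>
      (stabilizer_isOpen_of_isIntegral (K := K) x).mem_nhds (one_mem _)
    filter_upwards [hopen α, hopen y, hopen z] with σ ha hb hc
    apply Subtype.ext
    rw [map_one]
    ext i : 1
    change f σ i = i
    refine hinj ?_ ?_
    · rw [← hf1]; fin_cases i <;> simp [tag, ha]
    · rw [← hf2]; fin_cases i <;> simp [pt, hb, hc]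
  exact ⟨⟨ψ, hcont⟩, fun σ i => hf1 σ i, fun σ i => hf2 σ i⟩

end Galois

end LocalMass

/-! ### Kummer theory with fundamental discriminants; the split case F = K × K. -/

namespace LocalMass

open IsLocalRing

section Kummer

variable {S Ω : Type*} [CommRing S] [IsDomain S] [IsDiscreteValuationRing S] [Field Ω] [Algebra S Ω]

theorem DiscClass.rep_ne_zero (β : DiscClass S) : β.rep ≠ 0 :=
  β.rep_fund.ne_zero (IsDiscreteValuationRing.not_isField S)

theorem DiscClass.root_ne_zero (hinj : Function.Injective (algebraMap S Ω)) {β : DiscClass S}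
    {y : Ω} (hy : y ^ 2 = algebraMap S Ω β.rep) : y ≠ 0 := by
  rintro rfl
  rw [zero_pow two_ne_zero, eq_comm, map_eq_zero_iff _ hinj] at hy
  exact β.rep_ne_zero hy

/-- Every element whose square lies in the fraction field of `S` is a multiple of the square root of
a unique fundamental discriminant. -/
theorem DiscClass.exists_mul_eq_mul (hinj : Function.Injective (algebraMap S Ω)) (h2 : (2 : S) ≠ 0)
    {η : DiscClass S → Ω} (hη : ∀ β, η β ^ 2 = algebraMap S Ω β.rep) {x : Ω} (hx : x ≠ 0) {a b : S}
    (hb : b ≠ 0) (h : algebraMap S Ω b * x ^ 2 = algebraMap S Ω a) :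
    ∃ (β : DiscClass S) (s t : S), s ≠ 0 ∧ t ≠ 0 ∧
      algebraMap S Ω s * x = algebraMap S Ω t * η β := by
  have hne : ∀ s : S, s ≠ 0 → algebraMap S Ω s ≠ 0 := fun s hs => by
    rwa [Ne, map_eq_zero_iff _ hinj]
  have ha : a ≠ 0 := by
    rintro rfl
    rw [map_zero] at h
    exact mul_ne_zero (hne b hb) (pow_ne_zero 2 hx) h
  have h4 : (4 : S) ≠ 0 := by
    rw [show (4 : S) = 2 * 2 by norm_num]
    exact mul_ne_zero h2 h2
  obtain ⟨r, γ, hr, hγ, hrγ⟩ := exists_fundDisc (δ := 4 * (a * b))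
    (mul_ne_zero h4 (mul_ne_zero ha hb)) (isDisc_four_mul _)
  obtain ⟨u, hu⟩ := (DiscClass.mk_eq_iff hγ (DiscClass.mk hγ)).1 rfl
  have h5 : (algebraMap S Ω (2 * b) * x) ^ 2 =
      (algebraMap S Ω (r * u) * η (DiscClass.mk hγ)) ^ 2 := by
    rw [mul_pow, mul_pow, hη]
    have e : algebraMap S Ω (4 * (a * b)) =
        algebraMap S Ω (r ^ 2 * ((u : S) ^ 2 * (DiscClass.mk hγ).rep)) := by rw [hrγ, ← hu]
    simp only [map_mul, map_pow, map_ofNat] at e ⊢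
    linear_combination e + 4 * algebraMap S Ω b * h
  rcases sq_eq_sq_iff_eq_or_eq_neg.1 h5 with h6 | h6
  · exact ⟨_, _, _, mul_ne_zero h2 hb, mul_ne_zero hr u.ne_zero, h6⟩
  · exact ⟨_, _, -(r * u), mul_ne_zero h2 hb, neg_ne_zero.2 (mul_ne_zero hr u.ne_zero), by
      rw [h6, map_neg, neg_mul]⟩

theorem DiscClass.eq_of_mul_eq_mul (hinj : Function.Injective (algebraMap S Ω)) {β β' : DiscClass S}
    {y y' : Ω} (hy : y ^ 2 = algebraMap S Ω β.rep) (hy' : y' ^ 2 = algebraMap S Ω β'.rep) {s t : S}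
    (hs : s ≠ 0) (h : algebraMap S Ω s * y = algebraMap S Ω t * y') : β = β' := by
  have h1 : t ^ 2 * β'.rep = s ^ 2 * β.rep := by
    apply hinj
    simp only [map_mul, map_pow, ← hy, ← hy', ← mul_pow, h]
  obtain ⟨u, -, hu⟩ := β.rep_fund.exists_unit β'.rep_fund hs h1
  rw [← β.mk_rep, ← β'.mk_rep]
  exact (DiscClass.mk_eq_mk_iff _ _).2 ⟨u, hu⟩

/-- Two such square roots whose product lies in the fraction field belong to the same class. -/
theorem DiscClass.eq_of_mul_mem (hinj : Function.Injective (algebraMap S Ω)) {β β' : DiscClass S}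
    {y y' : Ω} (hy : y ^ 2 = algebraMap S Ω β.rep) (hy' : y' ^ 2 = algebraMap S Ω β'.rep) {a b : S}
    (hb : b ≠ 0) (h : algebraMap S Ω b * (y * y') = algebraMap S Ω a) : β = β' := by
  refine DiscClass.eq_of_mul_eq_mul hinj hy hy' (s := b * β'.rep) (t := a)
    (mul_ne_zero hb β'.rep_ne_zero) ?_
  rw [map_mul, ← hy', ← h]
  ring

end Kummer

section Fixed

variable {R K : Type*} [CommRing R] [Field K] [Algebra R K]

theorem galois_algebraMap (σ : AbsGal K) (a : R) :
    σ (algebraMap R (SeparableClosure K) a) = algebraMap R (SeparableClosure K) a := by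
  rw [IsScalarTower.algebraMap_apply R K (SeparableClosure K), AlgEquiv.commutes]

variable [IsFractionRing R K]

variable (R K) in
theorem algebraMap_separableClosure_injective :
    Function.Injective (algebraMap R (SeparableClosure K)) := by
  rw [IsScalarTower.algebraMap_eq R K (SeparableClosure K)]
  exact (algebraMap K (SeparableClosure K)).injective.comp (IsFractionRing.injective R K)

variable (R) in
-- An element of the fraction field is recorded as bx = a with b ≠ 0. The same form serves for
-- quadratic orders without naming their fraction fields.
theorem exists_mul_eq_of_fixed [IsDomain R] {x : SeparableClosure K} (h : ∀ σ : AbsGal K, σ x = x) :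
    ∃ a b : R, b ≠ 0 ∧
      algebraMap R (SeparableClosure K) b * x = algebraMap R (SeparableClosure K) a := by
  obtain ⟨k, rfl⟩ := (InfiniteGalois.mem_range_algebraMap_iff_fixed x).2 h
  obtain ⟨a, b, hb, rfl⟩ := IsFractionRing.div_surjective (A := R) k
  refine ⟨a, b, nonZeroDivisors.ne_zero hb, ?_⟩
  have h0 : algebraMap R K b ≠ 0 := by
    rw [Ne, map_eq_zero_iff _ (IsFractionRing.injective R K)]
    exact nonZeroDivisors.ne_zero hb
  rw [IsScalarTower.algebraMap_apply R K (SeparableClosure K),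
    IsScalarTower.algebraMap_apply R K (SeparableClosure K), ← map_mul, mul_div_cancel₀ _ h0]

theorem mem_etaleAlgebra_of_mul_mem {ρ : GalRep K D4} {x p : Fin 4 → SeparableClosure K}
    (hx : x ∈ ρ.etaleAlgebra) (h0 : ∀ i, x i ≠ 0) (h : x * p ∈ ρ.etaleAlgebra) :
    p ∈ ρ.etaleAlgebra := by
  intro σ i
  have h1 := h σ i
  rw [Pi.mul_apply, Pi.mul_apply, map_mul, hx σ i] at h1
  exact mul_left_cancel₀ (h0 _) h1

theorem galois_eq_or_eq_neg_of_sq {x : SeparableClosure K} {σ : AbsGal K} {y : SeparableClosure K}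
    (h : σ (x ^ 2) = y ^ 2) : σ x = y ∨ σ x = -y := by
  rw [map_pow] at h
  exact sq_eq_sq_iff_eq_or_eq_neg.1 h

end Fixed

section Tag

variable {R K : Type*} [CommRing R] [IsDomain R] [IsDiscreteValuationRing R] [Field K] [Algebra R K]
  [IsFractionRing R K]

/-- A representation determines a class of discriminants, that of the field that is fixed by the
elements that preserve the blocks. -/
theorem exists_class_tag_mem (h2 : (2 : R) ≠ 0) {η : DiscClass R → SeparableClosure K}
    (hη : ∀ c, η c ^ 2 = algebraMap R _ c.rep) (ρ : GalRep K D4) :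
    ∃ c, tag (η c) ∈ ρ.etaleAlgebra := by
  have hinj := algebraMap_separableClosure_injective R K
  obtain ⟨α, h0, hα⟩ := exists_tag_mem ρ
  rw [tag_mem_iff] at hα
  obtain ⟨a, b, hb, hab⟩ := exists_mul_eq_of_fixed R (x := α ^ 2) fun σ => by
    by_cases h : σ ∈ blockSubgroup ρ
    · rw [map_pow, (hα σ).1 h]
    · rw [map_pow, (hα σ).2 h, neg_sq]
  obtain ⟨c, s, t, hs, ht, hst⟩ := DiscClass.exists_mul_eq_mul hinj h2 hη h0 hb hab
  have ht' : algebraMap R (SeparableClosure K) t ≠ 0 := by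
    rwa [Ne, map_eq_zero_iff _ hinj]
  refine ⟨c, tag_mem_iff.2 fun σ => ⟨fun h => ?_, fun h => ?_⟩⟩
  · apply mul_left_cancel₀ ht'
    rw [← hst, ← galois_algebraMap σ t, ← map_mul, ← hst, map_mul, galois_algebraMap, (hα σ).1 h]
  · apply mul_left_cancel₀ ht'
    rw [mul_neg, ← hst, ← galois_algebraMap σ t, ← map_mul, ← hst, map_mul, galois_algebraMap,
      (hα σ).2 h, mul_neg]

/-- Both roots are multiplied by the same sign, so their product is fixed by the Galois group. -/
theorem class_eq_of_tag_mem {ρ : GalRep K D4} {c c' : DiscClass R} {α α' : SeparableClosure K}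
    (hα : α ^ 2 = algebraMap R _ c.rep) (hα' : α' ^ 2 = algebraMap R _ c'.rep)
    (h : tag α ∈ ρ.etaleAlgebra) (h' : tag α' ∈ ρ.etaleAlgebra) : c = c' := by
  rw [tag_mem_iff] at h h'
  obtain ⟨a, b, hb, hab⟩ := exists_mul_eq_of_fixed R (x := α * α') fun σ => by
    by_cases hσ : σ ∈ blockSubgroup ρ
    · rw [map_mul, (h σ).1 hσ, (h' σ).1 hσ]
    · rw [map_mul, (h σ).2 hσ, (h' σ).2 hσ, neg_mul_neg]
  exact DiscClass.eq_of_mul_mem (algebraMap_separableClosure_injective R K) hα hα' hb hab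

end Tag

section Split

variable {R K : Type*} [CommRing R] [IsDomain R] [IsDiscreteValuationRing R] [Field K] [Algebra R K]
  [IsFractionRing R K]

theorem mem_blockSubgroup_of_fixed {ρ : GalRep K D4} {α : SeparableClosure K} (h2 : (2 : K) ≠ 0)
    (h0 : α ≠ 0) (hα : tag α ∈ ρ.etaleAlgebra) {σ : AbsGal K} (h : σ α = α) :
    σ ∈ blockSubgroup ρ := by
  by_contra hσ
  have h1 := (tag_mem_iff.1 hα σ).2 hσ
  rw [h] at h1
  have h3 : (2 : SeparableClosure K) * α = 0 := by linear_combination h1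
  have h4 : (2 : SeparableClosure K) ≠ 0 := by
    rw [← map_ofNat (algebraMap K (SeparableClosure K)) 2]
    simpa using h2
  exact mul_ne_zero h4 h0 h3

theorem apply_of_pt_mem {ρ : GalRep K D4} {y z : SeparableClosure K} (h : pt y z ∈ ρ.etaleAlgebra)
    {σ : AbsGal K} (hσ : σ ∈ blockSubgroup ρ) : (σ y = y ∨ σ y = -y) ∧ (σ z = z ∨ σ z = -z) := by
  have h0 : σ y = pt y z _ := h σ 0
  have h1 : σ z = pt y z _ := h σ 1
  obtain ⟨h3, h4⟩ := even_of_mem hσ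
  constructor
  · rcases h3 with h3 | h3 <;> rw [h3] at h0
    · exact Or.inl h0
    · exact Or.inr h0
  · rcases h4 with h4 | h4 <;> rw [h4] at h1
    · exact Or.inl h1
    · exact Or.inr h1

/-- Both square roots of a representation transform by the same sign. -/
theorem mul_fixed_of_pt_mem {ρ : GalRep K D4} {y z y' z' : SeparableClosure K}
    (h : pt y z ∈ ρ.etaleAlgebra) (h' : pt y' z' ∈ ρ.etaleAlgebra) {σ : AbsGal K}
    (hσ : σ ∈ blockSubgroup ρ) : σ (y * y') = y * y' ∧ σ (z * z') = z * z' := by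
  have h0 : σ (y * y') = pt y z _ * pt y' z' _ := (mul_mem h h') σ 0
  have h1 : σ (z * z') = pt y z _ * pt y' z' _ := (mul_mem h h') σ 1
  obtain ⟨h3, h4⟩ := even_of_mem hσ
  constructor
  · rw [h0]
    rcases h3 with h3 | h3 <;> rw [h3] <;> simp [pt]
  · rw [h1]
    rcases h4 with h4 | h4 <;> rw [h4] <;> simp [pt]

variable {η : DiscClass R → SeparableClosure K} {α : SeparableClosure K}

theorem exists_rep_split (hη : ∀ c, η c ^ 2 = algebraMap R _ c.rep) (h0 : α ≠ 0)
    (hα : ∀ σ : AbsGal K, σ α = α) (h2 : (2 : K) ≠ 0) (β β' : DiscClass R) :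
    ∃ ρ : GalRep K D4, tag α ∈ ρ.etaleAlgebra ∧ pt (η β) (η β') ∈ ρ.etaleAlgebra := by
  have hinj := algebraMap_separableClosure_injective R K
  refine exists_rep h2 h0 (DiscClass.root_ne_zero hinj (hη β)) (DiscClass.root_ne_zero hinj (hη β'))
    fun σ => Or.inl ⟨hα σ, galois_eq_or_eq_neg_of_sq ?_, galois_eq_or_eq_neg_of_sq ?_⟩ <;>
  rw [hη, galois_algebraMap]

theorem exists_pt_mem_split (hη : ∀ c, η c ^ 2 = algebraMap R _ c.rep) (h0 : α ≠ 0)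
    (hα : ∀ σ : AbsGal K, σ α = α) (h2 : (2 : R) ≠ 0) (h2' : (2 : K) ≠ 0) {ρ : GalRep K D4}
    (hρ : tag α ∈ ρ.etaleAlgebra) : ∃ β β' : DiscClass R, pt (η β) (η β') ∈ ρ.etaleAlgebra := by
  have hinj := algebraMap_separableClosure_injective R K
  have hne : ∀ s : R, s ≠ 0 → algebraMap R (SeparableClosure K) s ≠ 0 := fun s hs => by
    rwa [Ne, map_eq_zero_iff _ hinj]
  have hblk : ∀ σ, σ ∈ blockSubgroup ρ := fun σ => mem_blockSubgroup_of_fixed h2' h0 hρ (hα σ)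
  obtain ⟨y, z, hy, hz, hyz⟩ := exists_pt_mem ρ
  have key : ∀ x : SeparableClosure K, x ≠ 0 → (∀ σ : AbsGal K, σ x = x ∨ σ x = -x) →
      ∃ (β : DiscClass R) (s t : R), s ≠ 0 ∧ t ≠ 0 ∧
        algebraMap R _ s * x = algebraMap R _ t * η β := by
    intro x hx h
    obtain ⟨a, b, hb, hab⟩ := exists_mul_eq_of_fixed R (x := x ^ 2) fun σ => by
      rcases h σ with h | h <;> rw [map_pow, h]
      rw [neg_sq]
    exact DiscClass.exists_mul_eq_mul hinj h2 hη hx hb hab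
  obtain ⟨β, s, t, hs, ht, hst⟩ := key y hy fun σ => (apply_of_pt_mem hyz (hblk σ)).1
  obtain ⟨β', s', t', hs', ht', hst'⟩ := key z hz fun σ => (apply_of_pt_mem hyz (hblk σ)).2
  -- As the blocks are preserved, functions that are constant on each block with values in R belong
  -- to the algebra. Hence y and z can be rescaled independently.
  have hmem : ∀ a b : R, ![algebraMap R (SeparableClosure K) a, algebraMap R _ b,
      algebraMap R _ a, algebraMap R _ b] ∈ ρ.etaleAlgebra := by
    intro a b σ i
    have h3 := D4_apply_two (ρ.1 σ)
    have h4 := D4_apply_three (ρ.1 σ)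
    obtain ⟨h5, h6⟩ := even_of_mem (hblk σ)
    fin_cases i
    · rcases h5 with h5 | h5 <;> simp [h5, galois_algebraMap]
    · rcases h6 with h6 | h6 <;> simp [h6, galois_algebraMap]
    · rcases h5 with h5 | h5 <;> simp [h3, h5, galois_algebraMap]
    · rcases h6 with h6 | h6 <;> simp [h4, h6, galois_algebraMap]
  refine ⟨β, β', mem_etaleAlgebra_of_mul_mem (hmem t t') (fun i => ?_) ?_⟩
  · fin_cases i <;> simp [hne _ ht, hne _ ht']
  · convert mul_mem (hmem s s') hyz using 1
    ext i
    fin_cases i <;> simp [pt, hst, hst']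

theorem eq_of_pt_mem_split (hη : ∀ c, η c ^ 2 = algebraMap R _ c.rep) (h0 : α ≠ 0)
    (hα : ∀ σ : AbsGal K, σ α = α) (h2' : (2 : K) ≠ 0) {ρ : GalRep K D4}
    (hρ : tag α ∈ ρ.etaleAlgebra) {β β' δ δ' : DiscClass R}
    (h : pt (η β) (η β') ∈ ρ.etaleAlgebra) (h' : pt (η δ) (η δ') ∈ ρ.etaleAlgebra) :
    β = δ ∧ β' = δ' := by
  have hinj := algebraMap_separableClosure_injective R K
  have hblk : ∀ σ, σ ∈ blockSubgroup ρ := fun σ => mem_blockSubgroup_of_fixed h2' h0 hρ (hα σ)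
  obtain ⟨a, b, hb, hab⟩ := exists_mul_eq_of_fixed R fun σ => (mul_fixed_of_pt_mem h h' (hblk σ)).1
  obtain ⟨a', b', hb', hab'⟩ :=
    exists_mul_eq_of_fixed R fun σ => (mul_fixed_of_pt_mem h h' (hblk σ)).2
  exact ⟨DiscClass.eq_of_mul_mem hinj (hη _) (hη _) hb hab,
    DiscClass.eq_of_mul_mem hinj (hη _) (hη _) hb' hab'⟩

end Split

end LocalMass

/-! ### The case in which F is a quadratic field extension. -/

namespace LocalMass

open IsLocalRing

theorem apply_of_pt_mem_of_notMem {K : Type*} [Field K] {ρ : GalRep K D4} {y z : SeparableClosure K} (σ : AbsGal K)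
    (hσ : σ ∉ blockSubgroup ρ) (h : pt y z ∈ ρ.etaleAlgebra) : σ y = z ∨ σ y = -z := by
  have h0 : σ y = pt y z _ := h σ 0
  rcases (odd_of_notMem hσ).1 with h1 | h1 <;> rw [h1] at h0
  · exact Or.inl h0
  · exact Or.inr h0

section Inert

variable {R K : Type*} [CommRing R] [Field K] [Algebra R K] {w n : R}
  [Algebra (QuadraticAlgebra R (-n) w) (SeparableClosure K)]
  [IsScalarTower R (QuadraticAlgebra R (-n) w) (SeparableClosure K)]

variable (K w n) in
/-- The square root of `w ^ 2 - 4 * n`. -/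
noncomputable def quadRoot : SeparableClosure K :=
  algebraMap (QuadraticAlgebra R (-n) w) (SeparableClosure K) ⟨-w, 2⟩

theorem quadRoot_sq : quadRoot K w n ^ 2 = algebraMap R _ (w ^ 2 - 4 * n) := by
  rw [quadRoot, ← map_pow,
    IsScalarTower.algebraMap_apply R (QuadraticAlgebra R (-n) w) (SeparableClosure K)]
  congr 1
  ext
  · simp [pow_two]; ring
  · simp [pow_two]; ring

theorem two_mul_algebraMap_quadraticAlgebra (s : QuadraticAlgebra R (-n) w) :
    2 * algebraMap _ (SeparableClosure K) s =
      algebraMap R _ (2 * s.re + w * s.im) + algebraMap R _ s.im * quadRoot K w n := by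
  rw [quadRoot,
    IsScalarTower.algebraMap_apply R (QuadraticAlgebra R (-n) w) (SeparableClosure K),
    IsScalarTower.algebraMap_apply R (QuadraticAlgebra R (-n) w) (SeparableClosure K),
    ← map_ofNat (algebraMap (QuadraticAlgebra R (-n) w) (SeparableClosure K)) 2,
    ← map_mul, ← map_mul, ← map_add]
  congr 1
  ext
  · simp [two_mul]; ring
  · simp [two_mul]; ring

theorem galois_quadRoot (σ : AbsGal K) :
    σ (quadRoot K w n) = quadRoot K w n ∨ σ (quadRoot K w n) = -quadRoot K w n :=
  galois_eq_or_eq_neg_of_sq (by rw [quadRoot_sq, galois_algebraMap])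

variable [IsFractionRing R K]

theorem two_ne_zero_separableClosure (h2 : (2 : R) ≠ 0) : (2 : SeparableClosure K) ≠ 0 := by
  rw [← map_ofNat (algebraMap R (SeparableClosure K)) 2]
  rwa [Ne, map_eq_zero_iff _ (algebraMap_separableClosure_injective R K)]

theorem galois_apply_of_quadRoot_eq (h2 : (2 : R) ≠ 0) {σ : AbsGal K}
    (h : σ (quadRoot K w n) = quadRoot K w n) (s : QuadraticAlgebra R (-n) w) :
    σ (algebraMap _ _ s) = algebraMap _ _ s := by
  apply mul_left_cancel₀ (two_ne_zero_separableClosure (R := R) (K := K) h2)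
  have h1 := congrArg σ (two_mul_algebraMap_quadraticAlgebra (K := K) s)
  rw [map_mul, map_add, map_mul, h, galois_algebraMap, galois_algebraMap, map_ofNat] at h1
  rw [h1, two_mul_algebraMap_quadraticAlgebra]

theorem galois_apply_of_quadRoot_eq_neg (h2 : (2 : R) ≠ 0) {σ : AbsGal K}
    (h : σ (quadRoot K w n) = -quadRoot K w n) (s : QuadraticAlgebra R (-n) w) :
    σ (algebraMap _ _ s) = algebraMap _ _ (star s) := by
  apply mul_left_cancel₀ (two_ne_zero_separableClosure (R := R) (K := K) h2)
  have h1 := congrArg σ (two_mul_algebraMap_quadraticAlgebra (K := K) s)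
  rw [map_mul, map_add, map_mul, h, galois_algebraMap, galois_algebraMap, map_ofNat] at h1
  rw [h1, two_mul_algebraMap_quadraticAlgebra]
  simp only [QuadraticAlgebra.re_star, QuadraticAlgebra.im_star, map_add, map_mul, map_neg, map_ofNat]
  ring

theorem galois_conj_root_sq (h2 : (2 : R) ≠ 0) {τ : AbsGal K}
    (hτ : τ (quadRoot K w n) = -quadRoot K w n) {y : SeparableClosure K}
    {s : QuadraticAlgebra R (-n) w} (hy : y ^ 2 = algebraMap _ _ s) :
    τ y ^ 2 = algebraMap _ _ (star s) := by
  rw [← map_pow, hy, galois_apply_of_quadRoot_eq_neg h2 hτ]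

variable [IsDomain R] [IsQuadOrder w n]

variable (K w n) in
theorem algebraMap_quadraticAlgebra_injective :
    Function.Injective (algebraMap (QuadraticAlgebra R (-n) w) (SeparableClosure K)) := by
  rw [injective_iff_map_eq_zero]
  intro s hs
  rw [← norm_eq_zero_iff_of_isQuadOrder]
  apply algebraMap_separableClosure_injective R K
  rw [IsScalarTower.algebraMap_apply R (QuadraticAlgebra R (-n) w) (SeparableClosure K),
    QuadraticAlgebra.algebraMap_norm_eq_mul_star, map_mul, hs, zero_mul, map_zero]

theorem quadRoot_ne_zero (h2 : (2 : R) ≠ 0) : quadRoot K w n ≠ 0 := by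
  rw [quadRoot, Ne, map_eq_zero_iff _ (algebraMap_quadraticAlgebra_injective K w n)]
  intro h
  exact h2 (congrArg QuadraticAlgebra.im h)

variable (K w n) in
theorem exists_galois_quadRoot_eq_neg : ∃ τ : AbsGal K, τ (quadRoot K w n) = -quadRoot K w n := by
  by_contra! h
  obtain ⟨a, b, hb, hab⟩ := exists_mul_eq_of_fixed R
    fun σ => (galois_quadRoot (K := K) (w := w) (n := n) σ).resolve_right (h σ)
  refine hb (IsQuadOrder.nonsq (w := w) (n := n) a b ?_)
  apply algebraMap_separableClosure_injective R K
  rw [map_pow, ← hab, mul_pow, quadRoot_sq, map_mul, map_pow]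

/-- The elements that are fixed by the stabilizer of the root are quotients of elements of the
order. -/
theorem exists_mul_eq_of_fixed_quadRoot (h2 : (2 : R) ≠ 0) {x : SeparableClosure K}
    (h : ∀ σ : AbsGal K, σ (quadRoot K w n) = quadRoot K w n → σ x = x) :
    ∃ a b : QuadraticAlgebra R (-n) w, b ≠ 0 ∧
      algebraMap _ (SeparableClosure K) b * x = algebraMap _ _ a := by
  obtain ⟨τ, hτ⟩ := exists_galois_quadRoot_eq_neg K w n
  have hτ' : τ⁻¹ (quadRoot K w n) = -quadRoot K w n := by
    rw [AlgEquiv.aut_inv, AlgEquiv.symm_apply_eq, map_neg, hτ, neg_neg]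
  have hneg : ∀ σ : AbsGal K, σ (quadRoot K w n) = -quadRoot K w n →
      σ x = τ x ∧ σ (τ x) = x := by
    intro σ hσ
    constructor
    · have h1 := h (τ⁻¹ * σ) (by rw [AlgEquiv.mul_apply, hσ, map_neg, hτ', neg_neg])
      rwa [AlgEquiv.mul_apply, AlgEquiv.aut_inv, AlgEquiv.symm_apply_eq] at h1
    · exact h (σ * τ) (by rw [AlgEquiv.mul_apply, hτ, map_neg, hσ, neg_neg])
  have hpos : ∀ σ : AbsGal K, σ (quadRoot K w n) = quadRoot K w n → σ (τ x) = τ x := by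
    intro σ hσ
    have h1 := h (τ⁻¹ * (σ * τ)) (by
      rw [AlgEquiv.mul_apply, AlgEquiv.mul_apply, hτ, map_neg, hσ, map_neg, hτ', neg_neg])
    rwa [AlgEquiv.mul_apply, AlgEquiv.aut_inv, AlgEquiv.symm_apply_eq] at h1
  obtain ⟨a, b, hb, hab⟩ := exists_mul_eq_of_fixed R (x := x + τ x) fun σ => by
    rcases galois_quadRoot (K := K) (w := w) (n := n) σ with hσ | hσ
    · rw [map_add, h σ hσ, hpos σ hσ]
    · rw [map_add, (hneg σ hσ).1, (hneg σ hσ).2, add_comm]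
  obtain ⟨c, d, hd, hcd⟩ := exists_mul_eq_of_fixed R (x := (x - τ x) * quadRoot K w n) fun σ => by
    rcases galois_quadRoot (K := K) (w := w) (n := n) σ with hσ | hσ
    · rw [map_mul, map_sub, h σ hσ, hpos σ hσ, hσ]
    · rw [map_mul, map_sub, (hneg σ hσ).1, (hneg σ hσ).2, hσ]
      ring
  have hinj := algebraMap_quadraticAlgebra_injective K w n
  have hR := algebraMap_separableClosure_injective R K
  let f := algebraMap R (QuadraticAlgebra R (-n) w)
  have hf : ∀ r : R, algebraMap _ (SeparableClosure K) (f r) = algebraMap R _ r := fun r =>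
    (IsScalarTower.algebraMap_apply R (QuadraticAlgebra R (-n) w) (SeparableClosure K) r).symm
  -- With √ for the root ⟨-w, 2⟩, the relations b(x + τx) = a and d(x − τx)√ = c combine to 2bd√ · x
  -- = ad√ + bc.
  refine ⟨f (a * d) * ⟨-w, 2⟩ + f (b * c), f (2 * (b * d)) * ⟨-w, 2⟩, ?_, ?_⟩
  · rw [Ne, ← map_eq_zero_iff _ hinj, map_mul, hf]
    refine mul_ne_zero ?_ (quadRoot_ne_zero h2)
    rw [Ne, map_eq_zero_iff _ hR]
    exact mul_ne_zero h2 (mul_ne_zero hb hd)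
  · have hq : algebraMap _ (SeparableClosure K) (⟨-w, 2⟩ : QuadraticAlgebra R (-n) w) =
      quadRoot K w n := rfl
    simp only [map_add, map_mul, hf, hq, map_ofNat]
    rw [← hab, ← hcd]
    ring

theorem exists_rep_inert (h2 : (2 : R) ≠ 0) {y z : SeparableClosure K} (hy0 : y ≠ 0) (hz0 : z ≠ 0)
    {s : QuadraticAlgebra R (-n) w} (hy : y ^ 2 = algebraMap _ _ s)
    (hz : z ^ 2 = algebraMap _ _ (star s)) :
    ∃ ρ : GalRep K D4, tag (quadRoot K w n) ∈ ρ.etaleAlgebra ∧ pt y z ∈ ρ.etaleAlgebra := by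
  have h2' : (2 : K) ≠ 0 := fun h => two_ne_zero_separableClosure (R := R) (K := K) h2 (by
    rw [← map_ofNat (algebraMap K (SeparableClosure K)) 2, h, map_zero])
  refine exists_rep h2' (quadRoot_ne_zero h2) hy0 hz0 fun σ => ?_
  rcases galois_quadRoot (K := K) (w := w) (n := n) σ with hσ | hσ
  · refine Or.inl ⟨hσ, galois_eq_or_eq_neg_of_sq ?_, galois_eq_or_eq_neg_of_sq ?_⟩
    · rw [hy, galois_apply_of_quadRoot_eq h2 hσ]
    · rw [hz, galois_apply_of_quadRoot_eq h2 hσ]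
  · refine Or.inr ⟨hσ, galois_eq_or_eq_neg_of_sq ?_, galois_eq_or_eq_neg_of_sq ?_⟩
    · rw [hy, hz, galois_apply_of_quadRoot_eq_neg h2 hσ]
    · rw [hy, hz, galois_apply_of_quadRoot_eq_neg h2 hσ, star_star]

theorem notMem_blockSubgroup_of_quadRoot (h2 : (2 : R) ≠ 0) {ρ : GalRep K D4} {τ : AbsGal K}
    (hρ : tag (quadRoot K w n) ∈ ρ.etaleAlgebra)
    (hτ : τ (quadRoot K w n) = -quadRoot K w n) : τ ∉ blockSubgroup ρ := by
  intro h
  have h1 := (tag_mem_iff.1 hρ τ).1 h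
  rw [hτ] at h1
  refine mul_ne_zero (two_ne_zero_separableClosure (R := R) (K := K) h2)
    (quadRoot_ne_zero (K := K) (w := w) (n := n) h2) ?_
  linear_combination -h1

theorem mem_blockSubgroup_of_quadRoot (h2 : (2 : R) ≠ 0) {ρ : GalRep K D4} {σ : AbsGal K}
    (hρ : tag (quadRoot K w n) ∈ ρ.etaleAlgebra)
    (hσ : σ (quadRoot K w n) = quadRoot K w n) : σ ∈ blockSubgroup ρ := by
  refine mem_blockSubgroup_of_fixed (fun h => ?_) (quadRoot_ne_zero h2) hρ hσ
  refine two_ne_zero_separableClosure (R := R) (K := K) h2 ?_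
  rw [← map_ofNat (algebraMap K (SeparableClosure K)) 2, h, map_zero]

/-- The sum of the two functions is 2y on the letter 0 and vanishes on 1 and 3, but τ carries the
letter 0 to one of these. So the two signs of z belong to different representations. -/
theorem not_pt_mem_neg (h2 : (2 : R) ≠ 0) {ρ : GalRep K D4} {τ : AbsGal K}
    (hρ : tag (quadRoot K w n) ∈ ρ.etaleAlgebra)
    (hτ : τ (quadRoot K w n) = -quadRoot K w n) {y z : SeparableClosure K} (hy : y ≠ 0)
    (h : pt y z ∈ ρ.etaleAlgebra) : pt y (-z) ∉ ρ.etaleAlgebra := by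
  intro h'
  have h0 : τ (y + y) = pt y z _ + pt y (-z) _ := (add_mem h h') τ 0
  have h3 : τ (y + y) = 0 := by
    rw [h0]
    rcases (odd_of_notMem (notMem_blockSubgroup_of_quadRoot h2 hρ hτ)).1 with h1 | h1 <;>
      rw [h1] <;> simp [pt]
  rw [map_eq_zero_iff _ τ.injective, ← two_mul] at h3
  exact mul_ne_zero (two_ne_zero_separableClosure (R := R) (K := K) h2) hy h3

/-- This is the embedding of F into L: an element of F on one block and its conjugate on the other.
-/
theorem conj_mem_etaleAlgebra (h2 : (2 : R) ≠ 0) {ρ : GalRep K D4}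
    (hρ : tag (quadRoot K w n) ∈ ρ.etaleAlgebra) (s : QuadraticAlgebra R (-n) w) :
    ![algebraMap _ (SeparableClosure K) s, algebraMap _ _ (star s), algebraMap _ _ s,
      algebraMap _ _ (star s)] ∈ ρ.etaleAlgebra := by
  intro σ i
  have h3 := D4_apply_two (ρ.1 σ)
  have h4 := D4_apply_three (ρ.1 σ)
  rcases galois_quadRoot (K := K) (w := w) (n := n) σ with hσ | hσ
  · have h7 := galois_apply_of_quadRoot_eq h2 hσ
    obtain ⟨h5, h6⟩ := even_of_mem (mem_blockSubgroup_of_quadRoot h2 hρ hσ)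
    fin_cases i
    · rcases h5 with h5 | h5 <;> simp [h5, h7]
    · rcases h6 with h6 | h6 <;> simp [h6, h7]
    · rcases h5 with h5 | h5 <;> simp [h3, h5, h7]
    · rcases h6 with h6 | h6 <;> simp [h4, h6, h7]
  · have h7 := galois_apply_of_quadRoot_eq_neg h2 hσ
    obtain ⟨h5, h6⟩ := odd_of_notMem (notMem_blockSubgroup_of_quadRoot h2 hρ hσ)
    fin_cases i
    · rcases h5 with h5 | h5 <;> simp [h5, h7]
    · rcases h6 with h6 | h6 <;> simp [h6, h7]
    · rcases h5 with h5 | h5 <;> simp [h3, h5, h7]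
    · rcases h6 with h6 | h6 <;> simp [h4, h6, h7]

variable [IsDiscreteValuationRing R] [QuadHenselian R]

/-- The square of y lies in F, so an element of F carries y to some η β, and its conjugate rescales
z accordingly. An element τ that exchanges the blocks forces z = ±τ y. -/
theorem exists_pt_mem_inert (h2 : (2 : R) ≠ 0) {τ : AbsGal K}
    (hτ : τ (quadRoot K w n) = -quadRoot K w n)
    {η : DiscClass (QuadraticAlgebra R (-n) w) → SeparableClosure K}
    (hη : ∀ β, η β ^ 2 = algebraMap _ _ β.rep) {ρ : GalRep K D4}
    (hρ : tag (quadRoot K w n) ∈ ρ.etaleAlgebra) :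
    ∃ β, pt (η β) (τ (η β)) ∈ ρ.etaleAlgebra ∨ pt (η β) (-τ (η β)) ∈ ρ.etaleAlgebra := by
  have hinj := algebraMap_quadraticAlgebra_injective K w n
  have hS : (2 : QuadraticAlgebra R (-n) w) ≠ 0 := fun h => h2 (by
    apply QuadraticAlgebra.algebraMap_injective (a := -n) (b := w)
    rw [map_zero, map_ofNat, h])
  obtain ⟨y, z, hy, hz, hyz⟩ := exists_pt_mem ρ
  obtain ⟨a, b, hb, hab⟩ := exists_mul_eq_of_fixed_quadRoot (R := R) (w := w) (n := n) h2
    (x := y ^ 2) fun σ hσ => by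
      rcases (apply_of_pt_mem hyz (mem_blockSubgroup_of_quadRoot h2 hρ hσ)).1 with h | h <;>
        rw [map_pow, h]
      rw [neg_sq]
  obtain ⟨β, s, t, hs, ht, hst⟩ := DiscClass.exists_mul_eq_mul hinj hS hη hy hb hab
  have hst' : algebraMap _ (SeparableClosure K) (star s) * τ y =
      algebraMap _ (SeparableClosure K) (star t) * τ (η β) := by
    rw [← galois_apply_of_quadRoot_eq_neg h2 hτ, ← galois_apply_of_quadRoot_eq_neg h2 hτ,
      ← map_mul, hst, map_mul]
  have hne : ∀ s : QuadraticAlgebra R (-n) w, s ≠ 0 → algebraMap _ (SeparableClosure K) s ≠ 0 :=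
    fun s hs => by rwa [Ne, map_eq_zero_iff _ hinj]
  have hmem := conj_mem_etaleAlgebra (K := K) h2 hρ
  have hst0 : star t ≠ 0 := fun h => ht (by rw [← star_star t, h, star_zero])
  have hnz : ∀ i, ![algebraMap _ (SeparableClosure K) t,
      algebraMap _ _ (star t), algebraMap _ _ t, algebraMap _ _ (star t)] i ≠ 0 := by
    intro i
    fin_cases i <;> simp [hne _ ht, hne _ hst0]
  refine ⟨β, ?_⟩
  rcases apply_of_pt_mem_of_notMem τ (notMem_blockSubgroup_of_quadRoot h2 hρ hτ) hyz with h | h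
  · refine Or.inl (mem_etaleAlgebra_of_mul_mem (hmem t) hnz ?_)
    convert mul_mem (hmem s) hyz using 1
    ext i
    fin_cases i <;> simp [pt, ← h, hst, hst']
  · refine Or.inr (mem_etaleAlgebra_of_mul_mem (hmem t) hnz ?_)
    have h' : z = -τ y := by rw [h, neg_neg]
    convert mul_mem (hmem s) hyz using 1
    ext i
    fin_cases i <;> simp [pt, h', hst, hst']

theorem eq_of_pt_mem_inert (h2 : (2 : R) ≠ 0)
    {ρ : GalRep K D4} (hρ : tag (quadRoot K w n) ∈ ρ.etaleAlgebra) {y y' z z' : SeparableClosure K}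
    {β β' : DiscClass (QuadraticAlgebra R (-n) w)} (hy : y ^ 2 = algebraMap _ _ β.rep)
    (hy' : y' ^ 2 = algebraMap _ _ β'.rep) (h : pt y z ∈ ρ.etaleAlgebra)
    (h' : pt y' z' ∈ ρ.etaleAlgebra) : β = β' := by
  obtain ⟨a, b, hb, hab⟩ := exists_mul_eq_of_fixed_quadRoot (R := R) (w := w) (n := n) h2
    (x := y * y') fun σ hσ =>
      (mul_fixed_of_pt_mem h h' (mem_blockSubgroup_of_quadRoot h2 hρ hσ)).1
  exact DiscClass.eq_of_mul_mem (algebraMap_quadraticAlgebra_injective K w n) hy hy' hb hab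

end Inert

end LocalMass

/-! ### Integral bases and discriminants of the quartic algebras. -/

namespace LocalMass

open IsLocalRing

theorem det_split {A : Type*} [CommRing A] (a b c d : A) :
    (!![1, 0, 1, 0; a, 0, b, 0; 0, 1, 0, 1; 0, c, 0, d] : Matrix (Fin 4) (Fin 4) A).det =
      -((a - b) * (c - d)) := by
  rw [Matrix.det_succ_row_zero, Fin.sum_univ_four]
  simp [Matrix.det_fin_three, Fin.succAbove]
  ring

/-- The square of this determinant is the tower formula for discriminants: (a − a')⁴ is the square
of the discriminant of F, and the rest is the norm of the relative discriminant. -/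
theorem det_inert {A : Type*} [CommRing A] (a a' t0 t1 t2 t3 : A) :
    (!![1, 1, 1, 1; a, a', a, a'; t0, t1, t2, t3; a * t0, a' * t1, a * t2, a' * t3] :
      Matrix (Fin 4) (Fin 4) A).det = (a - a') ^ 2 * ((t0 - t2) * (t1 - t3)) := by
  rw [Matrix.det_succ_row_zero, Fin.sum_univ_four]
  simp [Matrix.det_fin_three, Fin.succAbove]
  ring

/-- The roots of a monic quadratic polynomial are integral. -/
theorem isIntegral_add_root_div_two {S Ω : Type*} [CommRing S] [Field Ω] [Algebra S Ω]
    (h2 : (2 : Ω) ≠ 0) {w n : S} {y : Ω} (hy : y ^ 2 = algebraMap S Ω (w ^ 2 - 4 * n)) :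
    IsIntegral S ((algebraMap S Ω w + y) / 2) := by
  open Polynomial in
  refine ⟨X ^ 2 - C w * X + C n, by nontriviality S; monicity!, ?_⟩
  simp only [Polynomial.eval₂_add, Polynomial.eval₂_sub, Polynomial.eval₂_mul, Polynomial.eval₂_pow,
    Polynomial.eval₂_X, Polynomial.eval₂_C]
  rw [map_sub, map_mul, map_pow, map_ofNat] at hy
  field_simp
  linear_combination hy

theorem half_add_mem {K : Type*} [Field K] {ρ : GalRep K D4} {p q : Fin 4 → SeparableClosure K}
    (hp : p ∈ ρ.etaleAlgebra) (hq : q ∈ ρ.etaleAlgebra) :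
    (fun j => (p j + q j) / 2) ∈ ρ.etaleAlgebra := fun σ i => by
  rw [map_div₀, map_add, hp σ i, hq σ i, map_ofNat]

theorem algebraMap_const_mem {R K : Type*} [CommRing R] [Field K] [Algebra R K]
    {ρ : GalRep K D4} (a : R) :
    (fun _ => algebraMap R (SeparableClosure K) a) ∈ ρ.etaleAlgebra :=
  fun σ _ => galois_algebraMap σ a

section Split

variable {R K : Type*} [CommRing R] [IsDomain R] [IsDiscreteValuationRing R] [QuadHenselian R]
  [Field K] [Algebra R K] [IsFractionRing R K] {ρ : GalRep K D4}

/-- An element that preserves the blocks either fixes x j, x (j + 2) and p j, or exchanges the first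
two and negates p j. The sum of the first two and their difference times p j are thus fixed, which
is the input of `IsFundDisc.exists_coords`. The ring S is R in the split case and the quadratic
order otherwise. -/
theorem exists_coords_of_mem_blockSubgroup {S : Type*} [CommRing S] [IsDomain S]
    [IsDiscreteValuationRing S] [QuadHenselian S] [Algebra S (SeparableClosure K)]
    (hinj : Function.Injective (algebraMap S (SeparableClosure K)))
    (hfix : ∀ x : SeparableClosure K, (∀ σ ∈ blockSubgroup ρ, σ x = x) →
      ∃ a b : S, b ≠ 0 ∧ algebraMap _ (SeparableClosure K) b * x = algebraMap _ _ a)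
    {p x : Fin 4 → SeparableClosure K} (hp : p ∈ ρ.etaleAlgebra)
    (hx : x ∈ ρ.etaleAlgebra) {j : Fin 4} (hpj : p (j + 2) = -p j)
    (hj : ∀ σ ∈ blockSubgroup ρ, (ρ.1 σ : Equiv.Perm (Fin 4)) j = j ∨
      (ρ.1 σ : Equiv.Perm (Fin 4)) j = j + 2)
    {w n : S} (hγ : IsFundDisc (w ^ 2 - 4 * n)) (hy : p j ^ 2 = algebraMap _ _ (w ^ 2 - 4 * n))
    (hi : IsIntegral S (x j)) (hi' : IsIntegral S (x (j + 2))) :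
    ∃ m r : S, x j = algebraMap S _ m + algebraMap S _ r * ((algebraMap S _ w + p j) / 2) ∧
      x (j + 2) = algebraMap S _ m + algebraMap S _ r * ((algebraMap S _ w - p j) / 2) := by
  have h22 : j + 2 + 2 = j := by rw [add_assoc]; exact add_zero j
  have h0 : w ^ 2 - 4 * n ≠ 0 := hγ.ne_zero (IsDiscreteValuationRing.not_isField S)
  have hx2 : ∀ σ ∈ blockSubgroup ρ, (σ (x j) = x j ∧ σ (x (j + 2)) = x (j + 2) ∧ σ (p j) = p j) ∨
      (σ (x j) = x (j + 2) ∧ σ (x (j + 2)) = x j ∧ σ (p j) = -p j) := by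
    intro σ hσ
    rw [hx σ j, hx σ (j + 2), hp σ j, D4_apply_add_two]
    rcases hj σ hσ with h | h <;> rw [h]
    · exact Or.inl ⟨rfl, rfl, rfl⟩
    · exact Or.inr ⟨rfl, by rw [h22], hpj⟩
  obtain ⟨a, b, hb, hab⟩ := hfix (x j + x (j + 2)) fun σ hσ => by
    rcases hx2 σ hσ with ⟨h1, h2, -⟩ | ⟨h1, h2, -⟩ <;> rw [map_add, h1, h2]
    rw [add_comm]
  obtain ⟨c, d, hd, hcd⟩ := hfix ((x j - x (j + 2)) * p j) fun σ hσ => by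
    rcases hx2 σ hσ with ⟨h1, h2, h3⟩ | ⟨h1, h2, h3⟩ <;> rw [map_mul, map_sub, h1, h2, h3]
    ring
  refine hγ.exists_coords hinj hy hi hi' hb (mul_ne_zero hd h0) hab (c := c) ?_
  rw [map_mul, ← hy, ← hcd]
  ring

/-- The discriminant of the étale algebra when all elements of the Galois group preserve the
blocks. -/
theorem span_discr_split (hblk : ∀ σ, σ ∈ blockSubgroup ρ) {β β' : DiscClass R}
    {y z : SeparableClosure K} (hy : y ^ 2 = algebraMap R _ β.rep)
    (hz : z ^ 2 = algebraMap R _ β'.rep) (hyz : pt y z ∈ ρ.etaleAlgebra) :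
    Ideal.span {a : R | ∃ b : Fin 4 → ρ.etaleAlgebra, (∀ i, IsIntegral R (b i)) ∧
      algebraMap R K a = Algebra.discr K b} = Ideal.span {β.rep * β'.rep} := by
  have hinj := algebraMap_separableClosure_injective R K
  have h2 : (2 : SeparableClosure K) ≠ 0 :=
    two_ne_zero_separableClosure (R := R) two_ne_zero_of_quadHenselian
  have hyz2 : (y * z) ^ 2 = algebraMap R _ (β.rep * β'.rep) := by rw [mul_pow, hy, hz, map_mul]
  have hfund := β.rep_fund
  have hfund' := β'.rep_fund
  have hne := mul_ne_zero β.rep_ne_zero β'.rep_ne_zero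
  obtain ⟨w, n, hwn⟩ := β.rep_fund.1
  obtain ⟨w', n', hwn'⟩ := β'.rep_fund.1
  rw [hwn] at hy hfund
  rw [hwn'] at hz hfund'
  have he : ![1, 0, 1, 0] ∈ ρ.etaleAlgebra := by
    intro σ j
    have h3 := D4_apply_two (ρ.1 σ)
    have h4 := D4_apply_three (ρ.1 σ)
    obtain ⟨h5, h6⟩ := even_of_mem (hblk σ)
    fin_cases j
    · rcases h5 with h5 | h5 <;> simp [h5]
    · rcases h6 with h6 | h6 <;> simp [h6]
    · rcases h5 with h5 | h5 <;> simp [h3, h5]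
    · rcases h6 with h6 | h6 <;> simp [h4, h6]
  let e : ρ.etaleAlgebra := ⟨_, he⟩
  let θ : R → ρ.etaleAlgebra := fun w => ⟨_, half_add_mem (algebraMap_const_mem w) hyz⟩
  have hei : IsIntegral R e := by
    rw [isIntegral_subalgebra_pi_iff]
    intro j
    fin_cases j
    exacts [isIntegral_one, isIntegral_zero, isIntegral_one, isIntegral_zero]
  have hneg : ∀ {x : SeparableClosure K} {w n : R}, x ^ 2 = algebraMap R _ (w ^ 2 - 4 * n) →
      IsIntegral R ((algebraMap R (SeparableClosure K) w + -x) / 2) := fun {x w n} h =>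
    isIntegral_add_root_div_two h2 (by rwa [neg_sq])
  have h1i : IsIntegral R (e * θ w) := by
    rw [isIntegral_subalgebra_pi_iff]
    intro j
    fin_cases j
    · exact isIntegral_one.mul (isIntegral_add_root_div_two h2 hy)
    · change IsIntegral R ((0 : SeparableClosure K) * _)
      rw [zero_mul]; exact isIntegral_zero
    · exact isIntegral_one.mul (hneg hy)
    · change IsIntegral R ((0 : SeparableClosure K) * _)
      rw [zero_mul]; exact isIntegral_zero
  have h2i : IsIntegral R ((1 - e) * θ w') := by
    rw [isIntegral_subalgebra_pi_iff]
    have e0 : (1 - 1 : SeparableClosure K) = 0 := sub_self _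
    intro j
    fin_cases j
    · change IsIntegral R ((1 - 1 : SeparableClosure K) * _)
      rw [e0, zero_mul]; exact isIntegral_zero
    · exact (isIntegral_one.sub isIntegral_zero).mul (isIntegral_add_root_div_two h2 hz)
    · change IsIntegral R ((1 - 1 : SeparableClosure K) * _)
      rw [e0, zero_mul]; exact isIntegral_zero
    · exact (isIntegral_one.sub isIntegral_zero).mul (hneg hz)
  -- The idempotent e of the block {0, 2} splits the algebra into two quadratic ones, each with
  -- basis 1 and (w + root)/2. The determinant is −yz.
  refine span_discr_eq_span_singleton ![e, e * θ w, 1 - e, (1 - e) * θ w'] (fun i => ?_)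
    (fun x hx => ?_) hne ?_
  · fin_cases i
    exacts [hei, h1i, isIntegral_one.sub hei, h2i]
  · rw [isIntegral_subalgebra_pi_iff] at hx
    have hfix : ∀ x : SeparableClosure K, (∀ σ ∈ blockSubgroup ρ, σ x = x) →
      ∃ a b : R, b ≠ 0 ∧ algebraMap _ (SeparableClosure K) b * x = algebraMap _ _ a :=
      fun x h => exists_mul_eq_of_fixed R fun σ => h σ (hblk σ)
    obtain ⟨m, r, h0, h1⟩ := exists_coords_of_mem_blockSubgroup hinj hfix hyz x.2 (j := 0)
      (pt_add_two _ _ _) (fun σ hσ => (even_of_mem hσ).1) hfund hy (hx _) (hx _)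
    obtain ⟨m', r', h0', h1'⟩ := exists_coords_of_mem_blockSubgroup hinj hfix hyz x.2 (j := 1)
      (pt_add_two _ _ _) (fun σ hσ => (even_of_mem hσ).2) hfund' hz (hx _) (hx _)
    refine ⟨![m, r, m', r'], fun j => ?_⟩
    rw [Fin.sum_univ_four]
    change _ = algebraMap R _ m * (![1, 0, 1, 0] : Fin 4 → SeparableClosure K) j +
      algebraMap R _ r * ((![1, 0, 1, 0] : Fin 4 → SeparableClosure K) j *
        ((algebraMap R _ w + pt y z j) / 2)) +
      algebraMap R _ m' * (1 - (![1, 0, 1, 0] : Fin 4 → SeparableClosure K) j) +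
      algebraMap R _ r' * ((1 - (![1, 0, 1, 0] : Fin 4 → SeparableClosure K) j) *
        ((algebraMap R _ w' + pt y z j) / 2))
    fin_cases j
    · refine h0.trans ?_; simp
    · refine h0'.trans ?_; simp
    · refine h1.trans ?_; simp [pt, sub_eq_add_neg]
    · refine h1'.trans ?_; simp [pt, sub_eq_add_neg]
  · rw [← hyz2]
    have hM : (Matrix.of fun i j => ((![e, e * θ w, 1 - e, (1 - e) * θ w'] i : ρ.etaleAlgebra) :
        Fin 4 → SeparableClosure K) j) =
        !![1, 0, 1, 0; (algebraMap R _ w + y) / 2, 0, (algebraMap R _ w + -y) / 2, 0;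
          0, 1, 0, 1; 0, (algebraMap R _ w' + z) / 2, 0, (algebraMap R _ w' + -z) / 2] := by
      refine Matrix.ext fun i j => ?_
      fin_cases i
      · rfl
      · change (![1, 0, 1, 0] : Fin 4 → SeparableClosure K) j *
          ((algebraMap R _ w + pt y z j) / 2) = _
        fin_cases j <;> simp [pt]
      · change 1 - (![1, 0, 1, 0] : Fin 4 → SeparableClosure K) j = _
        fin_cases j <;> simp
      · change (1 - (![1, 0, 1, 0] : Fin 4 → SeparableClosure K) j) *
          ((algebraMap R _ w' + pt y z j) / 2) = _
        fin_cases j <;> simp [pt]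
    rw [hM, det_split]
    field_simp
    ring

end Split

section Inert

/-- Since τ carries {0, 2} to {1, 3}, identities in the algebra need to be checked on the letters 0
and 2 only. -/
theorem eq_zero_of_vanish {K : Type*} [Field K] {ρ : GalRep K D4} {f : Fin 4 → SeparableClosure K}
    (hf : f ∈ ρ.etaleAlgebra) (h0 : f 0 = 0) (h2 : f 2 = 0) {τ : AbsGal K}
    (hτ : τ ∉ blockSubgroup ρ) : f = 0 := by
  have e0 := hf τ 0
  have e2 := hf τ 2
  rw [D4_apply_two, h2, map_zero] at e2
  rw [h0, map_zero] at e0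
  ext1 j
  rcases (odd_of_notMem hτ).1 with h | h <;> rw [h] at e0 e2 <;> fin_cases j
  exacts [h0, e0.symm, h2, e2.symm, h0, e2.symm, h2, e0.symm]

variable {R K : Type*} [CommRing R] [IsDomain R] [IsDiscreteValuationRing R] [QuadHenselian R]
  [IsAdicComplete (maximalIdeal R) R] [Field K] [Algebra R K] [IsFractionRing R K] {w n : R}
  [Algebra (QuadraticAlgebra R (-n) w) (SeparableClosure K)]
  [IsScalarTower R (QuadraticAlgebra R (-n) w) (SeparableClosure K)] [IsQuadOrder w n]
  {ρ : GalRep K D4}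

/-- The discriminant of the étale algebra when some elements of the Galois group exchange the
blocks. -/
theorem span_discr_inert (hρ : tag (quadRoot K w n) ∈ ρ.etaleAlgebra)
    {β : DiscClass (QuadraticAlgebra R (-n) w)}
    {y z : SeparableClosure K} (hy : y ^ 2 = algebraMap _ _ β.rep)
    (hz : z ^ 2 = algebraMap _ _ (star β.rep)) (hyz : pt y z ∈ ρ.etaleAlgebra) :
    Ideal.span {a : R | ∃ b : Fin 4 → ρ.etaleAlgebra, (∀ i, IsIntegral R (b i)) ∧
      algebraMap R K a = Algebra.discr K b} =
      Ideal.span {(w ^ 2 - 4 * n) ^ 2 * QuadraticAlgebra.norm β.rep} := by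
  have h2R : (2 : R) ≠ 0 := two_ne_zero_of_quadHenselian
  have hinj := algebraMap_quadraticAlgebra_injective K w n
  have h2 : (2 : SeparableClosure K) ≠ 0 := two_ne_zero_separableClosure (R := R) h2R
  obtain ⟨τ, hτ⟩ := exists_galois_quadRoot_eq_neg K w n
  have hτρ := notMem_blockSubgroup_of_quadRoot h2R hρ hτ
  have hsq : (quadRoot K w n ^ 2 * (y * z)) ^ 2 =
      algebraMap R _ ((w ^ 2 - 4 * n) ^ 2 * QuadraticAlgebra.norm β.rep) := by
    rw [mul_pow, mul_pow, hy, hz, quadRoot_sq, ← map_mul, ← QuadraticAlgebra.algebraMap_norm_eq_mul_star,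
      ← IsScalarTower.algebraMap_apply R (QuadraticAlgebra R (-n) w) (SeparableClosure K), map_mul,
      map_pow (algebraMap R (SeparableClosure K))]
  have hne : (w ^ 2 - 4 * n) ^ 2 * QuadraticAlgebra.norm β.rep ≠ 0 :=
    mul_ne_zero (pow_ne_zero 2 ((IsQuadOrder.fund (w := w) (n := n)).ne_zero
      (IsDiscreteValuationRing.not_isField R)))
      fun h => β.rep_ne_zero (norm_eq_zero_iff_of_isQuadOrder.1 h)
  have hfund := β.rep_fund
  obtain ⟨w', n', hwn'⟩ := β.rep_fund.1
  rw [hwn'] at hy hfund hz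
  rw [star_sub, star_mul', star_pow, star_ofNat] at hz
  let ω : QuadraticAlgebra R (-n) w := ⟨0, 1⟩
  let ψ : QuadraticAlgebra R (-n) w → ρ.etaleAlgebra := fun s => ⟨_, conj_mem_etaleAlgebra h2R hρ s⟩
  let θ : ρ.etaleAlgebra := ⟨_, half_add_mem (ψ w').2 hyz⟩
  have hSR : ∀ {x : SeparableClosure K}, IsIntegral (QuadraticAlgebra R (-n) w) x →
    IsIntegral R x := fun {x} hx => isIntegral_trans x hx
  have hψi : ∀ s, IsIntegral R (ψ s) := by
    intro s
    rw [isIntegral_subalgebra_pi_iff]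
    intro j
    fin_cases j <;> exact hSR isIntegral_algebraMap
  have hθi : IsIntegral R θ := by
    rw [isIntegral_subalgebra_pi_iff]
    intro j
    fin_cases j
    · exact hSR (isIntegral_add_root_div_two h2 hy)
    · exact hSR (isIntegral_add_root_div_two h2 hz)
    · exact hSR (isIntegral_add_root_div_two h2 ((neg_sq y).trans hy))
    · exact hSR (isIntegral_add_root_div_two h2 ((neg_sq z).trans hz))
  have hcoord : ∀ s : QuadraticAlgebra R (-n) w, algebraMap _ (SeparableClosure K) s =
      algebraMap R _ s.re + algebraMap R _ s.im * algebraMap _ _ ω := by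
    intro s
    rw [IsScalarTower.algebraMap_apply R (QuadraticAlgebra R (-n) w) (SeparableClosure K),
      IsScalarTower.algebraMap_apply R (QuadraticAlgebra R (-n) w) (SeparableClosure K),
      ← map_mul, ← map_add]
    congr 1
    ext <;> simp [ω]
  have hψ : ∀ s j, (ψ s).1 j = algebraMap R _ s.re + algebraMap R _ s.im * (ψ ω).1 j := by
    intro s j
    have h1 : ((ψ s).1 - (fun j => algebraMap R (SeparableClosure K) s.re +
        algebraMap R (SeparableClosure K) s.im * (ψ ω).1 j)) = 0 := by
      refine eq_zero_of_vanish (sub_mem (ψ s).2 (add_mem (algebraMap_const_mem s.re)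
        (mul_mem (algebraMap_const_mem s.im) (ψ ω).2))) ?_ ?_ hτρ
      · exact sub_eq_zero.2 (hcoord s)
      · exact sub_eq_zero.2 (hcoord s)
    exact sub_eq_zero.1 (congrFun h1 j)
  -- The basis is the product of the basis 1, ω of the integers of F over R and the basis 1, θ of
  -- the integers of L over those of F.
  refine span_discr_eq_span_singleton ![1, ψ ω, θ, ψ ω * θ] (fun i => ?_)
    (fun x hx => ?_) hne ?_
  · fin_cases i
    exacts [isIntegral_one, hψi _, hθi, (hψi _).mul hθi]
  · rw [isIntegral_subalgebra_pi_iff] at hx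
    have hfix : ∀ x : SeparableClosure K, (∀ σ ∈ blockSubgroup ρ, σ x = x) →
      ∃ a b : QuadraticAlgebra R (-n) w, b ≠ 0 ∧
        algebraMap _ (SeparableClosure K) b * x = algebraMap _ _ a :=
      fun x h => exists_mul_eq_of_fixed_quadRoot h2R fun σ hσ =>
        h σ (mem_blockSubgroup_of_quadRoot h2R hρ hσ)
    obtain ⟨m, r, h0, h1⟩ := exists_coords_of_mem_blockSubgroup hinj hfix hyz x.2 (j := 0)
      (pt_add_two _ _ _) (fun σ hσ => (even_of_mem hσ).1) hfund hy (hx _).tower_top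
      (hx _).tower_top
    have h3 : x.1 - (ψ m + ψ r * θ : ρ.etaleAlgebra).1 = 0 := by
      refine eq_zero_of_vanish (sub_mem x.2 (ψ m + ψ r * θ).2) ?_ ?_ hτρ
      · exact sub_eq_zero.2 h0
      · refine sub_eq_zero.2 (h1.trans ?_)
        rw [sub_eq_add_neg]
        rfl
    refine ⟨![m.re, m.im, r.re, r.im], fun j => ?_⟩
    have h4 := sub_eq_zero.1 (congrFun h3 j)
    rw [Fin.sum_univ_four]
    change x.1 j = algebraMap R _ m.re * 1 + algebraMap R _ m.im * (ψ ω).1 j +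
      algebraMap R _ r.re * θ.1 j + algebraMap R _ r.im * ((ψ ω).1 j * θ.1 j)
    change x.1 j = (ψ m).1 j + (ψ r).1 j * θ.1 j at h4
    rw [h4, hψ m, hψ r]
    ring
  · rw [← hsq]
    have hM : (Matrix.of fun i j => ((![1, ψ ω, θ, ψ ω * θ] i : ρ.etaleAlgebra) :
        Fin 4 → SeparableClosure K) j) =
        !![1, 1, 1, 1; algebraMap _ _ ω, algebraMap _ _ (star ω), algebraMap _ _ ω,
          algebraMap _ _ (star ω); θ.1 0, θ.1 1, θ.1 2, θ.1 3;
          algebraMap _ _ ω * θ.1 0, algebraMap _ _ (star ω) * θ.1 1, algebraMap _ _ ω * θ.1 2,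
          algebraMap _ _ (star ω) * θ.1 3] := by
      refine Matrix.ext fun i j => ?_
      fin_cases i <;> fin_cases j <;> rfl
    have h3 : algebraMap _ (SeparableClosure K) ω - algebraMap _ _ (star ω) =
        quadRoot K w n := by
      rw [← map_sub, quadRoot]
      congr 1
      ext
      · simp [ω]
      · simp [ω]; norm_num
    have h4 : θ.1 0 - θ.1 2 = y := by
      change (algebraMap _ _ w' + y) / 2 - (algebraMap _ _ w' + -y) / 2 = y
      field_simp
      ring
    have h5 : θ.1 1 - θ.1 3 = z := by
      change (algebraMap _ _ (star w') + z) / 2 - (algebraMap _ _ (star w') + -z) / 2 = z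
      field_simp
      ring
    rw [hM, det_inert, h3, h4, h5]

end Inert

end LocalMass

/-! ### Summation over the towers. -/

namespace LocalMass

open IsLocalRing

theorem isFundDisc_one {R : Type*} [CommRing R] : IsFundDisc (1 : R) := by
  refine ⟨by simpa using isDisc_sq (1 : R), fun r δ _ h => ?_⟩
  exact IsUnit.of_mul_eq_one (r * δ) (by rw [h]; ring)

/-- The class of 1 is that of K × K. Any other fundamental discriminant is not a square in K,
because its square class contains only one class. -/
theorem isQuadOrder_of_ne {R : Type*} [CommRing R] [IsDomain R]
    [IsDiscreteValuationRing R] {c : DiscClass R} (hc : c ≠ DiscClass.mk isFundDisc_one) {w n : R}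
    (h : c.rep = w ^ 2 - 4 * n) : IsQuadOrder w n where
  fund := h ▸ c.rep_fund
  nonsq a b hab := by
    by_contra hb
    rw [← h] at hab
    obtain ⟨u, -, hu⟩ := c.rep_fund.exists_unit isFundDisc_one hb (b := a) (by rw [← hab]; ring)
    exact hc ((DiscClass.mk_eq_iff _ _).2 ⟨u, hu⟩).symm

section Sum

variable {R K : Type*} [CommRing R] [IsDomain R] [IsDiscreteValuationRing R] [QuadHenselian R]
  [Field K] [Algebra R K] [IsFractionRing R K] {m : GalRep K D4 → ℝ≥0∞}

theorem exists_roots {S : Type*} [CommRing S] [Algebra S (SeparableClosure K)]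
    (h2 : (2 : SeparableClosure K) ≠ 0) : ∃ η : DiscClass S → SeparableClosure K,
      ∀ c, η c ^ 2 = algebraMap S _ c.rep := by
  have : NeZero ((2 : ℕ) : SeparableClosure K) := ⟨by exact_mod_cast h2⟩
  exact ⟨fun c => (IsSepClosed.exists_pow_nat_eq (algebraMap S _ c.rep) 2).choose,
    fun c => (IsSepClosed.exists_pow_nat_eq (algebraMap S _ c.rep) 2).choose_spec⟩

theorem two_ne_zero_of_quadHenselian_of_isFractionRing (R : Type*) {K : Type*} [CommRing R]
    [IsDomain R] [IsDiscreteValuationRing R] [QuadHenselian R] [Field K] [Algebra R K]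
    [IsFractionRing R K] : (2 : K) ≠ 0 := by
  rw [← map_ofNat (algebraMap R K) 2, Ne, map_eq_zero_iff _ (IsFractionRing.injective R K)]
  exact two_ne_zero_of_quadHenselian

/-- The contribution of the representations that preserve the blocks. -/
theorem tsum_split (hm : ∀ ρ (δ : R), δ ≠ 0 →
      Ideal.span {a : R | ∃ b : Fin 4 → ρ.etaleAlgebra, (∀ i, IsIntegral R (b i)) ∧
        algebraMap R K a = Algebra.discr K b} = Ideal.span {δ} →
      m ρ = ENNReal.ofReal (idx δ : ℝ)⁻¹)
    {α : SeparableClosure K} (h0 : α ≠ 0) (hα : ∀ σ : AbsGal K, σ α = α) :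
    ∑' ρ : {ρ : GalRep K D4 // tag α ∈ ρ.etaleAlgebra}, m ρ =
      ENNReal.ofReal ((2 + 2 / (Nat.card (ResidueField R) : ℝ)) ^ 2) := by
  have h2R : (2 : R) ≠ 0 := two_ne_zero_of_quadHenselian
  have h2K : (2 : K) ≠ 0 := two_ne_zero_of_quadHenselian_of_isFractionRing R
  obtain ⟨η, hη⟩ := exists_roots (S := R) (K := K) (two_ne_zero_separableClosure (R := R) h2R)
  choose F hF hF' using fun p : DiscClass R × DiscClass R =>
    exists_rep_split hη h0 hα h2K p.1 p.2
  have hinj := algebraMap_separableClosure_injective R K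
  have hη0 : ∀ c, η c ≠ 0 := fun c => DiscClass.root_ne_zero hinj (hη c)
  let G : DiscClass R × DiscClass R → {ρ : GalRep K D4 // tag α ∈ ρ.etaleAlgebra} :=
    fun p => ⟨F p, hF p⟩
  -- Representations that preserve the blocks correspond to pairs of classes, one for each block.
  have hG : Function.Bijective G := by
    constructor
    · intro p p' h
      have h' : F p = F p' := congrArg Subtype.val h
      have h1 := hF' p'
      rw [← h'] at h1
      exact Prod.ext_iff.2 (eq_of_pt_mem_split hη h0 hα h2K (hF p) (hF' p) h1)
    · rintro ⟨ρ, hρ⟩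
      obtain ⟨β, β', h⟩ := exists_pt_mem_split hη h0 hα h2R h2K hρ
      exact ⟨(β, β'), Subtype.ext
        (rep_ext h2K h0 (hη0 β) (hη0 β') (hF (β, β')) hρ (hF' (β, β')) h)⟩
  rw [← (Equiv.ofBijective G hG).tsum_eq, tsum_fintype]
  have hterm : ∀ p, m (G p) =
      ENNReal.ofReal ((idx p.1.rep : ℝ)⁻¹ * (idx p.2.rep : ℝ)⁻¹) := by
    intro p
    rw [hm (F p) _ (mul_ne_zero p.1.rep_ne_zero p.2.rep_ne_zero)
      (span_discr_split (fun σ => mem_blockSubgroup_of_fixed h2K h0 (hF p) (hα σ)) (hη _) (hη _)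
        (hF' p)), idx_mul p.1.rep_ne_zero, Nat.cast_mul, mul_inv]
  change ∑ p, m (G p) = _
  rw [Finset.sum_congr rfl fun p _ => hterm p,
    ← ENNReal.ofReal_sum_of_nonneg fun p _ => by positivity, Fintype.sum_prod_type,
    ← sum_inv_idx, sq, Finset.sum_mul_sum]

variable [IsAdicComplete (maximalIdeal R) R]

/-- The contribution of the representations with a given quadratic subfield. -/
theorem tsum_inert (hm : ∀ ρ (δ : R), δ ≠ 0 →
      Ideal.span {a : R | ∃ b : Fin 4 → ρ.etaleAlgebra, (∀ i, IsIntegral R (b i)) ∧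
        algebraMap R K a = Algebra.discr K b} = Ideal.span {δ} →
      m ρ = ENNReal.ofReal (idx δ : ℝ)⁻¹)
    {w n : R} [IsQuadOrder w n] [Algebra (QuadraticAlgebra R (-n) w) (SeparableClosure K)]
    [IsScalarTower R (QuadraticAlgebra R (-n) w) (SeparableClosure K)] :
    ∑' ρ : {ρ : GalRep K D4 // tag (quadRoot K w n) ∈ ρ.etaleAlgebra}, m ρ =
      ENNReal.ofReal (2 * ((idx (w ^ 2 - 4 * n) : ℝ)⁻¹ ^ 2 *
        (2 + 2 / (Nat.card (ResidueField (QuadraticAlgebra R (-n) w)) : ℝ)))) := by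
  have h2R : (2 : R) ≠ 0 := two_ne_zero_of_quadHenselian
  have h2K : (2 : K) ≠ 0 := two_ne_zero_of_quadHenselian_of_isFractionRing R
  obtain ⟨η, hη⟩ := exists_roots (S := QuadraticAlgebra R (-n) w) (K := K)
    (two_ne_zero_separableClosure (R := R) h2R)
  obtain ⟨τ, hτ⟩ := exists_galois_quadRoot_eq_neg K w n
  have hinj := algebraMap_quadraticAlgebra_injective K w n
  have hη0 : ∀ c, η c ≠ 0 := fun c => DiscClass.root_ne_zero hinj (hη c)
  have hτη0 : ∀ c, τ (η c) ≠ 0 := fun c => (map_ne_zero τ).2 (hη0 c)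
  have hα0 := quadRoot_ne_zero (K := K) (w := w) (n := n) h2R
  -- The Boolean is the sign in z = ±τ(η β). Both signs give the same discriminant, whence the
  -- factor 2.
  let z : DiscClass (QuadraticAlgebra R (-n) w) × Bool → SeparableClosure K :=
    fun p => bif p.2 then τ (η p.1) else -τ (η p.1)
  have hz0 : ∀ p, z p ≠ 0 := by
    rintro ⟨β, _ | _⟩
    exacts [neg_ne_zero.2 (hτη0 β), hτη0 β]
  have hz : ∀ p, z p ^ 2 = algebraMap _ _ (star p.1.rep) := by
    rintro ⟨β, _ | _⟩
    exacts [(neg_sq _).trans (galois_conj_root_sq h2R hτ (hη β)), galois_conj_root_sq h2R hτ (hη β)]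
  choose F hF hF' using fun p : DiscClass (QuadraticAlgebra R (-n) w) × Bool =>
    exists_rep_inert h2R (hη0 p.1) (hz0 p) (hη p.1) (hz p)
  let G : DiscClass (QuadraticAlgebra R (-n) w) × Bool →
      {ρ : GalRep K D4 // tag (quadRoot K w n) ∈ ρ.etaleAlgebra} := fun p => ⟨F p, hF p⟩
  have hG : Function.Bijective G := by
    constructor
    · rintro ⟨β, b⟩ ⟨β', b'⟩ h
      have h' : F (β, b) = F (β', b') := congrArg Subtype.val h
      have h1 := hF' (β, b)
      have h3 := hF' (β', b')
      rw [← h'] at h3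
      obtain rfl : β = β' := eq_of_pt_mem_inert h2R (hF _) (hη _) (hη _) h1 h3
      have h4 := not_pt_mem_neg h2R (hF _) hτ (hη0 β) h1
      rcases b with _ | _ <;> rcases b' with _ | _
      · rfl
      · exact absurd (by simpa [z] using h3) h4
      · exact absurd h3 h4
      · rfl
    · rintro ⟨ρ, hρ⟩
      obtain ⟨β, h | h⟩ := exists_pt_mem_inert h2R hτ hη hρ
      · exact ⟨(β, true), Subtype.ext
          (rep_ext h2K hα0 (hη0 β) (hz0 (β, true)) (hF (β, true)) hρ (hF' (β, true)) h)⟩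
      · exact ⟨(β, false), Subtype.ext
          (rep_ext h2K hα0 (hη0 β) (hz0 (β, false)) (hF (β, false)) hρ (hF' (β, false)) h)⟩
  rw [← (Equiv.ofBijective G hG).tsum_eq, tsum_fintype]
  have hγ0 : w ^ 2 - 4 * n ≠ 0 := (IsQuadOrder.fund (w := w) (n := n)).ne_zero
    (IsDiscreteValuationRing.not_isField R)
  have hterm : ∀ p, m (G p) = ENNReal.ofReal ((idx (w ^ 2 - 4 * n) : ℝ)⁻¹ ^ 2 *
      (idx p.1.rep : ℝ)⁻¹) := by
    intro p
    have hN : QuadraticAlgebra.norm p.1.rep ≠ 0 := fun h =>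
      p.1.rep_ne_zero (norm_eq_zero_iff_of_isQuadOrder.1 h)
    rw [hm (F p) _ (mul_ne_zero (pow_ne_zero 2 hγ0) hN)
      (span_discr_inert (hF p) (hη _) (hz p) (hF' p)), idx_mul (pow_ne_zero 2 hγ0),
      idx_pow hγ0, ← idx_eq_idx_norm p.1.rep_ne_zero, Nat.cast_mul, mul_inv, Nat.cast_pow, inv_pow]
  change ∑ p, m (G p) = _
  rw [Finset.sum_congr rfl fun p _ => hterm p,
    ← ENNReal.ofReal_sum_of_nonneg fun p _ => by positivity, Fintype.sum_prod_type,
    ← sum_inv_idx, Finset.mul_sum, Finset.mul_sum]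
  simp only [Fintype.sum_bool, two_mul]

open Classical in
/-- The contribution of one class. -/
theorem tsum_class (hm : ∀ ρ (δ : R), δ ≠ 0 →
      Ideal.span {a : R | ∃ b : Fin 4 → ρ.etaleAlgebra, (∀ i, IsIntegral R (b i)) ∧
        algebraMap R K a = Algebra.discr K b} = Ideal.span {δ} →
      m ρ = ENNReal.ofReal (idx δ : ℝ)⁻¹)
    {c : DiscClass R} (hc : c ≠ DiscClass.mk isFundDisc_one) {α : SeparableClosure K}
    (hα : α ^ 2 = algebraMap R _ c.rep) :
    ∑' ρ : {ρ : GalRep K D4 // tag α ∈ ρ.etaleAlgebra}, m ρ =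
      ENNReal.ofReal (2 * ((idx c.rep : ℝ)⁻¹ ^ 2 *
        (2 + 2 / (if IsUnit c.rep then (Nat.card (ResidueField R) : ℝ) ^ 2
          else Nat.card (ResidueField R))))) := by
  obtain ⟨w, n, hwn⟩ := c.rep_fund.1
  have hq := isQuadOrder_of_ne hc hwn
  have h2 : (2 : SeparableClosure K) ≠ 0 :=
    two_ne_zero_separableClosure (R := R) two_ne_zero_of_quadHenselian
  -- The order is embedded by ω ↦ (w + α)/2, so that the root 2ω − w is the given α.
  have hω : (algebraMap R (SeparableClosure K) w + α) / 2 *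
      ((algebraMap R (SeparableClosure K) w + α) / 2) =
      (-n) • 1 + w • ((algebraMap R (SeparableClosure K) w + α) / 2) := by
    rw [Algebra.smul_def, Algebra.smul_def, map_neg]
    rw [hwn, map_sub, map_mul, map_pow, map_ofNat] at hα
    field_simp
    linear_combination hα
  let f : QuadraticAlgebra R (-n) w →ₐ[R] SeparableClosure K := QuadraticAlgebra.lift ⟨_, hω⟩
  let _ : Algebra (QuadraticAlgebra R (-n) w) (SeparableClosure K) := f.toAlgebra
  have _ : IsScalarTower R (QuadraticAlgebra R (-n) w) (SeparableClosure K) :=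
    IsScalarTower.of_algHom f
  have hroot : quadRoot K w n = α := by
    change (-w) • 1 + (2 : R) • ((algebraMap R (SeparableClosure K) w + α) / 2) = α
    rw [Algebra.smul_def, Algebra.smul_def, map_neg, map_ofNat]
    field_simp
    ring
  have := tsum_inert hm (w := w) (n := n)
  rw [hroot] at this
  rw [this]
  congr 4
  · rw [hwn]
  · congr 1
    split_ifs with hu
    · rw [hwn] at hu
      rw [card_residueField_of_isUnit hu, Nat.cast_pow]
    · rw [hwn] at hu
      rw [card_residueField_of_not_isUnit hu]

open Classical in
/-- The total mass in terms of the sums over the classes of discriminants. -/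
theorem tsum_eq_of_sum_unit (hm : ∀ ρ (δ : R), δ ≠ 0 →
      Ideal.span {a : R | ∃ b : Fin 4 → ρ.etaleAlgebra, (∀ i, IsIntegral R (b i)) ∧
        algebraMap R K a = Algebra.discr K b} = Ideal.span {δ} →
      m ρ = ENNReal.ofReal (idx δ : ℝ)⁻¹)
    (hU : ∑ c : DiscClass R with IsUnit c.rep, (idx c.rep : ℝ)⁻¹ = 2) {T : ℝ}
    (hT : ∑ c : DiscClass R with ¬ IsUnit c.rep, (idx c.rep : ℝ)⁻¹ ^ 2 = T) :
    ∑' ρ, m ρ = ENNReal.ofReal ((2 + 2 / (Nat.card (ResidueField R) : ℝ)) ^ 2 +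
      2 * (2 + 2 / (Nat.card (ResidueField R) : ℝ) ^ 2) +
      2 * T * (2 + 2 / (Nat.card (ResidueField R) : ℝ))) := by
  have h2R : (2 : R) ≠ 0 := two_ne_zero_of_quadHenselian
  have hinj := algebraMap_separableClosure_injective R K
  obtain ⟨η, hη⟩ := exists_roots (S := R) (K := K) (two_ne_zero_separableClosure (R := R) h2R)
  choose κ hκ using exists_class_tag_mem (K := K) h2R hη
  have hiff : ∀ c ρ, κ ρ = c ↔ tag (η c) ∈ ρ.etaleAlgebra := fun c ρ =>
    ⟨fun h => h ▸ hκ ρ, fun h => class_eq_of_tag_mem (hη _) (hη _) (hκ ρ) h⟩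
  set c₁ : DiscClass R := DiscClass.mk isFundDisc_one with hc₁
  set q : ℝ := (Nat.card (ResidueField R) : ℝ) with hq
  have hfix : ∀ σ : AbsGal K, σ (η c₁) = η c₁ := by
    intro σ
    obtain ⟨u, hu⟩ := (DiscClass.mk_eq_iff isFundDisc_one c₁).1 rfl
    have h1 : (algebraMap R (SeparableClosure K) u * η c₁) ^ 2 = 1 := by
      rw [mul_pow, hη, ← map_pow, ← map_mul, ← hu, map_one]
    have hu0 : algebraMap R (SeparableClosure K) u ≠ 0 := by
      rw [Ne, map_eq_zero_iff _ hinj]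
      exact u.ne_zero
    apply mul_left_cancel₀ hu0
    conv_lhs => rw [← galois_algebraMap σ (u : R), ← map_mul]
    rcases sq_eq_sq_iff_eq_or_eq_neg.1 (h1.trans (one_pow 2).symm) with h | h <;> simp [h]
  have hmain : ∀ c, ∑' ρ : {ρ // κ ρ = c}, m ρ =
      ENNReal.ofReal (if c = c₁ then (2 + 2 / q) ^ 2 else 2 * ((idx c.rep : ℝ)⁻¹ ^ 2 *
        (2 + 2 / (if IsUnit c.rep then q ^ 2 else q)))) := by
    intro c
    rw [← (Equiv.subtypeEquivRight (hiff c)).symm.tsum_eq]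
    change ∑' ρ : {ρ : GalRep K D4 // tag (η c) ∈ ρ.etaleAlgebra}, m ρ = _
    split_ifs with h hu
    · subst h
      exact tsum_split hm (DiscClass.root_ne_zero hinj (hη _)) hfix
    · rw [tsum_class hm h (hη c), if_pos hu]
    · rw [tsum_class hm h (hη c), if_neg hu]
  rw [← (Equiv.sigmaFiberEquiv κ).tsum_eq, ENNReal.tsum_sigma']
  change ∑' c, ∑' ρ : {ρ // κ ρ = c}, m ρ = _
  rw [tsum_congr hmain, tsum_fintype, ← ENNReal.ofReal_sum_of_nonneg (fun c _ => by
    split_ifs <;> positivity)]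
  congr 1
  have hu1 : IsUnit c₁.rep := by
    obtain ⟨u, hu⟩ := (DiscClass.mk_eq_iff isFundDisc_one c₁).1 rfl
    exact isUnit_of_mul_isUnit_right (hu ▸ isUnit_one)
  have hidx : ∀ c : DiscClass R, IsUnit c.rep → (idx c.rep : ℝ)⁻¹ = 1 := fun c hc => by
    rw [idx_of_isUnit hc]; simp
  -- The class of 1 is first counted like the unramified field, and the difference is added as a
  -- correction. The sums over units and non-units can then be inserted.
  have hsplit : ∀ c : DiscClass R, (if c = c₁ then (2 + 2 / q) ^ 2 else 2 * ((idx c.rep : ℝ)⁻¹ ^ 2 *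
        (2 + 2 / (if IsUnit c.rep then q ^ 2 else q)))) =
      (if c = c₁ then (2 + 2 / q) ^ 2 - 2 * (2 + 2 / q ^ 2) else 0) +
      (if IsUnit c.rep then (idx c.rep : ℝ)⁻¹ else 0) * (2 * (2 + 2 / q ^ 2)) +
      (if ¬ IsUnit c.rep then (idx c.rep : ℝ)⁻¹ ^ 2 else 0) * (2 * (2 + 2 / q)) := by
    intro c
    by_cases h : c = c₁
    · have hu : IsUnit c.rep := h ▸ hu1
      rw [if_pos h, if_pos h, if_pos hu, if_neg (not_not.2 hu), hidx c hu]
      ring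
    · by_cases hu : IsUnit c.rep
      · rw [if_neg h, if_neg h, if_pos hu, if_pos hu, if_neg (not_not.2 hu), hidx c hu]
        ring
      · rw [if_neg h, if_neg h, if_neg hu, if_neg hu, if_pos hu]
        ring
  rw [Finset.sum_congr rfl fun c _ => hsplit c, Finset.sum_add_distrib, Finset.sum_add_distrib,
    ← Finset.sum_mul, ← Finset.sum_mul, (Finset.sum_filter _ _).symm.trans hU,
    (Finset.sum_filter _ _).symm.trans hT, Finset.sum_ite_eq' Finset.univ c₁,
    if_pos (Finset.mem_univ _)]
  ring

end Sum

end LocalMass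

/-! ### Local fields and the total mass for odd q. -/

namespace LocalMass

open IsLocalRing ValuativeRel

theorem card_residueField_pow_multiplicity {R : Type*} [CommRing R] [IsDomain R]
    [IsDiscreteValuationRing R] {δ : R} (hδ : δ ≠ 0) :
    Nat.card (ResidueField R) ^ multiplicity (maximalIdeal R) (Ideal.span {δ}) = idx δ := by
  obtain ⟨π, hπ⟩ := IsDiscreteValuationRing.exists_irreducible R
  obtain ⟨k, u, rfl⟩ := IsDiscreteValuationRing.eq_unit_mul_pow_irreducible hδ hπ
  have h0 : maximalIdeal R ≠ 0 := by
    rw [hπ.maximalIdeal_eq, Ne, Ideal.zero_eq_bot, Ideal.span_singleton_eq_bot]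
    exact hπ.ne_zero
  have h1 : ¬ IsUnit (maximalIdeal R) := by
    rw [Ideal.isUnit_iff]
    exact Ideal.IsPrime.ne_top'
  rw [Ideal.span_singleton_mul_left_unit u.isUnit, ← Ideal.span_singleton_pow,
    ← hπ.maximalIdeal_eq, multiplicity_pow_self h0 h1, idx_unit_mul, idx_pow hπ.ne_zero,
    idx_irreducible hπ]

section LocalField

variable (K : Type*) [Field K] [ValuativeRel K] [TopologicalSpace K] [IsNonarchimedeanLocalField K]

instance isAdicComplete_integer : IsAdicComplete (maximalIdeal 𝒪[K]) 𝒪[K] := by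
  let := IsTopologicalAddGroup.rightUniformSpace K
  have := isUniformAddGroup_of_addCommGroup (G := K)
  infer_instance

theorem residueCard_pos : 0 < residueCard K := Nat.card_pos

theorem one_div_pow_discExponent (ρ : GalRep K D4) {δ : 𝒪[K]} (hδ : δ ≠ 0)
    (h : Ideal.span {a : 𝒪[K] | ∃ b : Fin 4 → ρ.etaleAlgebra, (∀ i, IsIntegral 𝒪[K] (b i)) ∧
        algebraMap 𝒪[K] K a = Algebra.discr K b} = Ideal.span {δ}) :
    1 / (residueCard K : ℝ≥0∞) ^ (discCounting D4).toFun K ρ =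
      ENNReal.ofReal (idx δ : ℝ)⁻¹ := by
  have h1 : ρ.discIdeal = Ideal.span {δ} := h
  have h2 : residueCard K ^ (discCounting D4).toFun K ρ = idx δ := by
    rw [← card_residueField_pow_multiplicity hδ, ← h1]
    rfl
  have h3 : (0 : ℝ) < idx δ := by
    rw [← h2]
    exact_mod_cast pow_pos (residueCard_pos K) _
  rw [ENNReal.ofReal_inv_of_pos h3, ENNReal.ofReal_natCast, one_div, ← h2, Nat.cast_pow]

open Classical in
theorem mass_eq [QuadHenselian 𝒪[K]]
    (hU : ∑ c : DiscClass 𝒪[K] with IsUnit c.rep, (idx c.rep : ℝ)⁻¹ = 2) {T : ℝ}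
    (hT : ∑ c : DiscClass 𝒪[K] with ¬ IsUnit c.rep, (idx c.rep : ℝ)⁻¹ ^ 2 = T) :
    mass K (discCounting D4) = ENNReal.ofReal ((2 + 2 / (residueCard K : ℝ)) ^ 2 +
      2 * (2 + 2 / (residueCard K : ℝ) ^ 2) + 2 * T * (2 + 2 / (residueCard K : ℝ))) :=
  tsum_eq_of_sum_unit (R := 𝒪[K]) (fun ρ _ => one_div_pow_discExponent K ρ) hU hT

/-- If 2 is not a unit, then 1 has additive order 2 in the residue field, and q is even. -/
theorem isUnit_two_of_odd (h : Odd (residueCard K)) : IsUnit (2 : 𝒪[K]) := by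
  by_contra h2
  have h3 : (2 : 𝓀[K]) = 0 := by
    rw [← map_ofNat (residue 𝒪[K]) 2, residue_eq_zero_iff]
    exact h2
  have h4 : addOrderOf (1 : 𝓀[K]) = 2 :=
    addOrderOf_eq_prime (by rw [nsmul_one]; exact_mod_cast h3) one_ne_zero
  exact (Nat.not_even_iff_odd.2 h) (even_iff_two_dvd.2 (h4 ▸ addOrderOf_dvd_natCard _))

/-- The total mass in odd residue characteristic. -/
theorem mass_of_odd (h : Odd (residueCard K)) :
    mass K (discCounting D4) = ENNReal.ofReal (8 + 8 / (residueCard K : ℝ) +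
      16 / (residueCard K : ℝ) ^ 2 + 8 / (residueCard K : ℝ) ^ 3) := by
  classical
  have h2 := isUnit_two_of_odd K h
  have := QuadHenselian.of_isAdicComplete 𝒪[K] h2.ne_zero
  have hq : (residueCard K : ℝ) ≠ 0 := by exact_mod_cast (residueCard_pos K).ne'
  -- The total is 4 + 8/q + 4/q² from F = K × K, 4 + 4/q² from the unramified field and 8/q² + 8/q³
  -- from the ramified ones.
  rw [mass_eq K (T := 2 / (residueCard K : ℝ) ^ 2)
    (by convert sum_unit_of_isUnit_two h2) (by convert sum_not_unit_sq_of_isUnit_two h2; rfl)]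
  congr 1
  field_simp
  ring

end LocalField

/-! ### The 2-adic mass and the failure of a mass formula. -/

section Padic

variable (p : ℕ) [Fact p.Prime]

theorem padic_mem_integer_iff (x : ℚ_[p]) : x ∈ 𝒪[ℚ_[p]] ↔ ‖x‖ ≤ 1 := by
  rw [Valuation.mem_integer_iff, ← not_lt, ← map_one (valuation ℚ_[p]), padic_valuation_lt_iff,
    norm_one, not_lt]

/-- The ring of integers of `ℚ_[p]` is `ℤ_[p]`. -/
noncomputable def padicIntegerEquiv : 𝒪[ℚ_[p]] ≃+* ℤ_[p] where
  toFun x := ⟨x, (padic_mem_integer_iff p _).1 x.2⟩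
  invFun x := ⟨x, (padic_mem_integer_iff p _).2 x.2⟩
  left_inv _ := rfl
  right_inv _ := rfl
  map_mul' _ _ := rfl
  map_add' _ _ := rfl

theorem residueCard_padic : residueCard ℚ_[p] = p := by
  rw [residueCard, Nat.card_congr ((ResidueField.mapEquiv (padicIntegerEquiv p)).trans
    PadicInt.residueField).toEquiv, Nat.card_zmod]

theorem irreducible_two_integer_padic : Irreducible (2 : 𝒪[ℚ_[2]]) := by
  rw [← MulEquiv.irreducible_iff (padicIntegerEquiv 2)]
  have h := PadicInt.irreducible_p (p := 2)
  rwa [map_ofNat]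

/-- With q = 2 and T = 3/16 the three contributions are 9, 5 and 9/8. -/
theorem mass_padic_two : mass ℚ_[2] (discCounting D4) = ENNReal.ofReal (121 / 8) := by
  classical
  have h2 := irreducible_two_integer_padic
  have := QuadHenselian.of_isAdicComplete 𝒪[ℚ_[2]] h2.ne_zero
  have hq : Nat.card 𝓀[ℚ_[2]] = 2 := residueCard_padic 2
  rw [mass_eq ℚ_[2] (T := 3 / 16)
    (by convert sum_unit_of_dyadic h2 hq) (by convert sum_not_unit_sq_of_dyadic h2 hq),
    residueCard_padic]
  congr 1
  norm_num

/-- A mass formula f agrees with 8 + 8x + 16x² + 8x³ at 1/p for infinitely many odd primes p, hence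
equals it. At x = 1/2 this gives 17 and not 121/8. -/
theorem not_hasMassFormula : ¬ HasMassFormula.{0} (discCounting D4) := by
  rintro ⟨f, hf⟩
  have h2 := (hf ℚ_[2]).2
  rw [mass_padic_two, residueCard_padic, ENNReal.toReal_ofReal (by norm_num)] at h2
  open Polynomial in
  have key : f.map (algebraMap ℤ ℝ) = C 8 + C 8 * X + C 16 * X ^ 2 + C 8 * X ^ 3 := by
    refine Polynomial.eq_of_infinite_eval_eq _ _ ?_
    have hinf : (Set.Ioi 2 ∩ {p : ℕ | p.Prime}).Infinite := by
      rw [Set.inter_comm]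
      refine Set.infinite_of_not_bddAbove fun ⟨N, hN⟩ => ?_
      obtain ⟨p, hp, hp'⟩ := Nat.exists_infinite_primes (N + 3)
      have := hN ⟨hp', show 2 < p by omega⟩
      omega
    refine (hinf.image (f := fun p : ℕ => 1 / (p : ℝ)) ?_).mono ?_
    · intro a _ b _ hab
      simpa using hab
    · rintro _ ⟨p, ⟨hp2, hp⟩, rfl⟩
      have : Fact p.Prime := ⟨hp⟩
      have hodd : Odd (residueCard ℚ_[p]) := by
        rw [residueCard_padic]
        exact hp.odd_of_ne_two (ne_of_gt hp2)
      have h3 := (hf ℚ_[p]).2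
      rw [mass_of_odd _ hodd, residueCard_padic, ENNReal.toReal_ofReal (by positivity),
        Polynomial.aeval_def, ← Polynomial.eval_map] at h3
      rw [Set.mem_ofPred_eq, ← h3]
      simp
      ring
  rw [Polynomial.aeval_def, ← Polynomial.eval_map, key] at h2
  norm_num at h2

end Padic

end LocalMass

theorem mainTheorem6 :
    (∀ (K : Type*) [Field K] [ValuativeRel K] [TopologicalSpace K] [IsNonarchimedeanLocalField K],
      Odd (LocalMass.residueCard K) →
        LocalMass.mass K (LocalMass.discCounting LocalMass.D4) =
          8 + 8 / (LocalMass.residueCard K : ℝ≥0∞) + 16 / (LocalMass.residueCard K : ℝ≥0∞) ^ 2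
            + 8 / (LocalMass.residueCard K : ℝ≥0∞) ^ 3) ∧
    (8 + 8 / 2 + 16 / 2 ^ 2 + 8 / 2 ^ 3 : ℝ) = 17 ∧
    LocalMass.residueCard ℚ_[2] = 2 ∧
    LocalMass.mass ℚ_[2] (LocalMass.discCounting LocalMass.D4) = 121 / 8 ∧
    ¬ LocalMass.HasMassFormula.{0} (LocalMass.discCounting LocalMass.D4) := by
  refine ⟨fun K _ _ _ _ h => ?_, by norm_num, LocalMass.residueCard_padic 2, ?_,
    LocalMass.not_hasMassFormula⟩
  · have hq : (0 : ℝ) < LocalMass.residueCard K := by exact_mod_cast LocalMass.residueCard_pos K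
    rw [LocalMass.mass_of_odd K h, ENNReal.ofReal_add (by positivity) (by positivity),
      ENNReal.ofReal_add (by positivity) (by positivity),
      ENNReal.ofReal_add (by positivity) (by positivity),
      ENNReal.ofReal_div_of_pos hq, ENNReal.ofReal_div_of_pos (by positivity),
      ENNReal.ofReal_div_of_pos (by positivity), ENNReal.ofReal_pow hq.le, ENNReal.ofReal_pow hq.le,
      ENNReal.ofReal_natCast]
    norm_num
  · rw [LocalMass.mass_padic_two, ENNReal.ofReal_div_of_pos (by norm_num)]
    norm_num
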